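/- Let $M\ge 1$ be an integer. For $q\in(1,M+1]$ a sequence $(x_i)_{i\ge1}\in\{0,1,\dots,M\}^{\infty}$ is a $q$-expansion of $\pi_q((x_i)):=\sum_{i\ge1}x_iq^{-i}$. Let $\mathbf U_q$ be the set of all $(x_i)\in\{0,\dots,M\}^\infty$ that are the only $q$-expansion of $\pi_q((x_i))$, let $B_n(\mathbf U_q)$ be the set of words of length $n$ occurring in sequences of $\mathbf U_q$, and let $$H(q):=\lim_{n\to\infty}\frac{\log_{M+1}\#B_n(\mathbf U_q)}{n}$$ be the topological entropy of $\mathbf U_q$. The bifurcation set is $$\mathcal E:=\{q\in(1,M+1]:\ \forall\varepsilon>0\ \exists p\in(q-\varepsilon,q+\varepsilon)\cap(1,M+1]\text{ with }H(p)\ne H(q)\}.$$ Sequences are ordered lexicographically ($\prec,\preccurlyeq$), $\sigma$ is the left shift, and $\overline{\,\cdot\,}$ replaces each digit $c$ of a sequence or word by $M-c$. For a word $w=w_1\dots w_n$ put $w^-:=w_1\dots w_{n-1}(w_n-1)$ if $w_n>0$ and $w^+:=w_1\dots w_{n-1}(w_n+1)$ if $w_n<M$. For $q\in(1,M+1]$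 let $\alpha(q)$ be the quasi-greedy $q$-expansion of $1$, i.e. the lexicographically largest $q$-expansion of $1$ with infinitely many non-zero digits. Let $\mathbf V$ be the set of $(a_i)\in\{0,\dots,M\}^\infty$ with $\overline{(a_i)}\preccurlyeq\sigma^n((a_i))\preccurlyeq(a_i)$ for all $n\ge0$. Let $(\tau_i)_{i\ge0}$ be the Thue-Morse sequence ($\tau_0=0$, $\tau_{2i}=\tau_i$, $\tau_{2i+1}=1-\tau_i$), and for $i\ge1$ let $\lambda_i:=k+\tau_i-\tau_{i-1}$ if $M=2k$, and $\lambda_i:=k+\tau_i$ if $M=2k+1$. The Komornik-Loreti constant $q_c\in(1,M+1]$ is the base with $\alpha(q_c)=(\lambda_i)$. For $n\ge1$ let $\xi(n):=\lambda_1\dots\lambda_L(\overline{\lambda_1\dots\lambda_L}^{\,+})^\infty$, where $L=2^{n-1}$ if $M$ is even and $L=2^n$ if $M$ is odd. A sequence $(a_i)\in\mathbf V$ is irreducible if, for every $j\ge1$ with $a_j>0$ and $(a_1\dots a_j^-)^\infty\in\mathbf V$, $$a_1\dots a_j(\overline{a_1\dots a_j}^{\,+})^\infty\prec(a_i).\qquad(1)$$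 It is $*$-irreducible if for some $n\ge1$ one has $\xi(n+1)\preccurlyeq(a_i)\prec\xi(n)$, and (1) holds for every $j$ with $a_j>0$, $(a_1\dots a_j^-)^\infty\in\mathbf V$ and $j>2^n$ (if $M$ is even), respectively $j>2^{n+1}$ (if $M$ is odd). Then: 1. $\mathcal E=\overline{\{q\in(q_c,M+1]:\alpha(q)\text{ is irreducible or }*\text{-irreducible}\}}$, where the bar denotes the closure in $\mathbb R$; 2. $\mathcal E$ is a Cantor set (a nonempty compact set with empty interior and no isolated points), and its Hausdorff dimension is $\dim_H\mathcal E=1$. -/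

import Mathlib

open Filter Topology

namespace UniqueExpansions

/-! ### Sequences and words over the alphabet `{0, 1, …, M}`

A sequence `c₁c₂…` is a function `c : ℕ → Fin (M + 1)`, with `c i` standing for the term of
index `i + 1`. Sequences are compared in the lexicographic order, which is Mathlib's order on
`Lex (ℕ → Fin (M + 1))`. A word of length `m` is given by the first `m` terms of a sequence. -/

/-- One-sided sequences with digits in `{0, 1, …, M}`. -/
abbrev Sequ (M : ℕ) : Type := ℕ → Fin (M + 1)

/-- The `n`-th iterate of the left shift. -/
def shift {M : ℕ} (n : ℕ) (c : Sequ M) : Sequ M := fun i => c (n + i)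

/-- The reflection `(M - c₁)(M - c₂)…` (`Fin.rev d` is `M - d`). -/
def reflect {M : ℕ} (c : Sequ M) : Sequ M := fun i => (c i).rev

/-- `(u₁…uₘ)^∞`. -/
def cyc {M : ℕ} (m : ℕ) (u : Sequ M) : Sequ M := fun i => u (i % m)

/-- `u₁…uₘ v₁v₂…`. -/
def concat {M : ℕ} (m : ℕ) (u v : Sequ M) : Sequ M := fun i => if i < m then u i else v (i - m)

/-- The word `u₁…uₘ⁻ = u₁…uₘ₋₁(uₘ - 1)`; meaningful for `m ≥ 1` and `uₘ > 0`. -/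
def lastPred {M : ℕ} (m : ℕ) (u : Sequ M) : Sequ M := Function.update u (m - 1) (u (m - 1) - 1)

/-- The word `u₁…uₘ⁺ = u₁…uₘ₋₁(uₘ + 1)`; meaningful for `m ≥ 1` and `uₘ < M`. -/
def lastSucc {M : ℕ} (m : ℕ) (u : Sequ M) : Sequ M := Function.update u (m - 1) (u (m - 1) + 1)

/-! ### Expansions, univoque sets and entropy -/

/-- `π_q((cᵢ)) = ∑_{i ≥ 1} cᵢ / q ^ i`, the number with `q`-expansion `(cᵢ)` (used for `q > 1`,
where the series converges). -/
noncomputable def expand {M : ℕ} (q : ℝ) (c : Sequ M) : ℝ :=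
  ∑' i : ℕ, ((c i : ℕ) : ℝ) / q ^ (i + 1)

/-- The univoque set: the numbers with exactly one `q`-expansion over `{0, …, M}`. -/
def univoqueSet (M : ℕ) (q : ℝ) : Set ℝ := {x | ∃! c : Sequ M, expand q c = x}

/-- The set of all `q`-expansions of the numbers in the univoque set. -/
def univoqueSeqs (M : ℕ) (q : ℝ) : Set (Sequ M) := expand q ⁻¹' univoqueSet M q

/-- `B_n(X)`: the words of length `n` that occur, at any place, in some sequence of `X`. -/
def words {M : ℕ} (n : ℕ) (X : Set (Sequ M)) : Set (Fin n → Fin (M + 1)) :=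
  {w | ∃ c ∈ X, ∃ k : ℕ, ∀ i : Fin n, w i = c (k + i)}

/-- Topological entropy `lim (log #B_n(X)) / n`, with logarithms in base `M + 1`. The limit
exists for every nonempty `X`, see `tendsto_entropy`. -/
noncomputable def entropy {M : ℕ} (X : Set (Sequ M)) : ℝ :=
  limUnder atTop fun n : ℕ => Real.logb ((M : ℝ) + 1) ((words n X).ncard : ℝ) / (n : ℝ)

theorem words_nonempty {M : ℕ} {X : Set (Sequ M)} (hX : X.Nonempty) (n : ℕ) :
    (words n X).Nonempty := by
  obtain ⟨c, hc⟩ := hX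
  exact ⟨fun i => c (0 + i), c, hc, 0, fun _ => rfl⟩

theorem words_ncard_add_le {M : ℕ} (X : Set (Sequ M)) (m n : ℕ) :
    (words (m + n) X).ncard ≤ (words m X).ncard * (words n X).ncard := by
  rw [← Set.ncard_prod]
  refine Set.ncard_le_ncard_of_injOn
    (fun w => (fun i => w (Fin.castAdd n i), fun i => w (Fin.natAdd m i))) ?_ ?_ (Set.toFinite _)
  · rintro w ⟨c, hc, k, hk⟩
    refine ⟨⟨c, hc, k, fun i => ?_⟩, ⟨c, hc, k + m, fun i => ?_⟩⟩
    · simp [hk]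
    · simp [hk, add_assoc]
  · intro w _ w' _ h
    simp only [Prod.mk.injEq] at h
    funext i
    refine Fin.addCases (fun i => ?_) (fun i => ?_) i
    · exact congrFun h.1 i
    · exact congrFun h.2 i

/-- The limit in the definition of the entropy exists. -/
theorem tendsto_entropy {M : ℕ} {X : Set (Sequ M)} (hX : X.Nonempty) :
    Tendsto (fun n : ℕ => Real.logb ((M : ℝ) + 1) ((words n X).ncard : ℝ) / (n : ℝ)) atTop
      (𝓝 (entropy X)) := by
  have hpos : ∀ n, 1 ≤ (words n X).ncard := fun n =>
    (Set.ncard_pos (Set.toFinite _)).2 (words_nonempty hX n)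
  have hposR : ∀ n, (1 : ℝ) ≤ ((words n X).ncard : ℝ) := fun n => by exact_mod_cast hpos n
  have hb : (0 : ℝ) ≤ Real.log ((M : ℝ) + 1) := Real.log_nonneg (by simp)
  have hsub : Subadditive fun n : ℕ => Real.logb ((M : ℝ) + 1) ((words n X).ncard : ℝ) := by
    intro m n
    have h1 : ((words (m + n) X).ncard : ℝ) ≤ ((words m X).ncard : ℝ) * ((words n X).ncard : ℝ) := by
      exact_mod_cast words_ncard_add_le X m n
    have h2 := Real.log_le_log (by linarith [hposR (m + n)]) h1
    rw [Real.log_mul (by linarith [hposR m]) (by linarith [hposR n])] at h2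
    simp only [Real.logb]
    rw [← add_div]
    exact div_le_div_of_nonneg_right h2 hb
  have hbdd : BddBelow (Set.range fun n : ℕ =>
      Real.logb ((M : ℝ) + 1) ((words n X).ncard : ℝ) / (n : ℝ)) := by
    refine ⟨0, ?_⟩
    rintro _ ⟨n, rfl⟩
    exact div_nonneg (div_nonneg (Real.log_nonneg (hposR n)) hb) (Nat.cast_nonneg n)
  exact tendsto_nhds_limUnder ⟨_, hsub.tendsto_lim hbdd⟩

/-- `H(q)`, the topological entropy of the set of unique `q`-expansions. -/
noncomputable def H (M : ℕ) (q : ℝ) : ℝ := entropy (univoqueSeqs M q)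

/-- The bifurcation set: the bases in `(1, M + 1]` (the domain of `H`) at which `H` is not
locally constant. -/
def bifurcationSet (M : ℕ) : Set ℝ :=
  {q | q ∈ Set.Ioc (1 : ℝ) (M + 1) ∧
    ∀ ε > 0, ∃ p ∈ Set.Ioc (1 : ℝ) (M + 1), p ∈ Set.Ioo (q - ε) (q + ε) ∧ H M p ≠ H M q}

/-! ### Quasi-greedy expansions and the Komornik-Loreti constant -/

/-- The infinite sequences: those that do not end with an infinite string of zeros. -/
def IsInfinite {M : ℕ} (c : Sequ M) : Prop := ∀ n, ∃ i, n ≤ i ∧ c i ≠ 0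

/-- `a = α(q)`: `a` is the quasi-greedy `q`-expansion of `1`, that is, the lexicographically
largest infinite `q`-expansion of `1`. -/
def IsQuasiGreedy {M : ℕ} (q : ℝ) (a : Sequ M) : Prop :=
  (IsInfinite a ∧ expand q a = 1) ∧
    ∀ b : Sequ M, IsInfinite b → expand q b = 1 → toLex b ≤ toLex a

/-- The Thue-Morse sequence `τ₀τ₁τ₂… = 01101001…`. -/
def thueMorse : ℕ → ℕ
  | 0 => 0
  | n + 1 => if (n + 1) % 2 = 0 then thueMorse ((n + 1) / 2) else 1 - thueMorse ((n + 1) / 2)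

theorem thueMorse_zero : thueMorse 0 = 0 := by rw [thueMorse]

theorem thueMorse_two_mul (i : ℕ) : thueMorse (2 * i) = thueMorse i := by
  rcases i with _ | i
  · rfl
  · rw [show 2 * (i + 1) = (2 * i + 1) + 1 by ring, thueMorse, if_pos (by omega)]
    congr 1
    omega

theorem thueMorse_two_mul_add_one (i : ℕ) : thueMorse (2 * i + 1) = 1 - thueMorse i := by
  rw [thueMorse, if_neg (by omega)]
  congr 2
  omega

/-- The generalized Thue-Morse sequence: its term of index `i ≥ 1` (here `i - 1`) is
`k + τᵢ - τᵢ₋₁` if `M = 2k` and `k + τᵢ` if `M = 2k + 1`. For `M ≥ 1` these numbers lie in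
`{0, …, M}`. -/
def genThueMorse (M : ℕ) : Sequ M := fun i =>
  if Even M then Fin.ofNat (M + 1) (M / 2 + thueMorse (i + 1) - thueMorse i)
  else Fin.ofNat (M + 1) (M / 2 + thueMorse (i + 1))

/-- The Komornik-Loreti constant `q_c`: the base in `(1, M + 1]` whose quasi-greedy expansion
of `1` is the generalized Thue-Morse sequence. There is exactly one such base, so that the
infimum is taken over a one-point set. -/
noncomputable def komornikLoreti (M : ℕ) : ℝ :=
  sInf {q | q ∈ Set.Ioc (1 : ℝ) (M + 1) ∧ IsQuasiGreedy q (genThueMorse M)}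

/-! ### Irreducible and star-irreducible sequences -/

/-- The sequences `a` with `reflect a ≼ σⁿ(a) ≼ a` for all `n ≥ 0`. -/
def seqV (M : ℕ) : Set (Sequ M) :=
  {a | ∀ n, toLex (reflect a) ≤ toLex (shift n a) ∧ toLex (shift n a) ≤ toLex a}

/-- The condition at `j ≥ 1`: if `(a₁…aⱼ⁻)^∞` is (defined and) in `seqV M`, then
`a₁…aⱼ (w⁺)^∞ ≺ a`, where `w` is the reflection of `a₁…aⱼ`. -/
def IrredAt {M : ℕ} (a : Sequ M) (j : ℕ) : Prop :=
  0 < a (j - 1) → cyc j (lastPred j a) ∈ seqV M →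
    toLex (concat j a (cyc j (lastSucc j (reflect a)))) < toLex a

/-- Irreducible sequences. -/
def IsIrreducible {M : ℕ} (a : Sequ M) : Prop :=
  a ∈ seqV M ∧ ∀ j, 1 ≤ j → IrredAt a j

/-- The length `2 ^ (n - 1)` (if `M` is even) or `2 ^ n` (if `M` is odd), for `n ≥ 1`. -/
def blockLen (M n : ℕ) : ℕ := if Even M then 2 ^ (n - 1) else 2 ^ n

/-- The sequence `ξ(n) = t₁…t_L (w⁺)^∞`, for `n ≥ 1`, where `(tᵢ)` is the generalized
Thue-Morse sequence, `L = blockLen M n`, and `w` is the reflection of `t₁…t_L`. -/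
def xi (M n : ℕ) : Sequ M :=
  concat (blockLen M n) (genThueMorse M)
    (cyc (blockLen M n) (lastSucc (blockLen M n) (reflect (genThueMorse M))))

/-- `*`-irreducible sequences. -/
def IsStarIrreducible {M : ℕ} (a : Sequ M) : Prop :=
  a ∈ seqV M ∧ ∃ n, 1 ≤ n ∧ toLex (xi M (n + 1)) ≤ toLex a ∧ toLex a < toLex (xi M n) ∧
    ∀ j, (if Even M then 2 ^ n else 2 ^ (n + 1)) < j → IrredAt a j

/-! ### Cantor sets -/

/-- A Cantor set in the real line: a nonempty compact set with empty interior and no isolated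
points. -/
def IsCantorSet (E : Set ℝ) : Prop :=
  E.Nonempty ∧ IsCompact E ∧ interior E = ∅ ∧ ∀ x ∈ E, AccPt x (𝓟 E)

end UniqueExpansions

/-!
The entropy `H q` only depends on the subshift of all sequences whose tails lie strictly between
the reflection of `α(q)` and `α(q)`: apart from `0^∞` and `M^∞`, the unique `q`-expansions arise
from these by a prefix `0^i d` or `M^i d` (`H_le_H`, `H_le_entropy`). It is computed by comparing
`α(q)` with one-dimensional dynamics. For a slope `s ∈ (1, M + 1]` let `kneading M s` be the
itinerary of `1` under the map on `(-1, 1]` with branches `r ↦ s r - (2d - M)`, `0 ≤ d ≤ M`. It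
lies in `seqV M`, so it is the quasi-greedy expansion of `1` in a unique base `base M s`. The
proof rests on `H M (base M s) = log_{M+1} s` (`H_base`).

* The lower bound for this entropy is a version of the Milnor-Thurston formula. If `a ∈ seqV M`,
  then the number of admissible words below `y`, minus the number below the reflection of `y`,
  satisfies a first-order recursion along the orbit of `y`. On generating functions it says that
  the count of the words between the reflection of `a` and `a`, which is all of them up to a
  constant, equals the value `∑ (2aᵢ - M) s^{-i}` times the generating function of all words
  (`tsum_between`). Hence the value of `a` is less than `1` for every `s` above the growth rate,
  and it is `1` at the growth rate itself (`val_lt_one`, `val_eq_one_of_entropy`).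
* The upper bound holds since below the kneading sequence different words of length `n` have
  values separated by a multiple of `s⁻ⁿ` (`entropy_le_of_lt_kneading`).

As `s ↦ kneading M s` is strictly increasing (`kneading_strictMono`), `H` is strictly smaller to
the left of every `base M s`, so these bases lie in the bifurcation set; conversely every interval
on which `H` is not constant contains such a base (`base_mem_bifurcationSet`, `exists_base_near`).
So there are no isolated points, and part 1 follows by comparing kneading sequences with
irreducible ones.

* If `α(q)` lies in `seqV M` and is not the kneading sequence of its slope
  `s = (M + 1) ^ H M q`, then both are expansions of `1`, which forces the kneading sequence to be
  periodic and irreducibility of `α(q)` to fail at the period (`exists_not_irredAt`). For the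
  `*`-irreducible sequences one also needs that the orbit of `1` along the Thue-Morse digits does
  not reach `-1` first (`neg_one_lt_remainder_gtm`).
* If `s ^ j > 2`, then `kneading M s` satisfies the condition of irreducibility at `j`
  (`reflectedTail_lt_kneading`), and if `s ^ blockLen M n < 2`, then it starts like the
  Thue-Morse sequence and lies below `xi M n`. So it is irreducible or `*`-irreducible unless `s`
  is one of the countably many roots of `2` (`kneading_irreducible`).

The interior is empty since any interval contains bases whose quasi-greedy expansions have a long
run of zeros, a run that no admissible sequence can contain; what follows the run does not change
the subshift (`exists_Ioo_H_eq`). For the dimension, let `n` be the index at which the kneading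
sequences of `s < t` part, with `s` and `t` near `M + 1`. Then `t - s` is at most a multiple of
`s⁻ⁿ`, while `base M t - base M s` is at least a multiple of `(M + 1)⁻ⁿ`. So `q ↦ (M + 1) ^ H M q`
maps a part of the bifurcation set onto an interval and is Hölder continuous with an exponent
arbitrarily close to `1` (`exists_holder`).
-/

namespace UniqueExpansions

/-! ### The lexicographic order, the shift and the reflection -/

variable {M : ℕ}

theorem lex_lt_iff {x y : Sequ M} :
    toLex x < toLex y ↔ ∃ k, (∀ i < k, x i = y i) ∧ x k < y k := Iff.rfl

theorem lex_lt_of {x y : Sequ M} (k : ℕ) (h : ∀ i < k, x i = y i) (hk : x k < y k) :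
    toLex x < toLex y := lex_lt_iff.2 ⟨k, h, hk⟩

@[simp] theorem shift_zero (x : Sequ M) : shift 0 x = x := by
  funext i; simp [shift]

@[simp] theorem shift_shift (m n : ℕ) (x : Sequ M) : shift m (shift n x) = shift (n + m) x := by
  funext i; simp [shift, add_assoc]

theorem shift_apply (n i : ℕ) (x : Sequ M) : shift n x i = x (n + i) := rfl

@[simp] theorem reflect_reflect (x : Sequ M) : reflect (reflect x) = x := by
  funext i; simp [reflect]

theorem shift_reflect (n : ℕ) (x : Sequ M) : shift n (reflect x) = reflect (shift n x) := rfl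

theorem reflect_lt_reflect {x y : Sequ M} :
    toLex (reflect x) < toLex (reflect y) ↔ toLex y < toLex x := by
  simp only [lex_lt_iff, reflect, Fin.rev_lt_rev, Fin.rev_inj]
  constructor <;> rintro ⟨k, h, hk⟩ <;> exact ⟨k, fun i hi => (h i hi).symm, hk⟩

theorem reflect_le_reflect {x y : Sequ M} :
    toLex (reflect x) ≤ toLex (reflect y) ↔ toLex y ≤ toLex x := by
  constructor <;> intro h <;> refine not_lt.1 fun hc => absurd h (not_le.2 ?_)
  · exact reflect_lt_reflect.2 hc
  · exact reflect_lt_reflect.1 hc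

theorem reflect_lt_comm {x y : Sequ M} :
    toLex (reflect x) < toLex y ↔ toLex (reflect y) < toLex x := by
  rw [← reflect_lt_reflect, reflect_reflect]

theorem reflect_le_comm {x y : Sequ M} :
    toLex (reflect x) ≤ toLex y ↔ toLex (reflect y) ≤ toLex x := by
  rw [← reflect_le_reflect, reflect_reflect]

theorem shift_le_shift_of_agree {x y : Sequ M} {n : ℕ} (h : toLex x ≤ toLex y)
    (hn : ∀ i < n, x i = y i) : toLex (shift n x) ≤ toLex (shift n y) := by
  by_contra hlt
  obtain ⟨k, hk, hlt⟩ := lex_lt_iff.1 (not_le.1 hlt)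
  refine absurd h (not_le.2 (lex_lt_of (n + k) (fun i hi => ?_) hlt))
  rcases lt_or_ge i n with hin | hin
  · exact (hn i hin).symm
  · have := hk (i - n) (by omega)
    simpa [shift, Nat.add_sub_cancel' hin] using this

theorem shift_lt_shift_of_agree {x y : Sequ M} {n : ℕ} (h : toLex x < toLex y)
    (hn : ∀ i < n, x i = y i) : toLex (shift n x) < toLex (shift n y) := by
  obtain ⟨k, hk, hlt⟩ := lex_lt_iff.1 h
  have hkn : n ≤ k := by
    by_contra hc
    exact absurd (hn k (by omega)) hlt.ne
  exact lex_lt_of (k - n) (fun i hi => hk (n + i) (by omega))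
    (by simpa [shift, Nat.add_sub_cancel' hkn] using hlt)

theorem lt_of_agree_of_shift_lt {x y : Sequ M} {n : ℕ} (hn : ∀ i < n, x i = y i)
    (h : toLex (shift n x) < toLex (shift n y)) : toLex x < toLex y := by
  by_contra hc
  exact absurd (shift_le_shift_of_agree (not_lt.1 hc) fun i hi => (hn i hi).symm) (not_le.2 h)

/-! ### Values of sequences -/

theorem summable_expand {s : ℝ} (hs : 1 < s) (x : Sequ M) :
    Summable fun i : ℕ => ((x i : ℕ) : ℝ) / s ^ (i + 1) := by
  have hg : Summable fun i : ℕ => (M : ℝ) * s⁻¹ * s⁻¹ ^ i :=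
    (summable_geometric_of_lt_one (by positivity) (inv_lt_one_of_one_lt₀ hs)).mul_left _
  refine Summable.of_nonneg_of_le (fun i => by positivity) (fun i => ?_) hg
  have : ((x i : ℕ) : ℝ) ≤ M := by exact_mod_cast Nat.lt_succ_iff.1 (x i).2
  calc ((x i : ℕ) : ℝ) / s ^ (i + 1) ≤ M / s ^ (i + 1) := by gcongr
    _ = (M : ℝ) * s⁻¹ * s⁻¹ ^ i := by rw [pow_succ, inv_pow]; field_simp

theorem expand_rec {s : ℝ} (hs : 1 < s) (x : Sequ M) :
    s * expand s x = ((x 0 : ℕ) : ℝ) + expand s (shift 1 x) := by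
  unfold expand
  rw [(summable_expand hs x).tsum_eq_zero_add, mul_add, ← tsum_mul_left]
  have h0 : s ≠ 0 := by positivity
  congr 1
  · rw [zero_add, pow_one, mul_div_cancel₀ _ h0]
  · refine tsum_congr fun i => ?_
    simp only [shift, Nat.add_comm 1 i]
    rw [pow_succ s (i + 1)]
    field_simp

theorem expand_nonneg {s : ℝ} (hs : 1 < s) (x : Sequ M) : 0 ≤ expand s x :=
  tsum_nonneg fun i => by positivity

theorem expand_pos {s : ℝ} (hs : 1 < s) {x : Sequ M} {n : ℕ} (hn : x n ≠ 0) : 0 < expand s x :=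
  (summable_expand hs x).tsum_pos (fun i => by positivity) n (by
    have : 0 < ((x n : ℕ) : ℝ) := by
      exact_mod_cast Nat.pos_of_ne_zero fun h => hn (Fin.ext h)
    positivity)

theorem expand_top {s : ℝ} (hs : 1 < s) :
    expand s (fun _ => Fin.last M : Sequ M) = M / (s - 1) := by
  have h := expand_rec hs (fun _ => Fin.last M : Sequ M)
  have h2 : shift 1 (fun _ => Fin.last M : Sequ M) = fun _ => Fin.last M := rfl
  rw [h2] at h
  simp only [Fin.val_last] at h
  rw [eq_div_iff (by linarith)]
  linarith

theorem expand_le {s : ℝ} (hs : 1 < s) (x : Sequ M) : expand s x ≤ M / (s - 1) := by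
  rw [← expand_top hs]
  refine (summable_expand hs x).tsum_le_tsum (fun i => ?_) (summable_expand hs _)
  gcongr
  exact Fin.le_last _

theorem expand_reflect {s : ℝ} (hs : 1 < s) (x : Sequ M) :
    expand s (reflect x) = M / (s - 1) - expand s x := by
  rw [eq_sub_iff_add_eq, ← expand_top hs]
  unfold expand
  rw [← (summable_expand hs _).tsum_add (summable_expand hs _)]
  refine tsum_congr fun i => ?_
  rw [← add_div]
  congr 1
  have : (x i : ℕ) ≤ M := Nat.lt_succ_iff.1 (x i).2
  simp only [reflect, Fin.val_rev, Fin.val_last]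
  norm_cast
  omega

theorem expand_sub {s : ℝ} (hs : 1 < s) {x y : Sequ M} {k : ℕ} (h : ∀ i < k, x i = y i) :
    s ^ (k + 1) * (expand s y - expand s x) =
      ((y k : ℕ) : ℝ) - ((x k : ℕ) : ℝ) +
        (expand s (shift (k + 1) y) - expand s (shift (k + 1) x)) := by
  induction k generalizing x y with
  | zero =>
    have h1 := expand_rec hs x
    have h2 := expand_rec hs y
    simp only [zero_add, pow_one]
    linarith
  | succ k ih =>
    have h1 := expand_rec hs x
    have h2 := expand_rec hs y
    have h3 := ih (x := shift 1 x) (y := shift 1 y) fun i hi => h (1 + i) (by omega)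
    rw [h 0 (by omega)] at h1
    have h4 : s * (expand s y - expand s x) = expand s (shift 1 y) - expand s (shift 1 x) := by
      linarith
    simp only [shift_shift, shift_apply, Nat.add_comm 1] at h3 h4
    rw [pow_succ, mul_assoc, h4, h3]

/-- The digit `d` shifted to be symmetric about `0`. -/
def sgn (d : Fin (M + 1)) : ℝ := 2 * ((d : ℕ) : ℝ) - M

theorem sgn_rev (d : Fin (M + 1)) : sgn d.rev = -sgn d := by
  have : (d : ℕ) ≤ M := Nat.lt_succ_iff.1 d.2
  have h : ((d.rev : ℕ) : ℝ) = M - (d : ℕ) := by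
    rw [Fin.val_rev, ← Nat.cast_sub this]; congr 1; omega
  simp only [sgn, h]; ring

theorem sgn_add_two_le {d d' : Fin (M + 1)} (h : d < d') : sgn d + 2 ≤ sgn d' := by
  have : ((d : ℕ) : ℝ) + 1 ≤ ((d' : ℕ) : ℝ) := by exact_mod_cast Fin.lt_def.1 h
  simp only [sgn]; linarith

theorem sgn_le (d : Fin (M + 1)) : sgn d ≤ M := by
  have : ((d : ℕ) : ℝ) ≤ M := by exact_mod_cast Nat.lt_succ_iff.1 d.2
  simp only [sgn]; linarith

theorem neg_le_sgn (d : Fin (M + 1)) : -(M : ℝ) ≤ sgn d := by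
  have : (0 : ℝ) ≤ ((d : ℕ) : ℝ) := by positivity
  simp only [sgn]; linarith

/-- The value of a sequence with respect to the symmetric digits `2d - M`, that is,
`∑ (2xᵢ - M) / s ^ i`. -/
noncomputable def val (s : ℝ) (x : Sequ M) : ℝ := 2 * expand s x - M / (s - 1)

theorem val_rec {s : ℝ} (hs : 1 < s) (x : Sequ M) :
    s * val s x = sgn (x 0) + val s (shift 1 x) := by
  have h := expand_rec hs x
  have h1 : (M : ℝ) / (s - 1) * (s - 1) = M := div_mul_cancel₀ _ (by linarith)
  simp only [val, sgn]
  linear_combination 2 * h - h1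

theorem val_shift_succ {s : ℝ} (hs : 1 < s) (x : Sequ M) (n : ℕ) :
    val s (shift (n + 1) x) = s * val s (shift n x) - sgn (x n) := by
  have := val_rec hs (shift n x)
  rw [shift_shift, shift_apply, add_zero] at this
  linarith

theorem abs_val_le {s : ℝ} (hs : 1 < s) (x : Sequ M) : |val s x| ≤ M / (s - 1) := by
  have h1 := expand_nonneg hs x
  have h2 := expand_le hs x
  rw [abs_le]
  constructor <;> simp only [val] <;> linarith

theorem val_reflect {s : ℝ} (hs : 1 < s) (x : Sequ M) : val s (reflect x) = -val s x := by
  simp only [val, expand_reflect hs]; ring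

theorem val_sub {s : ℝ} (hs : 1 < s) {x y : Sequ M} {k : ℕ} (h : ∀ i < k, x i = y i) :
    s ^ (k + 1) * (val s y - val s x) =
      sgn (y k) - sgn (x k) + (val s (shift (k + 1) y) - val s (shift (k + 1) x)) := by
  have := expand_sub hs h
  simp only [val, sgn]
  linear_combination 2 * this

/-- The sequences all of whose shifts have a value in `[-1, 1]`. -/
def Bounded (s : ℝ) (x : Sequ M) : Prop := ∀ n, |val s (shift n x)| ≤ 1

theorem Bounded.shift {s : ℝ} {x : Sequ M} (h : Bounded s x) (n : ℕ) : Bounded s (shift n x) :=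
  fun m => by rw [shift_shift]; exact h _

theorem Bounded.reflect {s : ℝ} (hs : 1 < s) {x : Sequ M} (h : Bounded s x) :
    Bounded s (reflect x) :=
  fun m => by rw [shift_reflect, val_reflect hs, abs_neg]; exact h _

/-- On sequences with bounded orbits the value is weakly monotone. -/
theorem val_le_of_lt {s : ℝ} (hs : 1 < s) {x y : Sequ M} (hx : Bounded s x) (hy : Bounded s y)
    (h : toLex x < toLex y) : val s x ≤ val s y := by
  obtain ⟨k, hk, hlt⟩ := lex_lt_iff.1 h
  have h1 := val_sub hs hk
  have h2 := sgn_add_two_le hlt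
  have h3 := abs_le.1 (hx (k + 1))
  have h4 := abs_le.1 (hy (k + 1))
  have h5 : 0 ≤ s ^ (k + 1) * (val s y - val s x) := by rw [h1]; linarith
  have := nonneg_of_mul_nonneg_right h5 (by positivity)
  linarith

/-- Where two sequences with bounded orbits and equal values part, the smaller one continues with
value `1` and the larger one with value `-1`. -/
theorem val_eq_of_firstDiff {s : ℝ} (hs : 1 < s) {x y : Sequ M} (hx : Bounded s x)
    (hy : Bounded s y) (hv : val s x = val s y) {k : ℕ} (hk : ∀ i < k, x i = y i)
    (hlt : x k < y k) : val s (shift (k + 1) x) = 1 ∧ val s (shift (k + 1) y) = -1 ∧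
      sgn (y k) = sgn (x k) + 2 := by
  have h1 := val_sub hs hk
  have h2 := sgn_add_two_le hlt
  have h3 := abs_le.1 (hx (k + 1))
  have h4 := abs_le.1 (hy (k + 1))
  rw [hv, sub_self, mul_zero] at h1
  refine ⟨?_, ?_, ?_⟩ <;> linarith

/-! ### Orbits of the value `1` -/

/-- The point reached from `1` after reading `n` digits of `x` with the maps
`r ↦ s r - (2d - M)`. -/
def remainder (s : ℝ) (x : Sequ M) : ℕ → ℝ
  | 0 => 1
  | n + 1 => s * remainder s x n - sgn (x n)

theorem val_shift_eq_remainder {s : ℝ} (hs : 1 < s) {x : Sequ M} (h : val s x = 1) (n : ℕ) :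
    val s (shift n x) = remainder s x n := by
  induction n with
  | zero => simpa [remainder] using h
  | succ n ih => rw [val_shift_succ hs, ih, remainder]

theorem remainder_congr {s : ℝ} {x y : Sequ M} {n : ℕ} (h : ∀ i < n, x i = y i) :
    remainder s x n = remainder s y n := by
  induction n with
  | zero => rfl
  | succ n ih => rw [remainder, remainder, ih fun i hi => h i (by omega), h n (by omega)]

theorem continuous_remainder (x : Sequ M) (n : ℕ) : Continuous fun s => remainder s x n := by
  induction n with
  | zero => exact continuous_const
  | succ n ih => exact (continuous_id.mul ih).sub continuous_const

/-! ### Quasi-greedy expansions -/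

/-- If every point of the bounded set `S` is mapped into `S` by one of the maps `z ↦ q z - d`,
then each point of `S` has a `q`-expansion all of whose tails have their value in `S`. -/
theorem exists_itinerary {q : ℝ} (hq : 1 < q) {S : Set ℝ} {B : ℝ} (hB : ∀ z ∈ S, |z| ≤ B)
    (hS : ∀ z ∈ S, ∃ d : Fin (M + 1), q * z - ((d : ℕ) : ℝ) ∈ S) {z : ℝ} (hz : z ∈ S) :
    ∃ x : Sequ M, expand q x = z ∧ ∀ n, expand q (shift n x) ∈ S := by
  choose! f hf using hS
  let orb : ℕ → ℝ := fun n => Nat.rec z (fun _ r => q * r - ((f r : ℕ) : ℝ)) n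
  have horb : ∀ n, orb n ∈ S := by
    intro n
    induction n with
    | zero => exact hz
    | succ n ih => exact hf _ ih
  let x : Sequ M := fun n => f (orb n)
  have hdiff : ∀ m n, q ^ m * (expand q (shift n x) - orb n) =
      expand q (shift (n + m) x) - orb (n + m) := by
    intro m n
    induction m with
    | zero => simp
    | succ m ih =>
      have h1 := expand_rec hq (shift (n + m) x)
      have h2 : orb (n + m + 1) = q * orb (n + m) - ((x (n + m) : ℕ) : ℝ) := rfl
      rw [shift_shift, shift_apply, add_zero] at h1
      rw [pow_succ, ← add_assoc, h2]
      linear_combination q * ih + h1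
  have hval : ∀ n, expand q (shift n x) = orb n := by
    intro n
    by_contra hne
    have hpos : 0 < |expand q (shift n x) - orb n| := abs_pos.2 (sub_ne_zero.2 hne)
    obtain ⟨m, hm⟩ :=
      pow_unbounded_of_one_lt ((M / (q - 1) + B) / |expand q (shift n x) - orb n|) hq
    rw [div_lt_iff₀ hpos] at hm
    have h1 := congrArg abs (hdiff m n)
    rw [abs_mul, abs_of_pos (by positivity : 0 < q ^ m)] at h1
    have h2 := abs_sub (expand q (shift (n + m) x)) (orb (n + m))
    rw [abs_of_nonneg (expand_nonneg hq _)] at h2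
    linarith [hB _ (horb (n + m)), expand_le hq (shift (n + m) x)]
  refine ⟨x, by rw [← shift_zero x, hval]; rfl, fun n => ?_⟩
  rw [hval]
  exact horb n

theorem nat_ceil_bounds {x : ℝ} (hx : -1 < x) : x ≤ ⌈x⌉₊ ∧ (⌈x⌉₊ : ℝ) < x + 1 := by
  refine ⟨Nat.le_ceil x, ?_⟩
  rcases le_or_gt 0 x with h | h
  · exact Nat.ceil_lt_add_one h
  · rw [Nat.ceil_eq_zero.2 h.le, Nat.cast_zero]; linarith

theorem exists_expand_eq {q : ℝ} (hq : 1 < q) (hqM : q ≤ M + 1) {z : ℝ} (h0 : 0 ≤ z)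
    (hz : z ≤ M / (q - 1)) : ∃ x : Sequ M, expand q x = z := by
  have hB : (M : ℝ) / (q - 1) * (q - 1) = M := div_mul_cancel₀ _ (by linarith)
  have h1B : 1 ≤ (M : ℝ) / (q - 1) := by rw [le_div_iff₀ (by linarith)]; linarith
  have hS : ∀ z ∈ Set.Icc 0 ((M : ℝ) / (q - 1)), ∃ d : Fin (M + 1),
      q * z - ((d : ℕ) : ℝ) ∈ Set.Icc 0 ((M : ℝ) / (q - 1)) := by
    intro z hz
    have hqz : 0 ≤ q * z := mul_nonneg (by linarith) hz.1
    have hqz2 : q * z ≤ q * (M / (q - 1)) := mul_le_mul_of_nonneg_left hz.2 (by linarith)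
    rcases le_or_gt (M : ℝ) (q * z) with h | h
    · refine ⟨Fin.last M, ?_, ?_⟩ <;> simp only [Fin.val_last] <;> linarith
    · have hfl : ⌊q * z⌋₊ < M := (Nat.floor_lt hqz).2 h
      refine ⟨⟨⌊q * z⌋₊, by omega⟩, ?_, ?_⟩
      · have := Nat.floor_le hqz
        simp only; linarith
      · have := Nat.lt_floor_add_one (q * z)
        simp only; linarith
  obtain ⟨x, hx, -⟩ := exists_itinerary hq (B := M / (q - 1))
    (fun z hz => by rw [abs_of_nonneg hz.1]; exact hz.2) hS ⟨h0, hz⟩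
  exact ⟨x, hx⟩

theorem exists_alpha {q : ℝ} (hq : q ∈ Set.Ioc (1 : ℝ) (M + 1)) :
    ∃ a : Sequ M, expand q a = 1 ∧ ∀ n, expand q (shift n a) ∈ Set.Ioc (0 : ℝ) 1 := by
  refine exists_itinerary (S := Set.Ioc 0 1) (B := 1) hq.1
    (fun z hz => by rw [abs_of_pos hz.1]; exact hz.2) (fun z hz => ?_) ⟨one_pos, le_rfl⟩
  have h0 : 0 < q * z := mul_pos (by linarith [hq.1]) hz.1
  obtain ⟨h1, h2⟩ := nat_ceil_bounds (x := q * z - 1) (by linarith)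
  have h3 : q * z ≤ M + 1 := by nlinarith [hz.1, hz.2, hq.1, hq.2]
  have h4 : ⌈q * z - 1⌉₊ < M + 1 := by
    have : (⌈q * z - 1⌉₊ : ℝ) < ((M + 1 : ℕ) : ℝ) := by push_cast; linarith
    exact_mod_cast this
  refine ⟨⟨_, h4⟩, ?_, ?_⟩ <;> simp only <;> linarith

open Classical in
/-- The quasi-greedy `q`-expansion `α(q)` of `1`, for `q ∈ (1, M + 1]`. -/
noncomputable def alpha (M : ℕ) (q : ℝ) : Sequ M :=
  if hq : q ∈ Set.Ioc (1 : ℝ) (M + 1) then (exists_alpha hq).choose else 0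

theorem expand_alpha {q : ℝ} (hq : q ∈ Set.Ioc (1 : ℝ) (M + 1)) : expand q (alpha M q) = 1 := by
  rw [alpha, dif_pos hq]; exact (exists_alpha hq).choose_spec.1

theorem expand_shift_alpha {q : ℝ} (hq : q ∈ Set.Ioc (1 : ℝ) (M + 1)) (n : ℕ) :
    expand q (shift n (alpha M q)) ∈ Set.Ioc (0 : ℝ) 1 := by
  rw [alpha, dif_pos hq]; exact (exists_alpha hq).choose_spec.2 n

theorem isInfinite_iff {q : ℝ} (hq : 1 < q) {a : Sequ M} :
    IsInfinite a ↔ ∀ n, 0 < expand q (shift n a) := by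
  constructor
  · intro h n
    obtain ⟨i, hi, hne⟩ := h n
    refine expand_pos hq (n := i - n) ?_
    rwa [shift_apply, Nat.add_sub_cancel' hi]
  · intro h n
    by_contra hc
    push Not at hc
    have h0 := h n
    have : expand q (shift n a) = 0 := by
      unfold expand
      convert tsum_zero with i
      rw [shift_apply, hc (n + i) (by omega)]
      simp
    linarith

theorem one_lt_expand_of_alpha_lt {q : ℝ} (hq : q ∈ Set.Ioc (1 : ℝ) (M + 1)) {b : Sequ M}
    (hb : ∀ n, 0 < expand q (shift n b)) (h : toLex (alpha M q) < toLex b) : 1 < expand q b := by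
  obtain ⟨k, hk, hlt⟩ := lex_lt_iff.1 h
  have h1 := expand_sub hq.1 hk
  have h2 : ((alpha M q k : ℕ) : ℝ) + 1 ≤ ((b k : ℕ) : ℝ) := by exact_mod_cast Fin.lt_def.1 hlt
  have h3 := (expand_shift_alpha hq (k + 1)).2
  have h4 := hb (k + 1)
  rw [expand_alpha hq] at h1
  have h5 : 0 < q ^ (k + 1) * (expand q b - 1) := by rw [h1]; linarith
  have := pos_of_mul_pos_right h5 (pow_nonneg (by linarith [hq.1]) _)
  linarith

/-- If no tail of `b` exceeds an expansion `a` of `1`, then all values of tails of `b` are at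
most `1`. -/
theorem expand_le_one_of_shift_le {q : ℝ} (hq : 1 < q) {a b : Sequ M} (ha : expand q a = 1)
    (h : ∀ n, toLex (shift n b) ≤ toLex a) (n : ℕ) : expand q (shift n b) ≤ 1 := by
  have key : ∀ N n, expand q (shift n b) - 1 ≤ M / (q - 1) / q ^ N := by
    intro N
    induction N with
    | zero => intro n; have := expand_le hq (shift n b); simp; linarith
    | succ N ih =>
      intro n
      have hC : 0 ≤ (M : ℝ) / (q - 1) / q ^ N :=
        div_nonneg (div_nonneg (by positivity) (by linarith)) (by positivity)
      have hC' : (M : ℝ) / (q - 1) / q ^ (N + 1) = M / (q - 1) / q ^ N / q := by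
        rw [pow_succ, div_div _ (q ^ N)]
      rcases (h n).lt_or_eq with hlt | heq
      · obtain ⟨k, hk, hlt⟩ := lex_lt_iff.1 hlt
        have h1 := expand_sub hq hk
        have h2 : ((shift n b k : ℕ) : ℝ) + 1 ≤ ((a k : ℕ) : ℝ) := by
          exact_mod_cast Fin.lt_def.1 hlt
        have h3 := expand_nonneg hq (shift (k + 1) a)
        have h4 := ih (n + (k + 1))
        rw [shift_shift, ha] at h1
        rw [hC', le_div_iff₀ (by linarith)]
        by_contra hc
        push Not at hc
        have h5 : 0 < expand q (shift n b) - 1 := by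
          by_contra h6
          nlinarith
        have h7 : q ^ 1 ≤ q ^ (k + 1) := pow_le_pow_right₀ hq.le (by omega)
        nlinarith
      · rw [toLex_inj.1 heq, ha, sub_self]
        rw [hC']; exact div_nonneg hC (by linarith)
  have hlim : Tendsto (fun N : ℕ => (M : ℝ) / (q - 1) / q ^ N) atTop (𝓝 0) :=
    tendsto_const_nhds.div_atTop (tendsto_pow_atTop_atTop_of_one_lt hq)
  have := ge_of_tendsto' hlim fun N => key N n
  linarith

theorem isQuasiGreedy_alpha {q : ℝ} (hq : q ∈ Set.Ioc (1 : ℝ) (M + 1)) :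
    IsQuasiGreedy q (alpha M q) := by
  refine ⟨⟨(isInfinite_iff hq.1).2 fun n => (expand_shift_alpha hq n).1, expand_alpha hq⟩,
    fun b hb h1 => ?_⟩
  by_contra hc
  have := one_lt_expand_of_alpha_lt hq ((isInfinite_iff hq.1).1 hb) (not_le.1 hc)
  linarith

theorem IsQuasiGreedy.eq_alpha {q : ℝ} (hq : q ∈ Set.Ioc (1 : ℝ) (M + 1)) {a : Sequ M}
    (h : IsQuasiGreedy q a) : a = alpha M q := by
  have h2 := isQuasiGreedy_alpha hq
  exact toLex_inj.1 (le_antisymm (h2.2 a h.1.1 h.1.2) (h.2 _ h2.1.1 h2.1.2))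

theorem shift_alpha_le {q : ℝ} (hq : q ∈ Set.Ioc (1 : ℝ) (M + 1)) (n : ℕ) :
    toLex (shift n (alpha M q)) ≤ toLex (alpha M q) := by
  by_contra hc
  have := one_lt_expand_of_alpha_lt hq (b := shift n (alpha M q))
    (fun m => by rw [shift_shift]; exact (expand_shift_alpha hq _).1) (not_le.1 hc)
  linarith [(expand_shift_alpha hq n).2]

theorem expand_lt_expand {p q : ℝ} (hp : 1 < p) (hpq : p < q) {x : Sequ M} {n : ℕ}
    (hx : x n ≠ 0) : expand q x < expand p x := by
  have hn : 0 < ((x n : ℕ) : ℝ) := by exact_mod_cast Nat.pos_of_ne_zero fun h => hx (Fin.ext h)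
  refine (summable_expand (hp.trans hpq) x).tsum_lt_tsum (i := n) (fun i => ?_) ?_
    (summable_expand hp x)
  · exact div_le_div_of_nonneg_left (by positivity) (by positivity)
      (pow_le_pow_left₀ (by linarith) hpq.le _)
  · exact div_lt_div_of_pos_left hn (by positivity)
      (pow_lt_pow_left₀ hpq (by linarith) (by omega))

theorem alpha_lt_alpha {p q : ℝ} (hp : p ∈ Set.Ioc (1 : ℝ) (M + 1))
    (hq : q ∈ Set.Ioc (1 : ℝ) (M + 1)) (hpq : p < q) :
    toLex (alpha M p) < toLex (alpha M q) := by
  by_contra hc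
  have hc := not_lt.1 hc
  have h1 := expand_le_one_of_shift_le hp.1 (expand_alpha hp)
    (fun n => (shift_alpha_le hq n).trans hc) 0
  obtain ⟨n, -, hn⟩ := (isQuasiGreedy_alpha hq).1.1 0
  have h2 := expand_lt_expand hp.1 hpq hn
  rw [expand_alpha hq] at h2
  rw [shift_zero] at h1
  linarith

theorem lt_of_alpha_lt {p q : ℝ} (hp : p ∈ Set.Ioc (1 : ℝ) (M + 1))
    (hq : q ∈ Set.Ioc (1 : ℝ) (M + 1)) (h : toLex (alpha M p) < toLex (alpha M q)) : p < q := by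
  rcases lt_trichotomy p q with h1 | h1 | h1
  · exact h1
  · rw [h1] at h; exact absurd h (lt_irrefl _)
  · exact absurd (alpha_lt_alpha hq hp h1) h.not_gt

/-- The values of a sequence depend in a Lipschitz way on a base bounded away from `1`. -/
theorem abs_expand_sub_le {q₀ p q : ℝ} (h₀ : 1 < q₀) (hp : q₀ ≤ p) (hq : q₀ ≤ q) (x : Sequ M) :
    |expand p x - expand q x| ≤ M / (q₀ - 1) / (q₀ - 1) * |p - q| := by
  set C : ℝ := M / (q₀ - 1) with hC
  have hC0 : 0 ≤ C := div_nonneg (by positivity) (by linarith)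
  have hbound : ∀ r, q₀ ≤ r → ∀ y : Sequ M, |expand r y| ≤ C := by
    intro r hr y
    rw [abs_of_nonneg (expand_nonneg (by linarith) y)]
    refine (expand_le (by linarith) y).trans ?_
    exact div_le_div_of_nonneg_left (by positivity) (by linarith) (by linarith)
  have key : ∀ (N : ℕ) (y : Sequ M),
      |expand p y - expand q y| ≤ C / (q₀ - 1) * |p - q| + 2 * C / q₀ ^ N := by
    intro N
    induction N with
    | zero =>
      intro y
      have h1 := abs_sub (expand p y) (expand q y)
      have h2 : 0 ≤ C / (q₀ - 1) * |p - q| :=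
        mul_nonneg (div_nonneg hC0 (by linarith)) (abs_nonneg _)
      simp only [pow_zero, div_one]
      linarith [hbound p hp y, hbound q hq y]
    | succ N ih =>
      intro y
      have h1 := expand_rec (by linarith : 1 < p) y
      have h2 := expand_rec (by linarith : 1 < q) y
      have h3 : p * (expand p y - expand q y) =
          (expand p (shift 1 y) - expand q (shift 1 y)) - (p - q) * expand q y := by
        linear_combination h1 - h2
      have h4 := congrArg abs h3
      rw [abs_mul, abs_of_pos (by linarith : 0 < p)] at h4
      have h5 := abs_sub (expand p (shift 1 y) - expand q (shift 1 y)) ((p - q) * expand q y)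
      rw [abs_mul] at h5
      have h6 := ih (shift 1 y)
      have h7 : |p - q| * |expand q y| ≤ |p - q| * C :=
        mul_le_mul_of_nonneg_left (hbound q hq y) (abs_nonneg _)
      have h8 : q₀ * |expand p y - expand q y| ≤ p * |expand p y - expand q y| :=
        mul_le_mul_of_nonneg_right hp (abs_nonneg _)
      have h9 : q₀ * (C / (q₀ - 1) * |p - q| + 2 * C / q₀ ^ (N + 1)) =
          C / (q₀ - 1) * |p - q| + 2 * C / q₀ ^ N + |p - q| * C := by
        have : q₀ - 1 ≠ 0 := by linarith
        rw [pow_succ]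
        field_simp
        ring
      exact le_of_mul_le_mul_left (by linarith) (by linarith : 0 < q₀)
  have hlim : Tendsto (fun N : ℕ => C / (q₀ - 1) * |p - q| + 2 * C / q₀ ^ N) atTop
      (𝓝 (C / (q₀ - 1) * |p - q| + 0)) :=
    tendsto_const_nhds.add (tendsto_const_nhds.div_atTop (tendsto_pow_atTop_atTop_of_one_lt h₀))
  rw [add_zero] at hlim
  exact ge_of_tendsto' hlim fun N => key N x

theorem continuousOn_expand (x : Sequ M) : ContinuousOn (fun q => expand q x) (Set.Ioi 1) := by
  intro q hq
  have hq : 1 < q := hq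
  set q₀ := (1 + q) / 2
  have h₀ : 1 < q₀ := by simp only [q₀]; linarith
  have hlip : LipschitzOnWith (Real.toNNReal (M / (q₀ - 1) / (q₀ - 1))) (fun q => expand q x)
      (Set.Ici q₀) := by
    refine LipschitzOnWith.of_dist_le_mul fun p hp r hr => ?_
    rw [Real.coe_toNNReal _ (div_nonneg (div_nonneg (by positivity) (by linarith)) (by linarith))]
    exact abs_expand_sub_le h₀ hp hr x
  exact (hlip.continuousOn.continuousAt
    (Ici_mem_nhds (by simp only [q₀]; linarith))).continuousWithinAt

/-- Every infinite sequence that is not exceeded by any of its tails is a quasi-greedy expansion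
of `1`. -/
theorem exists_base {a : Sequ M} (hM : 1 ≤ M) (hinf : IsInfinite a)
    (h : ∀ n, toLex (shift n a) ≤ toLex a) : ∃ q ∈ Set.Ioc (1 : ℝ) (M + 1), alpha M q = a := by
  have hMR : (1 : ℝ) ≤ M := by exact_mod_cast hM
  obtain ⟨i, -, hi⟩ := hinf 0
  obtain ⟨j, hij, hj⟩ := hinf (i + 1)
  have hone : ∀ n, a n ≠ 0 → (1 : ℝ) ≤ ((a n : ℕ) : ℝ) := fun n hn => by
    exact_mod_cast Nat.pos_of_ne_zero fun h => hn (Fin.ext h)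
  obtain ⟨p, hp1, hpM, hp⟩ : ∃ p : ℝ, 1 < p ∧ p ≤ M + 1 ∧ 1 ≤ expand p a := by
    have hc : ContinuousAt (fun p : ℝ => 1 / p ^ (i + 1) + 1 / p ^ (j + 1)) 1 := by
      refine ContinuousAt.add ?_ ?_ <;>
      exact continuousAt_const.div (continuousAt_id.pow _) (by simp)
    have hev : ∀ᶠ p : ℝ in 𝓝[>] 1, 1 < 1 / p ^ (i + 1) + 1 / p ^ (j + 1) :=
      (hc.tendsto.mono_left nhdsWithin_le_nhds).eventually_const_lt (by norm_num)
    have hev2 : ∀ᶠ p : ℝ in 𝓝[>] 1, p ∈ Set.Ioo (1 : ℝ) (M + 1) :=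
      Ioo_mem_nhdsGT (by linarith)
    obtain ⟨p, hp, hp1, hp2⟩ := (hev.and hev2).exists
    refine ⟨p, hp1, hp2.le, hp.le.trans ?_⟩
    have hs := (summable_expand hp1 a).sum_le_tsum {i, j} fun k _ => by positivity
    rw [Finset.sum_pair (by omega)] at hs
    refine le_trans ?_ hs
    have := hone i hi
    have := hone j hj
    gcongr
  have hle : expand (M + 1 : ℝ) a ≤ 1 := by
    refine (expand_le (by linarith) a).trans ?_
    rw [add_sub_cancel_right, div_self (by linarith)]
  obtain ⟨q, hq, hqa⟩ := intermediate_value_Icc' hpM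
    ((continuousOn_expand a).mono fun r hr => lt_of_lt_of_le hp1 hr.1)
    (show (1 : ℝ) ∈ Set.Icc (expand ((M : ℝ) + 1) a) (expand p a) from ⟨hle, hp⟩)
  have hqI : q ∈ Set.Ioc (1 : ℝ) (M + 1) := ⟨lt_of_lt_of_le hp1 hq.1, hq.2⟩
  refine ⟨q, hqI, ?_⟩
  have hpos := (isInfinite_iff hqI.1).1 hinf
  have hub := expand_le_one_of_shift_le hqI.1 hqa h
  refine toLex_inj.1 (le_antisymm ?_ ?_)
  · by_contra hc
    obtain ⟨k, hk, hlt⟩ := lex_lt_iff.1 (not_le.1 hc)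
    have h1 := expand_sub hqI.1 hk
    have h2 : ((a k : ℕ) : ℝ) + 1 ≤ ((alpha M q k : ℕ) : ℝ) := by exact_mod_cast Fin.lt_def.1 hlt
    have h3 := hub (k + 1)
    have h4 := (expand_shift_alpha hqI (k + 1)).1
    have h5 : expand q a = 1 := hqa
    rw [expand_alpha hqI, h5, sub_self, mul_zero] at h1
    linarith
  · exact (isQuasiGreedy_alpha hqI).2 a hinf hqa

theorem seqV_isInfinite (hM : 1 ≤ M) {a : Sequ M} (ha : a ∈ seqV M) : IsInfinite a := by
  intro n
  by_contra hc
  push Not at hc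
  have h := (ha n).1
  have h0 : shift n a = fun _ => 0 := by
    funext i; exact hc (n + i) (by omega)
  rw [h0] at h
  have h2 : reflect a n = 0 := by
    by_contra hne
    classical
    have hex : ∃ m, reflect a m ≠ 0 := ⟨n, hne⟩
    refine absurd h (not_le.2 (lex_lt_of (Nat.find hex) (fun i hi => ?_) ?_))
    · have := Nat.find_min hex hi
      push Not at this
      exact this.symm
    · exact Fin.pos_of_ne_zero (Nat.find_spec hex)
  simp only [reflect, hc n le_rfl] at h2
  rw [Fin.ext_iff] at h2
  simp at h2
  omega

theorem exists_base_of_mem_seqV (hM : 1 ≤ M) {a : Sequ M} (ha : a ∈ seqV M) :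
    ∃ q ∈ Set.Ioc (1 : ℝ) (M + 1), alpha M q = a :=
  exists_base hM (seqV_isInfinite hM ha) fun n => (ha n).2

/-! ### Entropy -/

theorem one_le_words_ncard {X : Set (Sequ M)} (hX : X.Nonempty) (n : ℕ) :
    (1 : ℝ) ≤ ((words n X).ncard : ℝ) := by
  have := (Set.ncard_pos (Set.toFinite _)).2 (words_nonempty hX n)
  exact_mod_cast this

theorem entropy_le_of_ncard_le {X Y : Set (Sequ M)} (hX : X.Nonempty) (hY : Y.Nonempty) (C : ℝ)
    (hC : 0 < C) (h : ∀ n, ((words n X).ncard : ℝ) ≤ C * (n + 1) * (words n Y).ncard) :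
    entropy X ≤ entropy Y := by
  have hlim : Tendsto (fun n : ℕ => Real.log C / Real.log (M + 1) / n +
      (Real.log ((n : ℝ) + 1) / n) / Real.log (M + 1) +
        Real.logb ((M : ℝ) + 1) ((words n Y).ncard : ℝ) / (n : ℝ)) atTop
      (𝓝 (0 + 0 / Real.log (M + 1) + entropy Y)) := by
    refine ((tendsto_const_nhds.div_atTop tendsto_natCast_atTop_atTop).add
      (Tendsto.div_const ?_ _)).add (tendsto_entropy hY)
    have h1 : Tendsto (fun x : ℝ => Real.log x / x) atTop (𝓝 0) := by
      simpa using Real.isLittleO_log_id_atTop.tendsto_div_nhds_zero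
    have h2 : Tendsto (fun n : ℕ => (n : ℝ) + 1) atTop atTop :=
      tendsto_atTop_add_const_right _ _ tendsto_natCast_atTop_atTop
    have h3 : Tendsto (fun n : ℕ => ((n : ℝ) + 1) / n) atTop (𝓝 1) := by
      have h4 : Tendsto (fun n : ℕ => 1 + 1 / (n : ℝ)) atTop (𝓝 (1 + 0)) :=
        tendsto_const_nhds.add (tendsto_const_nhds.div_atTop tendsto_natCast_atTop_atTop)
      rw [add_zero] at h4
      refine h4.congr' ?_
      filter_upwards [eventually_gt_atTop 0] with n hn
      have : (n : ℝ) ≠ 0 := by positivity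
      field_simp
    have h5 := (h1.comp h2).mul h3
    rw [zero_mul] at h5
    refine h5.congr fun n => ?_
    have : (n : ℝ) + 1 ≠ 0 := by positivity
    simp only [Function.comp_apply]
    field_simp
  simp only [zero_div, zero_add] at hlim
  refine le_of_tendsto_of_tendsto (tendsto_entropy hX) hlim ?_
  filter_upwards [eventually_gt_atTop 0] with n hn
  have hb : (0 : ℝ) ≤ Real.log ((M : ℝ) + 1) := Real.log_nonneg (by simp)
  have h1 := one_le_words_ncard hX n
  have h2 := one_le_words_ncard hY n
  have h3 := Real.log_le_log (by linarith) (h n)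
  rw [Real.log_mul (by positivity) (by linarith), Real.log_mul hC.ne' (by positivity)] at h3
  have hn' : (0 : ℝ) < n := by exact_mod_cast hn
  have h4 := div_le_div_of_nonneg_right (div_le_div_of_nonneg_right h3 hb) hn'.le
  simp only [Real.logb]
  refine h4.trans (le_of_eq ?_)
  ring

theorem words_mono {X Y : Set (Sequ M)} (h : X ⊆ Y) (n : ℕ) : words n X ⊆ words n Y := by
  rintro w ⟨c, hc, k, hk⟩
  exact ⟨c, h hc, k, hk⟩

theorem entropy_mono {X Y : Set (Sequ M)} (hX : X.Nonempty) (h : X ⊆ Y) :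
    entropy X ≤ entropy Y := by
  refine entropy_le_of_ncard_le hX (hX.mono h) 1 one_pos fun n => ?_
  have h1 : ((words n X).ncard : ℝ) ≤ (words n Y).ncard := by
    exact_mod_cast Set.ncard_le_ncard (words_mono h n) (Set.toFinite _)
  have h2 := one_le_words_ncard (hX.mono h) n
  have h3 : (0 : ℝ) ≤ (n : ℝ) * (words n Y).ncard := by positivity
  linarith

theorem entropy_le_logb {X : Set (Sequ M)} (hX : X.Nonempty) {C s : ℝ} (hC : 0 < C) (hs : 0 < s)
    (h : ∀ n, ((words n X).ncard : ℝ) ≤ C * s ^ n) : entropy X ≤ Real.logb (M + 1) s := by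
  have hlim : Tendsto (fun n : ℕ => Real.log C / Real.log (M + 1) / n + Real.logb (M + 1) s) atTop
      (𝓝 (0 + Real.logb (M + 1) s)) :=
    (tendsto_const_nhds.div_atTop tendsto_natCast_atTop_atTop).add tendsto_const_nhds
  rw [zero_add] at hlim
  refine le_of_tendsto_of_tendsto (tendsto_entropy hX) hlim ?_
  filter_upwards [eventually_gt_atTop 0] with n hn
  have hb : (0 : ℝ) ≤ Real.log ((M : ℝ) + 1) := Real.log_nonneg (by simp)
  have h3 := Real.log_le_log (by linarith [one_le_words_ncard hX n]) (h n)
  rw [Real.log_mul hC.ne' (by positivity), Real.log_pow] at h3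
  have hn' : (0 : ℝ) < n := by exact_mod_cast hn
  have h4 := div_le_div_of_nonneg_right (div_le_div_of_nonneg_right h3 hb) hn'.le
  simp only [Real.logb]
  refine h4.trans (le_of_eq ?_)
  field_simp

theorem words_ncard_mul_le (X : Set (Sequ M)) (n k : ℕ) :
    (words (n * k) X).ncard ≤ (words n X).ncard ^ k := by
  induction k with
  | zero =>
    rw [mul_zero, pow_zero]
    exact Set.ncard_le_one_of_subsingleton _
  | succ k ih =>
    rw [Nat.mul_succ, pow_succ]
    exact (words_ncard_add_le X _ _).trans (Nat.mul_le_mul_right _ ih)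

theorem pow_le_words_ncard (hM : 1 ≤ M) {X : Set (Sequ M)} (hX : X.Nonempty) (n : ℕ) :
    (((M : ℝ) + 1) ^ entropy X) ^ n ≤ (words n X).ncard := by
  have hMR : (1 : ℝ) ≤ M := by exact_mod_cast hM
  have hb : (0 : ℝ) < Real.log ((M : ℝ) + 1) := Real.log_pos (by linarith)
  rcases Nat.eq_zero_or_pos n with rfl | hn
  · simpa using one_le_words_ncard hX 0
  have hn' : (0 : ℝ) < n := by exact_mod_cast hn
  have hsub : Tendsto (fun k : ℕ => n * k) atTop atTop :=
    tendsto_id.const_mul_atTop' hn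
  have h1 := (tendsto_entropy hX).comp hsub
  have h2 : entropy X ≤ Real.logb (M + 1) ((words n X).ncard : ℝ) / n := by
    refine le_of_tendsto h1 ?_
    filter_upwards [eventually_gt_atTop 0] with k hk
    have hk' : (0 : ℝ) < k := by exact_mod_cast hk
    have h3 : ((words (n * k) X).ncard : ℝ) ≤ ((words n X).ncard : ℝ) ^ k := by
      exact_mod_cast words_ncard_mul_le X n k
    have h4 := Real.log_le_log (by linarith [one_le_words_ncard hX (n * k)]) h3
    rw [Real.log_pow] at h4
    simp only [Function.comp_apply, Real.logb, Nat.cast_mul]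
    rw [div_div, div_div, div_le_div_iff₀ (by positivity) (by positivity)]
    have := mul_le_mul_of_nonneg_right h4 (by positivity : 0 ≤ Real.log ((M : ℝ) + 1) * n)
    linarith
  rw [le_div_iff₀ hn', Real.le_logb_iff_rpow_le (by linarith)
    (by linarith [one_le_words_ncard hX n]), Real.rpow_mul (by positivity)] at h2
  exact_mod_cast h2

theorem entropy_nonneg {X : Set (Sequ M)} (hX : X.Nonempty) : 0 ≤ entropy X := by
  refine ge_of_tendsto' (tendsto_entropy hX) fun n => ?_
  exact div_nonneg (div_nonneg (Real.log_nonneg (one_le_words_ncard hX n))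
    (Real.log_nonneg (by simp))) (by positivity)

theorem entropy_le_one (hM : 1 ≤ M) {X : Set (Sequ M)} (hX : X.Nonempty) : entropy X ≤ 1 := by
  have hMR : (1 : ℝ) ≤ M := by exact_mod_cast hM
  have h := entropy_le_logb hX (C := 1) (s := M + 1) one_pos (by positivity) fun n => by
    have h1 : (words n X).ncard ≤ (M + 1) ^ n := by
      refine (Set.ncard_le_ncard (Set.subset_univ _) (Set.toFinite _)).trans (le_of_eq ?_)
      simp [Set.ncard_univ, Nat.card_eq_fintype_card]
    rw [one_mul]
    exact_mod_cast h1
  rwa [Real.logb_self_eq_one (by linarith)] at h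

/-! ### Unique expansions and symmetric subshifts -/

/-- The sequences all of whose tails lie between the reflection of `a` and `a`. -/
def symShift (a : Sequ M) : Set (Sequ M) :=
  {x | ∀ n, toLex (reflect a) ≤ toLex (shift n x) ∧ toLex (shift n x) ≤ toLex a}

/-- The sequences all of whose tails lie strictly between the reflection of `a` and `a`. -/
def strictSymShift (a : Sequ M) : Set (Sequ M) :=
  {x | ∀ n, toLex (reflect a) < toLex (shift n x) ∧ toLex (shift n x) < toLex a}

theorem self_mem_symShift {a : Sequ M} (ha : a ∈ seqV M) : a ∈ symShift a := ha

theorem symShift_nonempty {a : Sequ M} (ha : a ∈ seqV M) : (symShift a).Nonempty :=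
  ⟨a, self_mem_symShift ha⟩

theorem symShift_mono {a b : Sequ M} (h : toLex a ≤ toLex b) : symShift a ⊆ symShift b :=
  fun _ hx n => ⟨(reflect_le_reflect.2 h).trans (hx n).1, (hx n).2.trans h⟩

theorem symShift_subset_strict {a b : Sequ M} (h : toLex a < toLex b) :
    symShift a ⊆ strictSymShift b :=
  fun _ hx n => ⟨(reflect_lt_reflect.2 h).trans_le (hx n).1, (hx n).2.trans_lt h⟩

theorem strictSymShift_subset {a b : Sequ M} (h : toLex a ≤ toLex b) :
    strictSymShift a ⊆ symShift b :=
  fun _ hx n => ⟨(reflect_le_reflect.2 h).trans (hx n).1.le, (hx n).2.le.trans h⟩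

theorem reflect_mem_symShift {a x : Sequ M} (h : x ∈ symShift a) : reflect x ∈ symShift a :=
  fun n => by
    rw [shift_reflect]
    exact ⟨reflect_le_reflect.2 (h n).2, reflect_le_comm.1 (h n).1⟩

theorem shift_mem_symShift {a x : Sequ M} (h : x ∈ symShift a) (k : ℕ) : shift k x ∈ symShift a :=
  fun n => by rw [shift_shift]; exact h _

theorem mem_univoqueSeqs_iff {q : ℝ} {x : Sequ M} :
    x ∈ univoqueSeqs M q ↔ ∀ y : Sequ M, expand q y = expand q x → y = x := by
  constructor
  · rintro ⟨c, -, hc⟩ y hy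
    rw [hc y hy, hc x rfl]
  · exact fun h => ⟨x, rfl, fun y hy => h y hy⟩

theorem strictSymShift_subset_univoqueSeqs {q : ℝ} (hq : q ∈ Set.Ioc (1 : ℝ) (M + 1)) :
    strictSymShift (alpha M q) ⊆ univoqueSeqs M q := by
  intro x hx
  have hone : ∀ y : Sequ M, (∀ n, toLex (shift n y) < toLex (alpha M q)) →
      expand q y < 1 := by
    intro y hy
    have h0 := hy 0
    rw [shift_zero] at h0
    obtain ⟨k, hk, hlt⟩ := lex_lt_iff.1 h0
    have h1 := expand_sub hq.1 hk
    have h2 : ((y k : ℕ) : ℝ) + 1 ≤ ((alpha M q k : ℕ) : ℝ) := by exact_mod_cast Fin.lt_def.1 hlt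
    have h3 := expand_le_one_of_shift_le hq.1 (expand_alpha hq) (fun n => (hy n).le) (k + 1)
    have h4 := (expand_shift_alpha hq (k + 1)).1
    rw [expand_alpha hq] at h1
    have h5 : 0 < q ^ (k + 1) * (1 - expand q y) := by rw [h1]; linarith
    have := pos_of_mul_pos_right h5 (pow_nonneg (by linarith [hq.1]) _)
    linarith
  -- The argument for a larger expansion is applied to reflections to exclude a smaller one.
  have key : ∀ x y : Sequ M, x ∈ strictSymShift (alpha M q) → toLex x < toLex y →
      expand q y ≠ expand q x := by
    intro x y hx hxy he
    obtain ⟨k, hk, hlt⟩ := lex_lt_iff.1 hxy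
    have h1 := expand_sub hq.1 hk
    have h2 : ((x k : ℕ) : ℝ) + 1 ≤ ((y k : ℕ) : ℝ) := by exact_mod_cast Fin.lt_def.1 hlt
    have h3 := hone (shift (k + 1) x) fun n => by rw [shift_shift]; exact (hx _).2
    have h4 := expand_nonneg hq.1 (shift (k + 1) y)
    rw [he, sub_self, mul_zero] at h1
    linarith
  refine mem_univoqueSeqs_iff.2 fun y hy => ?_
  rcases lt_trichotomy (toLex x) (toLex y) with h | h | h
  · exact absurd hy (key x y hx h)
  · exact (toLex_inj.1 h).symm
  · refine absurd ?_ (key (reflect x) (reflect y) (fun n => ?_) (reflect_lt_reflect.2 h))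
    · rw [expand_reflect hq.1, expand_reflect hq.1, hy]
    · rw [shift_reflect]
      exact ⟨reflect_lt_reflect.2 (hx n).2, reflect_lt_comm.1 (hx n).1⟩

theorem univoqueSeqs_nonempty {q : ℝ} (hq : 1 < q) : (univoqueSeqs M q).Nonempty := by
  refine ⟨fun _ => 0, mem_univoqueSeqs_iff.2 fun y hy => ?_⟩
  by_contra hne
  obtain ⟨n, hn⟩ := Function.ne_iff.1 hne
  have h1 := expand_pos hq hn
  rw [hy] at h1
  simp [expand] at h1

theorem expand_concat {q : ℝ} (hq : 1 < q) (x y : Sequ M) (n : ℕ) :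
    q ^ n * (expand q (concat n x y) - expand q x) = expand q y - expand q (shift n x) := by
  have hs : shift n (concat n x y) = y := by
    funext i; simp [shift, concat]
  rcases n with _ | k
  · rw [shift_zero] at hs ⊢; rw [hs]; ring
  · have h := expand_sub hq (x := x) (y := concat (k + 1) x y) (k := k) fun i hi => by
      simp [concat, Nat.lt_succ_of_lt hi]
    rw [hs] at h
    rw [h]
    simp [concat]

theorem shift_mem_univoqueSeqs {q : ℝ} (hq : 1 < q) {x : Sequ M} (hx : x ∈ univoqueSeqs M q)
    (n : ℕ) : shift n x ∈ univoqueSeqs M q := by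
  refine mem_univoqueSeqs_iff.2 fun y hy => ?_
  have h1 := expand_concat hq x y n
  rw [hy, sub_self] at h1
  have h2 : expand q (concat n x y) = expand q x := by
    have := (mul_eq_zero.1 h1).resolve_left (by positivity)
    linarith
  rw [← mem_univoqueSeqs_iff.1 hx _ h2]
  funext i; simp [shift, concat]

theorem reflect_mem_univoqueSeqs {q : ℝ} (hq : 1 < q) {x : Sequ M} (hx : x ∈ univoqueSeqs M q) :
    reflect x ∈ univoqueSeqs M q := by
  refine mem_univoqueSeqs_iff.2 fun y hy => ?_
  rw [← reflect_reflect y, mem_univoqueSeqs_iff.1 hx (reflect y)]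
  rw [expand_reflect hq, hy, expand_reflect hq]
  ring

theorem shift_lt_alpha_of_digit_lt {q : ℝ} (hq : q ∈ Set.Ioc (1 : ℝ) (M + 1)) {x : Sequ M}
    (hx : x ∈ univoqueSeqs M q) {n : ℕ} (hn : x n < Fin.last M) :
    toLex (shift (n + 1) x) < toLex (alpha M q) := by
  have hlt : expand q (shift (n + 1) x) < 1 := by
    by_contra hc
    push Not at hc
    obtain ⟨y, hy⟩ := exists_expand_eq hq.1 hq.2 (z := expand q (shift (n + 1) x) - 1)
      (by linarith) (by linarith [expand_le hq.1 (shift (n + 1) x)])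
    have hu := shift_mem_univoqueSeqs hq.1 hx n
    let z : Sequ M := concat 1 (fun _ => x n + 1) y
    have hz0 : z 0 = x n + 1 := rfl
    have hz1 : shift 1 z = y := by funext i; simp [z, shift, concat]
    have h1 := expand_rec hq.1 z
    have h2 := expand_rec hq.1 (shift n x)
    rw [hz0, hz1, Fin.val_add_one_of_lt hn, hy] at h1
    rw [shift_shift, shift_apply, add_zero] at h2
    push_cast at h1
    have h3 : z = shift n x := mem_univoqueSeqs_iff.1 hu z (by
      have h0 : q ≠ 0 := by linarith [hq.1]
      apply mul_left_cancel₀ h0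
      linarith)
    have h4 := congrFun h3 0
    rw [hz0, shift_apply, add_zero] at h4
    have h5 := Fin.val_add_one_of_lt hn
    rw [h4] at h5
    omega
  by_contra hc
  rcases (not_lt.1 hc).lt_or_eq with h | h
  · obtain ⟨k, hk, hlt'⟩ := lex_lt_iff.1 h
    have h1 := expand_sub hq.1 hk
    have h2 : ((alpha M q k : ℕ) : ℝ) + 1 ≤ ((shift (n + 1) x k : ℕ) : ℝ) := by
      exact_mod_cast Fin.lt_def.1 hlt'
    have h3 := (expand_shift_alpha hq (k + 1)).2
    have h4 := expand_nonneg hq.1 (shift (k + 1) (shift (n + 1) x))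
    rw [expand_alpha hq] at h1
    have h5 : 0 ≤ q ^ (k + 1) * (expand q (shift (n + 1) x) - 1) := by rw [h1]; linarith
    have := nonneg_of_mul_nonneg_right h5 (pow_pos (by linarith [hq.1]) _)
    linarith
  · rw [← toLex_inj.1 h, expand_alpha hq] at hlt
    exact lt_irrefl _ hlt

theorem shift_lt_alpha_of_lt {q : ℝ} (hq : q ∈ Set.Ioc (1 : ℝ) (M + 1)) {x : Sequ M}
    (hx : x ∈ univoqueSeqs M q) {m : ℕ} (hm : x m < Fin.last M) {n : ℕ} (hmn : m < n) :
    toLex (shift n x) < toLex (alpha M q) := by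
  induction n, Nat.succ_le_of_lt hmn using Nat.le_induction with
  | base => exact shift_lt_alpha_of_digit_lt hq hx hm
  | succ n hn ih =>
    rcases (Fin.le_last (x n)).lt_or_eq with h | h
    · exact shift_lt_alpha_of_digit_lt hq hx h
    · have ih := ih hn
      -- The digit `M` can only be matched by the first digit of `α(q)`.
      have h0 : shift n x 0 ≤ alpha M q 0 :=
        Pi.apply_le_of_toLex (i := 0) ih.le fun j hj => absurd hj (by omega)
      rw [shift_apply, add_zero, h] at h0
      have h1 := shift_lt_shift_of_agree (n := 1) ih fun i hi => by
        obtain rfl : i = 0 := by omega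
        rw [shift_apply, add_zero, h]
        exact (Fin.last_le_iff.1 h0).symm
      rw [shift_shift] at h1
      exact h1.trans_le (shift_alpha_le hq 1)

theorem shift_mem_strictSymShift {q : ℝ} (hq : q ∈ Set.Ioc (1 : ℝ) (M + 1)) {x : Sequ M}
    (hx : x ∈ univoqueSeqs M q) {m : ℕ} (h : x m ≠ x 0) :
    shift (m + 1) x ∈ strictSymShift (alpha M q) := by
  intro n
  rw [shift_shift]
  have hr := reflect_mem_univoqueSeqs hq.1 hx
  have hrev : ∀ i j : ℕ, x i < x j → i ≤ m → j ≤ m →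
      toLex (reflect (alpha M q)) < toLex (shift (m + 1 + n) x) ∧
        toLex (shift (m + 1 + n) x) < toLex (alpha M q) := by
    intro i j hij hi hj
    refine ⟨reflect_lt_comm.1 ?_, ?_⟩
    · rw [← shift_reflect]
      refine shift_lt_alpha_of_lt hq hr (m := j) ?_ (by omega)
      have : (x i : ℕ) < x j := hij
      rw [Fin.lt_def, reflect, Fin.val_rev, Fin.val_last]
      omega
    · exact shift_lt_alpha_of_lt hq hx (m := i) (hij.trans_le (Fin.le_last _)) (by omega)
  rcases lt_or_gt_of_ne h with h1 | h1
  · exact hrev m 0 h1 le_rfl (by omega)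
  · exact hrev 0 m h1 (by omega) le_rfl

/-- The entropy of the unique expansions is carried by the strict symmetric subshift of `α(q)`:
outside of it an expansion only has a prefix `c⋯cd` with digits `c ≠ d`. -/
theorem H_le_entropy {q : ℝ} (hq : q ∈ Set.Ioc (1 : ℝ) (M + 1)) {X : Set (Sequ M)}
    (hX : X.Nonempty) (h : strictSymShift (alpha M q) ⊆ X) : H M q ≤ entropy X := by
  refine entropy_le_of_ncard_le (univoqueSeqs_nonempty hq.1) hX ((M + 1) * (M + 1))
    (by positivity) fun n => ?_
  let F : ((Fin (n + 1) × Fin (M + 1)) × Fin (M + 1)) × (Fin n → Fin (M + 1)) →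
      (Fin n → Fin (M + 1)) := fun t j =>
    if h1 : (j : ℕ) < t.1.1.1 then t.1.1.2 else if (j : ℕ) = t.1.1.1 then t.1.2
      else t.2 ⟨j - (t.1.1.1 + 1), by omega⟩
  have hsub : words n (univoqueSeqs M q) ⊆ F '' (Set.univ ×ˢ words n X) := by
    rintro w ⟨c, hc, k, hk⟩
    have hu := shift_mem_univoqueSeqs hq.1 hc k
    set x := shift k c with hx
    have hw : ∀ i : Fin n, w i = x i := hk
    obtain ⟨w₀, hw₀⟩ := words_nonempty hX n
    by_cases hall : ∀ i < n, x i = x 0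
    · refine ⟨(((Fin.last n, x 0), x 0), w₀), ⟨trivial, hw₀⟩, ?_⟩
      funext j
      simp only [F, Fin.val_last, j.2, dif_pos]
      rw [hw, hall j j.2]
    · push Not at hall
      classical
      have hex : ∃ i, x i ≠ x 0 := ⟨_, hall.choose_spec.2⟩
      have hm : Nat.find hex < n := by
        obtain ⟨i, hi, hne⟩ := hall
        exact (Nat.find_min' hex hne).trans_lt hi
      set m := Nat.find hex with hmdef
      refine ⟨(((⟨m, by omega⟩, x 0), x m), fun i => shift (m + 1) x i),
        ⟨trivial, shift (m + 1) x, h (shift_mem_strictSymShift hq hu (Nat.find_spec hex)), 0,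
          fun i => by rw [zero_add]⟩, ?_⟩
      funext j
      simp only [F]
      split_ifs with h1 h2
      · have := Nat.find_min hex h1
        push Not at this
        rw [hw, this]
      · rw [hw, h2]
      · rw [hw, shift_apply]
        congr 1
        omega
  have hcard := (Set.ncard_le_ncard hsub (Set.toFinite _)).trans
    (Set.ncard_image_le (Set.toFinite _))
  rw [Set.ncard_prod, Set.ncard_univ, Nat.card_eq_fintype_card] at hcard
  simp only [Fintype.card_prod, Fintype.card_fin] at hcard
  have hcard' : ((words n (univoqueSeqs M q)).ncard : ℝ) ≤
      ((n + 1 : ℝ) * (M + 1) * (M + 1)) * (words n X).ncard := by exact_mod_cast hcard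
  refine hcard'.trans (le_of_eq ?_)
  ring

theorem entropy_le_H {q : ℝ} (hq : q ∈ Set.Ioc (1 : ℝ) (M + 1)) {b : Sequ M} (hb : b ∈ seqV M)
    (h : toLex b < toLex (alpha M q)) : entropy (symShift b) ≤ H M q :=
  entropy_mono (symShift_nonempty hb)
    ((symShift_subset_strict h).trans (strictSymShift_subset_univoqueSeqs hq))

theorem H_le_entropy_symShift {q : ℝ} (hq : q ∈ Set.Ioc (1 : ℝ) (M + 1)) {b : Sequ M}
    (hb : b ∈ seqV M) (h : toLex (alpha M q) ≤ toLex b) : H M q ≤ entropy (symShift b) :=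
  H_le_entropy hq (symShift_nonempty hb) (strictSymShift_subset h)

theorem H_le_H {p q : ℝ} (hp : p ∈ Set.Ioc (1 : ℝ) (M + 1)) (hq : q ∈ Set.Ioc (1 : ℝ) (M + 1))
    (h : strictSymShift (alpha M p) ⊆ strictSymShift (alpha M q)) : H M p ≤ H M q :=
  H_le_entropy hp (univoqueSeqs_nonempty hq.1) (h.trans (strictSymShift_subset_univoqueSeqs hq))

theorem H_mono {p q : ℝ} (hp : p ∈ Set.Ioc (1 : ℝ) (M + 1)) (hq : q ∈ Set.Ioc (1 : ℝ) (M + 1))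
    (hpq : p ≤ q) : H M p ≤ H M q := by
  rcases hpq.lt_or_eq with h | rfl
  · refine H_le_H hp hq fun x hx n => ?_
    have h1 := alpha_lt_alpha hp hq h
    exact ⟨(reflect_lt_reflect.2 h1).trans (hx n).1, (hx n).2.trans h1⟩
  · rfl

/-! ### The entropy as a zero: counting words with signs -/

/-- The word formed by the first `n` digits. -/
def pre : ℕ → Sequ M → List (Fin (M + 1))
  | 0, _ => []
  | n + 1, x => x 0 :: pre n (shift 1 x)

theorem pre_eq_ofFn (n : ℕ) (x : Sequ M) : pre n x = List.ofFn fun i : Fin n => x i := by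
  induction n generalizing x with
  | zero => simp [pre]
  | succ n ih =>
    rw [pre, ih, List.ofFn_succ]
    simp [shift, Nat.add_comm]

theorem lt_of_pre_lt {n : ℕ} {x y : Sequ M} (h : pre n x < pre n y) : toLex x < toLex y := by
  induction n generalizing x y with
  | zero => simp [pre] at h
  | succ n ih =>
    rw [pre, pre, List.cons_lt_cons_iff] at h
    rcases h with h | ⟨h0, h⟩
    · exact lex_lt_of 0 (fun i hi => absurd hi (by omega)) h
    · exact lt_of_agree_of_shift_lt (n := 1) (fun i hi => by
        obtain rfl : i = 0 := by omega
        exact h0) (ih h)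

theorem pre_le_pre {n : ℕ} {x y : Sequ M} (h : toLex x ≤ toLex y) : pre n x ≤ pre n y := by
  by_contra hc
  exact absurd h (not_le.2 (lt_of_pre_lt (not_le.1 hc)))

/-- The words of length `n` that, together with all their suffixes, lie between the corresponding
prefixes of the reflection of `a` and of `a`. -/
def adm (a : Sequ M) : ℕ → Finset (List (Fin (M + 1)))
  | 0 => {[]}
  | n + 1 => ((Finset.univ ×ˢ adm a n).image fun t => t.1 :: t.2).filter
      fun u => pre (n + 1) (reflect a) ≤ u ∧ u ≤ pre (n + 1) a

theorem adm_bounds {a : Sequ M} {n : ℕ} {u : List (Fin (M + 1))} (hu : u ∈ adm a n) :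
    pre n (reflect a) ≤ u ∧ u ≤ pre n a := by
  cases n with
  | zero => simp only [adm, Finset.mem_singleton] at hu; subst hu; simp [pre]
  | succ n => exact (Finset.mem_filter.1 hu).2

theorem pre_mem_adm {a x : Sequ M} (hx : x ∈ symShift a) (n : ℕ) : pre n x ∈ adm a n := by
  induction n generalizing x with
  | zero => simp [pre, adm]
  | succ n ih =>
    refine Finset.mem_filter.2 ⟨Finset.mem_image.2 ⟨(x 0, pre n (shift 1 x)), ?_, rfl⟩, ?_⟩
    · exact Finset.mem_product.2 ⟨Finset.mem_univ _, ih (shift_mem_symShift hx 1)⟩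
    · have h := hx 0
      rw [shift_zero] at h
      exact ⟨pre_le_pre h.1, pre_le_pre h.2⟩

/-- For `a` in `seqV M` every admissible word occurs: a word that equals a prefix of `a` or of
its reflection is extended by that sequence, and any other one by extending its tail. -/
theorem exists_of_mem_adm {a : Sequ M} (ha : a ∈ seqV M) {n : ℕ} {u : List (Fin (M + 1))}
    (hu : u ∈ adm a n) : ∃ x ∈ symShift a, pre n x = u := by
  induction n generalizing u with
  | zero =>
    simp only [adm, Finset.mem_singleton] at hu
    exact ⟨a, ha, by simp [pre, hu]⟩
  | succ n ih =>
    obtain ⟨hu1, hu2, hu3⟩ := Finset.mem_filter.1 hu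
    obtain ⟨⟨d, v⟩, hdv, rfl⟩ := Finset.mem_image.1 hu1
    obtain ⟨z, hz, rfl⟩ := ih (Finset.mem_product.1 hdv).2
    rcases hu2.eq_or_lt with h2 | h2
    · exact ⟨_, reflect_mem_symShift (self_mem_symShift ha), h2⟩
    rcases hu3.eq_or_lt with h3 | h3
    · exact ⟨a, ha, h3.symm⟩
    let x : Sequ M := concat 1 (fun _ => d) z
    have hx1 : shift 1 x = z := by funext i; simp [x, shift, concat]
    have hpx : pre (n + 1) x = d :: pre n z := by rw [pre, hx1]; rfl
    refine ⟨x, fun m => ?_, hpx⟩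
    rcases m with _ | m
    · rw [shift_zero]
      exact ⟨(lt_of_pre_lt (by rwa [hpx])).le, (lt_of_pre_lt (by rwa [hpx])).le⟩
    · have := hz m
      rwa [← hx1, shift_shift, Nat.add_comm 1 m] at this

theorem card_adm {a : Sequ M} (ha : a ∈ seqV M) (n : ℕ) :
    (adm a n).card = (words n (symShift a)).ncard := by
  rw [← Set.ncard_coe_finset, ← Set.ncard_image_of_injective (words n (symShift a))
    (List.ofFn_injective (n := n))]
  congr 1
  ext u
  constructor
  · intro hu
    obtain ⟨x, hx, rfl⟩ := exists_of_mem_adm ha hu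
    exact ⟨fun i => x i, ⟨x, hx, 0, fun i => by rw [zero_add]⟩, (pre_eq_ofFn n x).symm⟩
  · rintro ⟨w, ⟨x, hx, k, hk⟩, rfl⟩
    have : List.ofFn w = pre n (shift k x) := by
      rw [pre_eq_ofFn]
      congr 1
      funext i
      exact hk i
    rw [this]
    exact pre_mem_adm (shift_mem_symShift hx k) n

/-- The number of admissible words of length `n` below `y`. -/
def below (a : Sequ M) (n : ℕ) (y : Sequ M) : ℕ := ((adm a n).filter fun u => u < pre n y).card

theorem below_le (a : Sequ M) (n : ℕ) (y : Sequ M) : below a n y ≤ (adm a n).card :=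
  Finset.card_filter_le _ _

theorem card_cons_lt (a y : Sequ M) (n : ℕ) :
    (((Finset.univ ×ˢ adm a n).image fun t => t.1 :: t.2).filter
      fun u => u < pre (n + 1) y).card = (y 0 : ℕ) * (adm a n).card + below a n (shift 1 y) := by
  have hinj : Function.Injective fun t : Fin (M + 1) × List (Fin (M + 1)) => t.1 :: t.2 := by
    rintro ⟨d, v⟩ ⟨d', v'⟩ h
    simpa using h
  rw [Finset.filter_image, Finset.card_image_of_injective _ hinj, Finset.card_filter,
    Finset.sum_product]
  have hd : ∀ d : Fin (M + 1), (∑ v ∈ adm a n, if d :: v < pre (n + 1) y then 1 else 0) =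
      (if d < y 0 then (adm a n).card else 0) + if d = y 0 then below a n (shift 1 y) else 0 := by
    intro d
    simp only [pre, List.cons_lt_cons_iff]
    rcases lt_trichotomy d (y 0) with h | h | h
    · simp [h, h.ne]
    · subst h
      simp [below]
    · simp [h.not_gt, h.ne']
  rw [Finset.sum_congr rfl fun d _ => hd d, Finset.sum_add_distrib, ← Finset.sum_filter,
    Finset.sum_const, smul_eq_mul, Finset.filter_gt_eq_Iio, Fin.card_Iio]
  simp

theorem below_succ {a y : Sequ M} (h1 : toLex (reflect a) ≤ toLex y) (h2 : toLex y ≤ toLex a)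
    (n : ℕ) :
    below a (n + 1) y +
        (((reflect a) 0 : ℕ) * (adm a n).card + below a n (shift 1 (reflect a))) =
      (y 0 : ℕ) * (adm a n).card + below a n (shift 1 y) := by
  rw [← card_cons_lt, ← card_cons_lt, below, ← Finset.card_union_of_disjoint]
  · congr 1
    ext u
    simp only [adm, Finset.mem_union, Finset.mem_filter]
    have h3 := pre_le_pre (n := n + 1) h1
    have h4 := pre_le_pre (n := n + 1) h2
    constructor
    · rintro (⟨⟨h, -⟩, hu⟩ | ⟨h, hu⟩)
      · exact ⟨h, hu⟩
      · exact ⟨h, hu.trans_le h3⟩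
    · rintro ⟨h, hu⟩
      rcases lt_or_ge u (pre (n + 1) (reflect a)) with h5 | h5
      · exact Or.inr ⟨h, h5⟩
      · exact Or.inl ⟨⟨h, h5, hu.le.trans h4⟩, hu⟩
  · rw [Finset.disjoint_left]
    intro u hu hu'
    exact absurd (Finset.mem_filter.1 hu').2
      (not_lt.2 (adm_bounds (Finset.mem_filter.1 hu).1).1)

/-- The signed number of admissible words of length `n` between the reflection of `y` and `y`. -/
def between (a : Sequ M) (n : ℕ) (y : Sequ M) : ℝ := below a n y - below a n (reflect y)

theorem between_zero (a y : Sequ M) : between a 0 y = 0 := by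
  simp [between, below, adm, pre]

theorem between_succ {a y : Sequ M} (h1 : toLex (reflect a) ≤ toLex y) (h2 : toLex y ≤ toLex a)
    (n : ℕ) : between a (n + 1) y = sgn (y 0) * (adm a n).card + between a n (shift 1 y) := by
  have e1 := congrArg (Nat.cast : ℕ → ℝ) (below_succ h1 h2 n)
  have e2 := congrArg (Nat.cast : ℕ → ℝ)
    (below_succ (reflect_le_reflect.2 h2) (reflect_le_comm.1 h1) n)
  push_cast at e1 e2
  have hr : ((reflect y 0 : ℕ) : ℝ) = M - (y 0 : ℕ) := by
    have : (y 0 : ℕ) ≤ M := Nat.lt_succ_iff.1 (y 0).2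
    rw [reflect, Fin.val_rev, ← Nat.cast_sub this]; congr 1; omega
  rw [hr] at e2
  simp only [between, sgn, shift_reflect] at *
  linear_combination e1 - e2

theorem abs_between_le (a : Sequ M) (n : ℕ) (y : Sequ M) :
    |between a n y| ≤ (adm a n).card := by
  have h1 : (below a n y : ℝ) ≤ (adm a n).card := by exact_mod_cast below_le a n y
  have h2 : (below a n (reflect y) : ℝ) ≤ (adm a n).card := by exact_mod_cast below_le a n _
  have h3 : (0 : ℝ) ≤ below a n y := by positivity
  have h4 : (0 : ℝ) ≤ below a n (reflect y) := by positivity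
  rw [between, abs_le]
  constructor <;> linarith

theorem between_self {a : Sequ M} (ha : a ∈ seqV M) (n : ℕ) :
    between a n a = (adm a n).card - 1 := by
  have h1 : below a n (reflect a) = 0 := by
    rw [below, Finset.card_eq_zero, Finset.filter_eq_empty_iff]
    exact fun u hu => not_lt.2 (adm_bounds hu).1
  have h2 : below a n a + 1 = (adm a n).card := by
    rw [below, ← Finset.card_erase_add_one (pre_mem_adm (self_mem_symShift ha) n)]
    congr 2
    ext u
    simp only [Finset.mem_filter, Finset.mem_erase]
    constructor
    · exact fun h => ⟨h.2.ne, h.1⟩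
    · exact fun h => ⟨h.2, (adm_bounds h.2).2.lt_of_ne h.1⟩
  rw [between, h1, ← h2]
  simp

/-- Above the growth rate of the admissible words, the generating function of the signed counts
is the value of the sequence times the generating function of all counts. -/
theorem tsum_between {a : Sequ M} {s : ℝ} (hs : 1 < s)
    (hsum : Summable fun n => ((adm a n).card : ℝ) * s⁻¹ ^ n) {y : Sequ M}
    (hy : y ∈ symShift a) :
    ∑' n, between a n y * s⁻¹ ^ n = (∑' n, ((adm a n).card : ℝ) * s⁻¹ ^ n) * val s y := by
  set N : ℝ := ∑' n, ((adm a n).card : ℝ) * s⁻¹ ^ n with hN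
  have hs0 : s ≠ 0 := by positivity
  have hle : ∀ z : Sequ M, ∀ n, ‖between a n z * s⁻¹ ^ n‖ ≤ ((adm a n).card : ℝ) * s⁻¹ ^ n := by
    intro z n
    rw [norm_mul, norm_pow, Real.norm_eq_abs, Real.norm_eq_abs,
      abs_of_pos (by positivity : 0 < s⁻¹)]
    gcongr
    exact abs_between_le a n z
  have hsumb : ∀ z : Sequ M, Summable fun n => between a n z * s⁻¹ ^ n :=
    fun z => Summable.of_norm_bounded hsum (hle z)
  have hbd : ∀ z : Sequ M, |∑' n, between a n z * s⁻¹ ^ n| ≤ N :=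
    fun z => tsum_of_norm_bounded hsum.hasSum (hle z)
  have hrec : ∀ z ∈ symShift a, s * ∑' n, between a n z * s⁻¹ ^ n =
      sgn (z 0) * N + ∑' n, between a n (shift 1 z) * s⁻¹ ^ n := by
    intro z hz
    have hz0 := hz 0
    rw [shift_zero] at hz0
    rw [(hsumb z).tsum_eq_zero_add, between_zero, zero_mul, zero_add, hN, ← tsum_mul_left,
      ← tsum_mul_left, ← (hsum.mul_left _).tsum_add (hsumb _)]
    refine tsum_congr fun n => ?_
    rw [between_succ hz0.1 hz0.2, pow_succ]
    field_simp
  have hiter : ∀ k, s ^ k * (∑' n, between a n y * s⁻¹ ^ n - N * val s y) =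
      ∑' n, between a n (shift k y) * s⁻¹ ^ n - N * val s (shift k y) := by
    intro k
    induction k with
    | zero => simp
    | succ k ih =>
      have h1 := hrec (shift k y) (shift_mem_symShift hy k)
      have h2 := val_rec hs (shift k y)
      rw [shift_shift] at h1 h2
      rw [pow_succ]
      linear_combination s * ih + h1 - N * h2
  by_contra hne
  have hpos : 0 < |∑' n, between a n y * s⁻¹ ^ n - N * val s y| :=
    abs_pos.2 (sub_ne_zero.2 hne)
  obtain ⟨k, hk⟩ := pow_unbounded_of_one_lt
    ((N + N * (M / (s - 1))) / |∑' n, between a n y * s⁻¹ ^ n - N * val s y|) hs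
  rw [div_lt_iff₀ hpos] at hk
  have h1 := congrArg abs (hiter k)
  rw [abs_mul, abs_of_pos (by positivity : 0 < s ^ k)] at h1
  have h2 := abs_sub (∑' n, between a n (shift k y) * s⁻¹ ^ n) (N * val s (shift k y))
  have hN0 : 0 ≤ N := tsum_nonneg fun n => by positivity
  rw [abs_mul, abs_of_nonneg hN0] at h2
  have h3 := mul_le_mul_of_nonneg_left (abs_val_le hs (shift k y)) hN0
  linarith [hbd (shift k y)]

theorem summable_adm (hM : 1 ≤ M) {a : Sequ M} (ha : a ∈ seqV M) {s : ℝ}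
    (hs : ((M : ℝ) + 1) ^ entropy (symShift a) < s) :
    Summable fun n => ((adm a n).card : ℝ) * s⁻¹ ^ n := by
  have hMR : (1 : ℝ) ≤ M := by exact_mod_cast hM
  have hX : (symShift a).Nonempty := ⟨a, ha⟩
  obtain ⟨r, hr1, hr2⟩ := exists_between hs
  have hr0 : 0 < r := lt_trans (by positivity) hr1
  have hs0 : 0 < s := hr0.trans hr2
  have hlog : entropy (symShift a) < Real.logb (M + 1) r :=
    (Real.lt_logb_iff_rpow_lt (by linarith) hr0).2 hr1
  have hev : ∀ᶠ n : ℕ in atTop, ((adm a n).card : ℝ) ≤ r ^ n := by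
    filter_upwards [(tendsto_entropy hX).eventually_lt_const hlog, eventually_gt_atTop 0]
      with n hn hn0
    have hn' : (0 : ℝ) < n := by exact_mod_cast hn0
    rw [div_lt_iff₀ hn', Real.logb_lt_iff_lt_rpow (by linarith)
      (by linarith [one_le_words_ncard hX n]), Real.rpow_mul (by positivity),
      Real.rpow_logb (by linarith) (by linarith) hr0, Real.rpow_natCast] at hn
    rw [card_adm ha]
    exact hn.le
  have hg : Summable fun n : ℕ => (r / s) ^ n :=
    summable_geometric_of_lt_one (by positivity) ((div_lt_one hs0).2 hr2)
  refine summable_of_isBigO_nat hg ?_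
  refine Asymptotics.IsBigO.of_bound 1 ?_
  filter_upwards [hev] with n hn
  rw [one_mul, Real.norm_of_nonneg (by positivity), Real.norm_of_nonneg (by positivity), div_pow,
    inv_pow, ← div_eq_mul_inv]
  gcongr

theorem one_le_rpow_entropy {X : Set (Sequ M)} (hX : X.Nonempty) :
    1 ≤ ((M : ℝ) + 1) ^ entropy X :=
  Real.one_le_rpow (by simp) (entropy_nonneg hX)

/-- Above the growth rate of its subshift, `a` has value less than `1`; the exact defect is given
by the generating function. -/
theorem tsum_adm_mul (hM : 1 ≤ M) {a : Sequ M} (ha : a ∈ seqV M) {s : ℝ}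
    (hs : ((M : ℝ) + 1) ^ entropy (symShift a) < s) :
    (∑' n, ((adm a n).card : ℝ) * s⁻¹ ^ n) * (1 - val s a) = (1 - s⁻¹)⁻¹ := by
  have hs1 : 1 < s := (one_le_rpow_entropy (symShift_nonempty ha)).trans_lt hs
  have hsum := summable_adm hM ha hs
  have h := tsum_between hs1 hsum (self_mem_symShift ha)
  have hgeo := tsum_geometric_of_lt_one (by positivity : 0 ≤ s⁻¹) (inv_lt_one_of_one_lt₀ hs1)
  have hsg := summable_geometric_of_lt_one (by positivity : 0 ≤ s⁻¹) (inv_lt_one_of_one_lt₀ hs1)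
  rw [mul_sub, mul_one, ← h, ← hgeo, sub_eq_iff_eq_add, ← hsg.tsum_add]
  · refine tsum_congr fun n => ?_
    rw [between_self ha]; ring
  · refine (hsum.sub hsg).congr fun n => ?_
    rw [between_self ha]; ring

theorem val_lt_one (hM : 1 ≤ M) {a : Sequ M} (ha : a ∈ seqV M) {s : ℝ}
    (hs : ((M : ℝ) + 1) ^ entropy (symShift a) < s) : val s a < 1 := by
  have hs1 : 1 < s := (one_le_rpow_entropy (symShift_nonempty ha)).trans_lt hs
  have h := tsum_adm_mul hM ha hs
  have h1 : 0 < (1 - s⁻¹)⁻¹ := by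
    have := inv_lt_one_of_one_lt₀ hs1
    exact inv_pos.2 (by linarith)
  rw [← h] at h1
  have := pos_of_mul_pos_right h1 (tsum_nonneg fun n => by positivity)
  linarith

theorem abs_val_le_one_of_lt (hM : 1 ≤ M) {a : Sequ M} (ha : a ∈ seqV M) {s : ℝ}
    (hs : ((M : ℝ) + 1) ^ entropy (symShift a) < s) {x : Sequ M} (hx : x ∈ symShift a) :
    |val s x| ≤ 1 := by
  have hs1 : 1 < s := (one_le_rpow_entropy (symShift_nonempty ha)).trans_lt hs
  have hsum := summable_adm hM ha hs
  have h := tsum_between hs1 hsum hx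
  have hpos : 0 < ∑' n, ((adm a n).card : ℝ) * s⁻¹ ^ n :=
    hsum.tsum_pos (fun n => by positivity) 0 (by simp [adm])
  have hbd : |∑' n, between a n x * s⁻¹ ^ n| ≤ ∑' n, ((adm a n).card : ℝ) * s⁻¹ ^ n := by
    rw [← Real.norm_eq_abs]
    refine tsum_of_norm_bounded hsum.hasSum fun n => ?_
    rw [norm_mul, norm_pow, Real.norm_eq_abs, Real.norm_eq_abs,
      abs_of_pos (by positivity : 0 < s⁻¹)]
    gcongr
    exact abs_between_le a n x
  rw [h, abs_mul, abs_of_pos hpos] at hbd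
  exact le_of_mul_le_mul_left (by linarith) hpos

theorem continuousOn_val (x : Sequ M) : ContinuousOn (fun s => val s x) (Set.Ioi 1) :=
  (continuousOn_const.mul (continuousOn_expand x)).sub
    (continuousOn_const.div (continuousOn_id.sub continuousOn_const) fun _ hs =>
      (sub_pos.2 (Set.mem_Ioi.1 hs)).ne')

theorem tendsto_val {s : ℝ} (hs : 1 < s) (x : Sequ M) :
    Tendsto (fun r => val r x) (𝓝[>] s) (𝓝 (val s x)) :=
  ((continuousOn_val x).continuousAt (Ioi_mem_nhds hs)).tendsto.mono_left nhdsWithin_le_nhds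

theorem bounded_of_entropy (hM : 1 ≤ M) {a : Sequ M} (ha : a ∈ seqV M)
    (h : 0 < entropy (symShift a)) {x : Sequ M} (hx : x ∈ symShift a) :
    Bounded (((M : ℝ) + 1) ^ entropy (symShift a)) x := by
  have hMR : (1 : ℝ) ≤ M := by exact_mod_cast hM
  intro n
  refine le_of_tendsto (tendsto_val (Real.one_lt_rpow (by linarith) h) (shift n x)).abs ?_
  filter_upwards [self_mem_nhdsWithin] with r hr
  exact abs_val_le_one_of_lt hM ha hr (shift_mem_symShift hx n)

/-- With respect to the growth rate of its subshift, `a` has value `1`. -/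
theorem val_eq_one_of_entropy (hM : 1 ≤ M) {a : Sequ M} (ha : a ∈ seqV M)
    (h : 0 < entropy (symShift a)) : val (((M : ℝ) + 1) ^ entropy (symShift a)) a = 1 := by
  have hMR : (1 : ℝ) ≤ M := by exact_mod_cast hM
  set s := ((M : ℝ) + 1) ^ entropy (symShift a) with hsdef
  have hs1 : 1 < s := Real.one_lt_rpow (by linarith) h
  have hle : val s a ≤ 1 := le_of_abs_le (by
    have := bounded_of_entropy hM ha h (self_mem_symShift ha) 0
    rwa [shift_zero] at this)
  by_contra hne
  have hlt : val s a < 1 := lt_of_le_of_ne hle hne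
  -- Otherwise the generating function stays bounded near its radius of convergence.
  set δ := (1 - val s a) / 2
  have hδ : 0 < δ := by simp only [δ]; linarith
  set K := (1 - s⁻¹)⁻¹ / δ with hK
  have hsi := inv_lt_one_of_one_lt₀ hs1
  have hbound : ∀ m : ℕ, ∑ n ∈ Finset.range m, ((adm a n).card : ℝ) * s⁻¹ ^ n ≤ K := by
    intro m
    have hc : Tendsto (fun r : ℝ => ∑ n ∈ Finset.range m, ((adm a n).card : ℝ) * r⁻¹ ^ n)
        (𝓝[>] s) (𝓝 (∑ n ∈ Finset.range m, ((adm a n).card : ℝ) * s⁻¹ ^ n)) := by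
      refine tendsto_finsetSum _ fun n _ => ?_
      exact (((tendsto_inv₀ (by positivity)).mono_left nhdsWithin_le_nhds).pow n).const_mul _
    refine le_of_tendsto hc ?_
    have hv : ∀ᶠ r in 𝓝[>] s, val r a < 1 - δ :=
      (tendsto_val hs1 a).eventually_lt_const (by simp only [δ]; linarith)
    filter_upwards [self_mem_nhdsWithin, hv] with r hr hvr
    have hr' : s < r := hr
    have hr0 : 0 < r := by linarith
    have hsum := summable_adm hM ha hr
    have h1 := hsum.sum_le_tsum (Finset.range m) fun n _ => by positivity
    have h2 := tsum_adm_mul hM ha hr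
    set N := ∑' n, ((adm a n).card : ℝ) * r⁻¹ ^ n
    have hN : 0 ≤ N := tsum_nonneg fun n => by positivity
    have h3 : (1 - r⁻¹)⁻¹ ≤ (1 - s⁻¹)⁻¹ := by
      have : r⁻¹ < s⁻¹ := inv_strictAnti₀ (by linarith) hr'
      exact inv_anti₀ (by linarith) (by linarith)
    refine h1.trans ?_
    rw [hK, le_div_iff₀ hδ]
    nlinarith
  obtain ⟨m, hm⟩ := exists_nat_gt K
  refine absurd (hbound m) (not_le.2 (hm.trans_le ?_))
  have hge : ∀ n ∈ Finset.range m, (1 : ℝ) ≤ ((adm a n).card : ℝ) * s⁻¹ ^ n := by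
    intro n _
    rw [card_adm ha, inv_pow, ← div_eq_mul_inv, le_div_iff₀ (by positivity), one_mul]
    exact pow_le_words_ncard hM (symShift_nonempty ha) n
  have := Finset.sum_le_sum hge
  simpa using this

/-! ### Kneading sequences of the maps with constant slope -/

theorem exists_kneading {s : ℝ} (hs : s ∈ Set.Ioc (1 : ℝ) (M + 1)) :
    ∃ a : Sequ M, val s a = 1 ∧ ∀ n, val s (shift n a) ∈ Set.Ioc (-1 : ℝ) 1 := by
  have hs1 := hs.1
  set B : ℝ := M / (s - 1) with hBdef
  have hB : B * (s - 1) = M := div_mul_cancel₀ _ (by linarith)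
  have hB0 : 0 ≤ B := div_nonneg (by positivity) (by linarith)
  obtain ⟨a, ha, han⟩ := exists_itinerary (M := M) hs1
    (S := {z | 2 * z - B ∈ Set.Ioc (-1 : ℝ) 1}) (B := (B + 1) / 2) (z := (1 + B) / 2)
    (fun z hz => by rw [abs_le]; constructor <;> linarith [hz.1, hz.2])
    (fun z hz => by
      have h1 : -1 < 2 * z - B := hz.1
      have h2 : 2 * z - B ≤ 1 := hz.2
      have hlow : -(M + 1 : ℝ) ≤ s * (2 * z - B) := by nlinarith [hs.2]
      have hhigh : s * (2 * z - B) ≤ M + 1 := by nlinarith [hs.2]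
      have hlow' : -(M + 1 : ℝ) < s * (2 * z - B) := by
        rcases le_or_gt 0 (2 * z - B) with h | h
        · have := mul_nonneg (by linarith : 0 ≤ s) h
          have : (0 : ℝ) ≤ M := by positivity
          linarith
        · nlinarith [hs.2]
      obtain ⟨h3, h4⟩ := nat_ceil_bounds (x := (s * (2 * z - B) + M - 1) / 2) (by linarith)
      set d := ⌈(s * (2 * z - B) + M - 1) / 2⌉₊ with hd
      have h5 : d < M + 1 := by
        have : (d : ℝ) < ((M + 1 : ℕ) : ℝ) := by push_cast; linarith
        exact_mod_cast this
      refine ⟨⟨d, h5⟩, ?_, ?_⟩ <;> simp only <;> nlinarith)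
    (by constructor <;> linarith)
  refine ⟨a, by rw [val, ha]; simp only [← hBdef]; ring, fun n => han n⟩

open Classical in
/-- The kneading sequence of slope `s ∈ (1, M + 1]`: the itinerary of the point `1` under the map
with branches `r ↦ s r - (2d - M)` on the interval `(-1, 1]`. -/
noncomputable def kneading (M : ℕ) (s : ℝ) : Sequ M :=
  if hs : s ∈ Set.Ioc (1 : ℝ) (M + 1) then (exists_kneading hs).choose else 0

theorem val_kneading {s : ℝ} (hs : s ∈ Set.Ioc (1 : ℝ) (M + 1)) : val s (kneading M s) = 1 := by
  rw [kneading, dif_pos hs]; exact (exists_kneading hs).choose_spec.1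

theorem val_shift_kneading {s : ℝ} (hs : s ∈ Set.Ioc (1 : ℝ) (M + 1)) (n : ℕ) :
    val s (shift n (kneading M s)) ∈ Set.Ioc (-1 : ℝ) 1 := by
  rw [kneading, dif_pos hs]; exact (exists_kneading hs).choose_spec.2 n

theorem remainder_kneading {s : ℝ} (hs : s ∈ Set.Ioc (1 : ℝ) (M + 1)) (n : ℕ) :
    remainder s (kneading M s) n ∈ Set.Ioc (-1 : ℝ) 1 := by
  rw [← val_shift_eq_remainder hs.1 (val_kneading hs)]; exact val_shift_kneading hs n

theorem bounded_kneading {s : ℝ} (hs : s ∈ Set.Ioc (1 : ℝ) (M + 1)) :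
    Bounded s (kneading M s) :=
  fun n => abs_le.2 ⟨(val_shift_kneading hs n).1.le, (val_shift_kneading hs n).2⟩

/-- The kneading sequence is the smallest expansion of `1` with a bounded orbit. -/
theorem kneading_le {s : ℝ} (hs : s ∈ Set.Ioc (1 : ℝ) (M + 1)) {x : Sequ M} (hx : Bounded s x)
    (h1 : val s x = 1) : toLex (kneading M s) ≤ toLex x := by
  by_contra hc
  obtain ⟨k, hk, hlt⟩ := lex_lt_iff.1 (not_le.1 hc)
  have := (val_eq_of_firstDiff hs.1 hx (bounded_kneading hs) (by rw [h1, val_kneading hs]) hk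
    hlt).2.1
  linarith [(val_shift_kneading hs (k + 1)).1]

theorem kneading_mem_seqV {s : ℝ} (hs : s ∈ Set.Ioc (1 : ℝ) (M + 1)) :
    kneading M s ∈ seqV M := by
  have hb := bounded_kneading hs
  intro n
  constructor
  · by_contra hc
    have := val_le_of_lt hs.1 (hb.shift n) (hb.reflect hs.1) (not_le.1 hc)
    rw [val_reflect hs.1, val_kneading hs] at this
    linarith [(val_shift_kneading hs n).1]
  · by_contra hc
    have hlt := not_le.1 hc
    have h1 := val_le_of_lt hs.1 hb (hb.shift n) hlt
    rw [val_kneading hs] at h1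
    have h2 := (val_shift_kneading hs n).2
    obtain ⟨k, hk, hlt⟩ := lex_lt_iff.1 hlt
    have h3 := (val_eq_of_firstDiff hs.1 hb (hb.shift n) (by rw [val_kneading hs]; linarith) hk
      hlt).2.1
    rw [shift_shift] at h3
    linarith [(val_shift_kneading hs (n + (k + 1))).1]

/-- The kneading sequence starts like every sequence whose first remainders lie in `(-1, 1]`. -/
theorem kneading_eq_of_remainder {s : ℝ} (hs : s ∈ Set.Ioc (1 : ℝ) (M + 1)) {x : Sequ M} {n : ℕ}
    (h : ∀ i ≤ n, remainder s x i ∈ Set.Ioc (-1 : ℝ) 1) : ∀ i < n, kneading M s i = x i := by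
  intro i
  induction i using Nat.strong_induction_on with
  | _ i ih =>
    intro hi
    have h1 := remainder_kneading hs (i + 1)
    have h2 := h (i + 1) hi
    rw [remainder, remainder_congr (fun j hj => ih j hj (by omega))] at h1
    rw [remainder] at h2
    rcases lt_trichotomy (kneading M s i) (x i) with h3 | h3 | h3
    · have := sgn_add_two_le h3
      linarith [h1.2, h2.1]
    · exact h3
    · have := sgn_add_two_le h3
      linarith [h1.1, h2.2]

/-! ### The entropy determined by a kneading sequence -/

/-- If `a` is an expansion of `1` with a bounded orbit, then so are the orbits of all sequences
of the symmetric subshift of `a`. -/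
theorem bounded_of_mem_symShift {s : ℝ} (hs : 1 < s) {a : Sequ M} (ha : Bounded s a)
    (h1 : val s a = 1) {x : Sequ M} (hx : x ∈ symShift a) : Bounded s x := by
  have key : ∀ N, ∀ x ∈ symShift a, val s x - 1 ≤ M / (s - 1) / s ^ N := by
    intro N
    induction N with
    | zero =>
      intro x _
      have := le_of_abs_le (abs_val_le hs x)
      simp only [pow_zero, div_one]
      linarith
    | succ N ih =>
      intro x hx
      have hC : 0 ≤ (M : ℝ) / (s - 1) / s ^ N :=
        div_nonneg (div_nonneg (by positivity) (by linarith)) (by positivity)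
      have hC' : (M : ℝ) / (s - 1) / s ^ (N + 1) = M / (s - 1) / s ^ N / s := by
        rw [pow_succ, div_div _ (s ^ N)]
      have hx0 := (hx 0).2
      rw [shift_zero] at hx0
      rcases hx0.lt_or_eq with hlt | heq
      · obtain ⟨k, hk, hlt⟩ := lex_lt_iff.1 hlt
        have h2 := val_sub hs hk
        have h3 := sgn_add_two_le hlt
        have h4 := abs_le.1 (ha (k + 1))
        have h5 := ih _ (shift_mem_symShift hx (k + 1))
        rw [h1] at h2
        rw [hC', le_div_iff₀ (by linarith)]
        by_contra hc
        push Not at hc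
        have h6 : 0 < val s x - 1 := by
          by_contra h6
          nlinarith
        have h7 : s ^ 1 ≤ s ^ (k + 1) := pow_le_pow_right₀ hs.le (by omega)
        nlinarith
      · rw [toLex_inj.1 heq, h1, sub_self, hC']
        exact div_nonneg hC (by linarith)
  have hle : ∀ x ∈ symShift a, val s x ≤ 1 := by
    intro x hx
    have hlim : Tendsto (fun N : ℕ => (M : ℝ) / (s - 1) / s ^ N) atTop (𝓝 0) :=
      tendsto_const_nhds.div_atTop (tendsto_pow_atTop_atTop_of_one_lt hs)
    have := ge_of_tendsto' hlim fun N => key N x hx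
    linarith
  intro n
  have hn := shift_mem_symShift hx n
  have h2 := hle _ (reflect_mem_symShift hn)
  rw [val_reflect hs] at h2
  exact abs_le.2 ⟨by linarith, hle _ hn⟩

theorem exists_val_le_of_lt_kneading {s : ℝ} (hs : s ∈ Set.Ioc (1 : ℝ) (M + 1)) {b : Sequ M}
    (hlt : toLex b < toLex (kneading M s)) :
    ∃ η > 0, ∀ x ∈ symShift b, |val s x| ≤ 1 - η := by
  have hs1 := hs.1
  obtain ⟨K, hK, hKlt⟩ := lex_lt_iff.1 hlt
  obtain ⟨m, -, hm⟩ := Finset.exists_min_image (Finset.range (K + 2))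
    (fun i => 1 + val s (shift i (kneading M s))) ⟨0, by simp⟩
  set η := 1 + val s (shift m (kneading M s)) with hη
  have hη0 : 0 < η := by linarith [(val_shift_kneading hs m).1]
  have key : ∀ x ∈ symShift b, val s x ≤ 1 - η / s ^ (K + 1) := by
    intro x hx
    have hxb := (hx 0).2
    rw [shift_zero] at hxb
    obtain ⟨k, hk, hklt⟩ := lex_lt_iff.1 (hxb.trans_lt hlt)
    have hkK : k ≤ K := by
      by_contra hc
      push Not at hc
      refine absurd hxb (not_le.2 (lex_lt_of K (fun i hi => ?_) ?_))
      · rw [hk i (by omega), hK i hi]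
      · rw [hk K hc]; exact hKlt
    have hb := bounded_of_mem_symShift hs1 (bounded_kneading hs) (val_kneading hs)
      (symShift_mono hlt.le hx) (k + 1)
    have h1 := val_sub hs1 hk
    have h2 := sgn_add_two_le hklt
    have h3 := hm (k + 1) (by simp; omega)
    rw [val_kneading hs] at h1
    have h4 : η ≤ s ^ (k + 1) * (1 - val s x) := by
      rw [h1]; linarith [(abs_le.1 hb).2]
    have h5 : 0 < 1 - val s x := by
      by_contra hc
      have : 0 < s ^ (k + 1) := by positivity
      nlinarith
    have h6 : s ^ (k + 1) ≤ s ^ (K + 1) := pow_le_pow_right₀ hs1.le (by omega)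
    have h7 : η / s ^ (K + 1) ≤ 1 - val s x := by
      rw [div_le_iff₀ (by positivity)]
      nlinarith
    linarith
  refine ⟨η / s ^ (K + 1), by positivity, fun x hx => abs_le.2 ⟨?_, key x hx⟩⟩
  have := key _ (reflect_mem_symShift hx)
  rw [val_reflect hs1] at this
  linarith

/-- Below the kneading sequence of slope `s`, different words have values that are separated by a
multiple of `s⁻ⁿ`, so that there are at most `C sⁿ` of them. -/
theorem entropy_le_of_lt_kneading {s : ℝ} (hs : s ∈ Set.Ioc (1 : ℝ) (M + 1)) {b : Sequ M}
    (hb : b ∈ seqV M) (hlt : toLex b < toLex (kneading M s)) :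
    entropy (symShift b) ≤ Real.logb (M + 1) s := by
  have hs1 := hs.1
  obtain ⟨η, hη, hval⟩ := exists_val_le_of_lt_kneading hs hlt
  refine entropy_le_logb (symShift_nonempty hb) (C := η⁻¹ + 1) (by positivity) (by linarith)
    fun n => ?_
  have hrep : ∀ w ∈ words n (symShift b), ∃ x ∈ symShift b, ∀ i : Fin n, w i = x i := by
    rintro w ⟨c, hc, k, hk⟩
    exact ⟨shift k c, shift_mem_symShift hc k, hk⟩
  choose! f hf hfw using hrep
  have hsn : (0 : ℝ) < s ^ n := by positivity
  have hsep : ∀ u ∈ words n (symShift b), ∀ w ∈ words n (symShift b),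
      toLex (f u) < toLex (f w) → u ≠ w → 2 * η ≤ s ^ n * (val s (f w) - val s (f u)) := by
    intro u hu w hw hlt hne
    obtain ⟨k, hk, hklt⟩ := lex_lt_iff.1 hlt
    have hkn : k < n := by
      by_contra hc
      refine hne (funext fun i => ?_)
      rw [hfw u hu, hfw w hw, hk i (by omega)]
    have h1 := val_sub hs1 hk
    have h2 := sgn_add_two_le hklt
    have h3 := abs_le.1 (hval _ (shift_mem_symShift (hf u hu) (k + 1)))
    have h4 := abs_le.1 (hval _ (shift_mem_symShift (hf w hw) (k + 1)))
    have h5 : 2 * η ≤ s ^ (k + 1) * (val s (f w) - val s (f u)) := by rw [h1]; linarith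
    have h6 : 0 < val s (f w) - val s (f u) :=
      pos_of_mul_pos_right (by linarith : 0 < s ^ (k + 1) * (val s (f w) - val s (f u)))
        (by positivity)
    have h7 : s ^ (k + 1) ≤ s ^ n := pow_le_pow_right₀ hs1.le hkn
    nlinarith
  let g : (Fin n → Fin (M + 1)) → ℕ := fun w => ⌊(val s (f w) + 1) * s ^ n / (2 * η)⌋₊
  have hnn : ∀ w ∈ words n (symShift b), 0 ≤ (val s (f w) + 1) * s ^ n / (2 * η) := by
    intro w hw
    have := abs_le.1 (hval _ (hf w hw))
    exact div_nonneg (mul_nonneg (by linarith) hsn.le) (by linarith)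
  have hcard := Set.ncard_le_ncard_of_injOn (s := words n (symShift b))
    (t := (Finset.range (⌊s ^ n / η⌋₊ + 1) : Finset ℕ)) g (fun w hw => ?_) ?_
  · rw [Set.ncard_coe_finset, Finset.card_range] at hcard
    have h1 : ((words n (symShift b)).ncard : ℝ) ≤ ⌊s ^ n / η⌋₊ + 1 := by exact_mod_cast hcard
    have h2 : (⌊s ^ n / η⌋₊ : ℝ) ≤ s ^ n / η := Nat.floor_le (by positivity)
    have h3 : (1 : ℝ) ≤ s ^ n := one_le_pow₀ hs1.le
    have h4 : (η⁻¹ + 1) * s ^ n = s ^ n / η + s ^ n := by field_simp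
    linarith
  · simp only [Finset.coe_range, Set.mem_Iio, g]
    refine Nat.lt_succ_of_le (Nat.floor_le_floor ?_)
    have := abs_le.1 (hval _ (hf w hw))
    rw [div_le_div_iff₀ (by linarith) hη]
    have h5 : (val s (f w) + 1) * s ^ n ≤ 2 * s ^ n :=
      mul_le_mul_of_nonneg_right (by linarith) hsn.le
    nlinarith
  · intro u hu w hw hg
    by_contra hne
    have hfl : ∀ u ∈ words n (symShift b), ∀ w ∈ words n (symShift b), g u = g w →
        s ^ n * (val s (f w) - val s (f u)) < 2 * η := by
      intro u hu w hw hg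
      have h1 := Nat.floor_le (hnn u hu)
      have h2 := Nat.lt_floor_add_one ((val s (f w) + 1) * s ^ n / (2 * η))
      have h3 : (⌊(val s (f u) + 1) * s ^ n / (2 * η)⌋₊ : ℝ) =
          ⌊(val s (f w) + 1) * s ^ n / (2 * η)⌋₊ := congrArg Nat.cast hg
      rw [le_div_iff₀ (by linarith)] at h1
      rw [div_lt_iff₀ (by linarith)] at h2
      rw [h3] at h1
      nlinarith
    rcases lt_trichotomy (toLex (f u)) (toLex (f w)) with h | h | h
    · exact absurd (hfl u hu w hw hg) (not_lt.2 (hsep u hu w hw h hne))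
    · refine hne (funext fun i => ?_)
      rw [hfw u hu, hfw w hw, toLex_inj.1 h]
    · exact absurd (hfl w hw u hu hg.symm) (not_lt.2 (hsep w hw u hu h (Ne.symm hne)))

theorem logb_le_entropy_kneading (hM : 1 ≤ M) {s : ℝ} (hs : s ∈ Set.Ioc (1 : ℝ) (M + 1)) :
    Real.logb (M + 1) s ≤ entropy (symShift (kneading M s)) := by
  have hMR : (1 : ℝ) ≤ M := by exact_mod_cast hM
  by_contra hc
  have h1 := (Real.lt_logb_iff_rpow_lt (by linarith) (by linarith [hs.1])).1 (not_le.1 hc)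
  have := val_lt_one hM (kneading_mem_seqV hs) h1
  rw [val_kneading hs] at this
  exact lt_irrefl _ this

theorem hasSum_val {s : ℝ} (hs : 1 < s) (x : Sequ M) :
    HasSum (fun i : ℕ => sgn (x i) * s⁻¹ ^ (i + 1)) (val s x) := by
  have h1 := ((summable_expand hs x).hasSum.mul_left 2).sub
    ((summable_expand hs (fun _ => Fin.last M : Sequ M)).hasSum)
  have h2 : val s x = 2 * expand s x - expand s (fun _ => Fin.last M : Sequ M) := by
    rw [val, expand_top hs]
  rw [h2]
  refine h1.congr_fun fun i => ?_
  simp only [sgn, Fin.val_last, inv_pow]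
  field_simp

/-- A sequence cannot be an expansion of `1` for an interval of slopes, as a power series
vanishing at `0` would be constant. -/
theorem exists_val_ne_one {s t : ℝ} (hs : 1 < s) (hst : s < t) (a : Sequ M) :
    ∃ u ∈ Set.Icc s t, val u a ≠ 1 := by
  by_contra hc
  push Not at hc
  set r : ℝ := (1 + s⁻¹) / 2 with hr
  have hs1 : s⁻¹ < 1 := inv_lt_one_of_one_lt₀ hs
  have hr1 : r < 1 := by simp only [hr]; linarith
  have hsr : s⁻¹ < r := by simp only [hr]; linarith
  have hs0 : 0 < s⁻¹ := by positivity
  have hr0 : 0 < r := hs0.trans hsr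
  let F : ℂ → ℂ := fun z => ∑' i : ℕ, (sgn (a i) : ℂ) * z ^ (i + 1)
  have hF : DifferentiableOn ℂ F (Metric.ball 0 r) := by
    refine Complex.differentiableOn_tsum_of_summable_norm (u := fun i : ℕ => (M : ℝ) * r * r ^ i)
      ((summable_geometric_of_lt_one hr0.le hr1).mul_left _) (fun i => ?_) Metric.isOpen_ball ?_
    · exact ((differentiable_const _).mul (differentiable_id.pow _)).differentiableOn
    · intro i z hz
      rw [mem_ball_zero_iff] at hz
      rw [norm_mul, norm_pow, Complex.norm_real, Real.norm_eq_abs]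
      have h1 : |sgn (a i)| ≤ M := abs_le.2 ⟨neg_le_sgn _, sgn_le _⟩
      have h2 : ‖z‖ ^ (i + 1) ≤ r ^ (i + 1) := pow_le_pow_left₀ (norm_nonneg _) hz.le _
      calc |sgn (a i)| * ‖z‖ ^ (i + 1) ≤ M * r ^ (i + 1) :=
            mul_le_mul h1 h2 (by positivity) (by positivity)
        _ = M * r * r ^ i := by ring
  have hone : ∀ u ∈ Set.Ioo s t, F ((u⁻¹ : ℝ) : ℂ) = 1 := by
    intro u hu
    have h1 := hasSum_val (hs.trans hu.1) a
    rw [hc u ⟨hu.1.le, hu.2.le⟩] at h1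
    have h2 := (Complex.ofRealCLM.hasSum h1).tsum_eq
    simp only [Complex.ofRealCLM_apply, Complex.ofReal_one] at h2
    rw [← h2]
    refine tsum_congr fun i => ?_
    push_cast
    rfl
  set w : ℝ := (s + t) / 2 with hw
  have hws : s < w := by simp only [hw]; linarith
  have hwt : w < t := by simp only [hw]; linarith
  have hmem : ((w⁻¹ : ℝ) : ℂ) ∈ Metric.ball (0 : ℂ) r := by
    rw [mem_ball_zero_iff, Complex.norm_real, Real.norm_of_nonneg (inv_nonneg.2 (by linarith))]
    exact (inv_strictAnti₀ (by linarith) hws).trans hsr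
  have hfreq : ∃ᶠ z in 𝓝[≠] ((w⁻¹ : ℝ) : ℂ), F z = 1 := by
    have hcont : Tendsto (fun u : ℝ => ((u⁻¹ : ℝ) : ℂ)) (𝓝[>] w) (𝓝[≠] ((w⁻¹ : ℝ) : ℂ)) := by
      refine tendsto_nhdsWithin_iff.2 ⟨?_, ?_⟩
      · exact (Complex.continuous_ofReal.tendsto _).comp
          ((tendsto_inv₀ (by linarith)).mono_left nhdsWithin_le_nhds)
      · filter_upwards [self_mem_nhdsWithin] with u hu
        have hu' : w < u := hu
        simp only [Set.mem_compl_iff, Set.mem_singleton_iff, Complex.ofReal_inj, inv_inj]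
        exact hu'.ne'
    refine hcont.frequently (Eventually.frequently ?_)
    filter_upwards [Ioo_mem_nhdsGT hwt] with u hu
    exact hone u ⟨hws.trans hu.1, hu.2⟩
  have heq := (hF.analyticOnNhd Metric.isOpen_ball).eqOn_of_preconnected_of_frequently_eq
    (g := fun _ => 1) analyticOnNhd_const (convex_ball _ _).isPreconnected hmem hfreq
    (Metric.mem_ball_self hr0)
  simp [F] at heq

theorem kneading_strictMono (hM : 1 ≤ M) {s t : ℝ} (hs : s ∈ Set.Ioc (1 : ℝ) (M + 1))
    (ht : t ∈ Set.Ioc (1 : ℝ) (M + 1)) (hst : s < t) :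
    toLex (kneading M s) < toLex (kneading M t) := by
  have hMR : (1 : ℝ) ≤ M := by exact_mod_cast hM
  have hmono : ∀ s ∈ Set.Ioc (1 : ℝ) (M + 1), ∀ t ∈ Set.Ioc (1 : ℝ) (M + 1), s ≤ t →
      toLex (kneading M s) ≤ toLex (kneading M t) := by
    intro s hs t ht hst
    rcases hst.lt_or_eq with hst | rfl
    · by_contra hc
      have h1 := entropy_le_of_lt_kneading hs (kneading_mem_seqV ht) (not_le.1 hc)
      have h2 := logb_le_entropy_kneading hM ht
      have h3 := Real.logb_lt_logb (b := (M : ℝ) + 1) (by linarith) (by linarith [hs.1]) hst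
      linarith
    · exact le_rfl
  refine (hmono s hs t ht hst.le).lt_of_ne fun heq => ?_
  obtain ⟨u, hu, hne⟩ := exists_val_ne_one hs.1 hst (kneading M s)
  have hu' : u ∈ Set.Ioc (1 : ℝ) (M + 1) := ⟨hs.1.trans_le hu.1, hu.2.trans ht.2⟩
  have : kneading M u = kneading M s :=
    toLex_inj.1 (le_antisymm ((hmono u hu' t ht hu.2).trans heq.ge) (hmono s hs u hu' hu.1))
  rw [← this, val_kneading hu'] at hne
  exact hne rfl

open Classical in
/-- The base in which the kneading sequence of slope `s ∈ (1, M + 1]` is the quasi-greedy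
expansion of `1`. -/
noncomputable def base (M : ℕ) (s : ℝ) : ℝ :=
  if h : ∃ q ∈ Set.Ioc (1 : ℝ) (M + 1), alpha M q = kneading M s then h.choose else 0

theorem base_spec (hM : 1 ≤ M) {s : ℝ} (hs : s ∈ Set.Ioc (1 : ℝ) (M + 1)) :
    base M s ∈ Set.Ioc (1 : ℝ) (M + 1) ∧ alpha M (base M s) = kneading M s := by
  have h := exists_base_of_mem_seqV hM (kneading_mem_seqV hs)
  rw [base, dif_pos h]
  exact h.choose_spec

theorem base_strictMono (hM : 1 ≤ M) {s t : ℝ} (hs : s ∈ Set.Ioc (1 : ℝ) (M + 1))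
    (ht : t ∈ Set.Ioc (1 : ℝ) (M + 1)) (hst : s < t) : base M s < base M t := by
  refine lt_of_alpha_lt (base_spec hM hs).1 (base_spec hM ht).1 ?_
  rw [(base_spec hM hs).2, (base_spec hM ht).2]
  exact kneading_strictMono hM hs ht hst

/-- The entropy of the unique expansions in the base of the kneading sequence of slope `s` is
the logarithm of `s`. -/
theorem H_base (hM : 1 ≤ M) {s : ℝ} (hs : s ∈ Set.Ioc (1 : ℝ) (M + 1)) :
    H M (base M s) = Real.logb (M + 1) s := by
  have hMR : (1 : ℝ) ≤ M := by exact_mod_cast hM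
  have hb1 : (1 : ℝ) < M + 1 := by linarith
  obtain ⟨hq, hqa⟩ := base_spec hM hs
  refine le_antisymm ?_ ?_
  · have h1 : H M (base M s) ≤ entropy (symShift (kneading M s)) :=
      H_le_entropy_symShift hq (kneading_mem_seqV hs) (congrArg toLex hqa).le
    refine h1.trans ?_
    rcases hs.2.lt_or_eq with hsM | hsM
    · refine le_of_forall_gt fun c hc => ?_
      obtain ⟨t, hst, ht⟩ := exists_between
        (lt_min hsM ((Real.logb_lt_iff_lt_rpow hb1 (by linarith [hs.1])).1 hc))
      have ht' : t ∈ Set.Ioc (1 : ℝ) (M + 1) := ⟨hs.1.trans hst, (ht.trans_le (min_le_left _ _)).le⟩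
      refine (entropy_le_of_lt_kneading ht' (kneading_mem_seqV hs)
        (kneading_strictMono hM hs ht' hst)).trans_lt ?_
      exact (Real.logb_lt_iff_lt_rpow hb1 (by linarith [ht'.1])).2 (ht.trans_le (min_le_right _ _))
    · conv_rhs => rw [hsM]
      rw [Real.logb_self_eq_one hb1]
      exact entropy_le_one hM (symShift_nonempty (kneading_mem_seqV hs))
  · refine le_of_forall_lt fun c hc => ?_
    obtain ⟨t, ht, hts⟩ := exists_between
      (max_lt hs.1 ((Real.lt_logb_iff_rpow_lt hb1 (by linarith [hs.1])).1 hc))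
    have ht' : t ∈ Set.Ioc (1 : ℝ) (M + 1) :=
      ⟨(le_max_left _ _).trans_lt ht, hts.le.trans hs.2⟩
    have h1 := (Real.lt_logb_iff_rpow_lt hb1 (by linarith [ht'.1])).2
      ((le_max_right _ _).trans_lt ht)
    refine h1.trans_le ((logb_le_entropy_kneading hM ht').trans ?_)
    refine entropy_le_H hq (kneading_mem_seqV ht') ?_
    rw [hqa]
    exact kneading_strictMono hM ht' hs hts

theorem exists_base_H_eq (hM : 1 ≤ M) {c : ℝ} (h0 : 0 < c) (h1 : c ≤ 1) :
    ∃ s ∈ Set.Ioc (1 : ℝ) (M + 1), H M (base M s) = c := by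
  have hMR : (1 : ℝ) ≤ M := by exact_mod_cast hM
  have hs : ((M : ℝ) + 1) ^ c ∈ Set.Ioc (1 : ℝ) (M + 1) :=
    ⟨Real.one_lt_rpow (by linarith) h0,
      (Real.rpow_le_rpow_of_exponent_le (by linarith) h1).trans_eq (Real.rpow_one _)⟩
  refine ⟨_, hs, ?_⟩
  rw [H_base hM hs, Real.logb_rpow (by linarith) (by linarith)]

theorem H_nonneg {q : ℝ} (hq : 1 < q) : 0 ≤ H M q := entropy_nonneg (univoqueSeqs_nonempty hq)

theorem H_le_one (hM : 1 ≤ M) {q : ℝ} (hq : 1 < q) : H M q ≤ 1 :=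
  entropy_le_one hM (univoqueSeqs_nonempty hq)

theorem lt_of_H_lt {p q : ℝ} (hp : p ∈ Set.Ioc (1 : ℝ) (M + 1)) (hq : q ∈ Set.Ioc (1 : ℝ) (M + 1))
    (h : H M p < H M q) : p < q := by
  by_contra hc
  exact absurd (H_mono hq hp (not_lt.1 hc)) (not_le.2 h)

theorem entropy_symShift_alpha (hM : 1 ≤ M) {q : ℝ} (hq : q ∈ Set.Ioc (1 : ℝ) (M + 1))
    (ha : alpha M q ∈ seqV M) : entropy (symShift (alpha M q)) = H M q := by
  refine le_antisymm ?_ (H_le_entropy_symShift hq ha le_rfl)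
  by_contra hc
  obtain ⟨c, hc1, hc2⟩ := exists_between (not_le.1 hc)
  have hle := entropy_le_one hM (symShift_nonempty ha)
  obtain ⟨s, hs, hsc⟩ := exists_base_H_eq hM ((H_nonneg hq.1).trans_lt hc1) (hc2.le.trans hle)
  obtain ⟨hb, hba⟩ := base_spec hM hs
  have hlt := alpha_lt_alpha hq hb (lt_of_H_lt hq hb (hsc ▸ hc1))
  rw [hba] at hlt
  have := entropy_le_of_lt_kneading hs ha hlt
  rw [← H_base hM hs, hsc] at this
  linarith

/-- The kneading sequence depends on the slope continuously from the left. -/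
theorem eventually_kneading_eq (hM : 1 ≤ M) {s : ℝ} (hs : s ∈ Set.Ioc (1 : ℝ) (M + 1)) (n : ℕ) :
    ∀ᶠ t in 𝓝[<] s, t ∈ Set.Ioc (1 : ℝ) (M + 1) ∧ ∀ i < n, kneading M t i = kneading M s i := by
  have h1 : ∀ᶠ t in 𝓝[<] s, ∀ i ∈ Finset.range (n + 1), -1 < remainder t (kneading M s) i := by
    refine (Finset.eventually_all _).2 fun i _ => ?_
    exact ((continuous_remainder (kneading M s) i).tendsto s).mono_left nhdsWithin_le_nhds
      |>.eventually_const_lt (remainder_kneading hs i).1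
  filter_upwards [h1, Ioo_mem_nhdsLT hs.1] with t ht hts
  have ht' : t ∈ Set.Ioc (1 : ℝ) (M + 1) := ⟨hts.1, hts.2.le.trans hs.2⟩
  refine ⟨ht', ?_⟩
  obtain ⟨k, hk, hlt⟩ := lex_lt_iff.1 (kneading_strictMono hM ht' hs hts.2)
  have hkn : n ≤ k := by
    by_contra hc
    have h2 := ht (k + 1) (by simp; omega)
    have h3 := (remainder_kneading ht' (k + 1)).2
    have h4 := sgn_add_two_le hlt
    rw [remainder] at h2 h3
    rw [remainder_congr hk] at h3
    linarith
  exact fun i hi => hk i (by omega)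

theorem H_lt_H_base (hM : 1 ≤ M) {s : ℝ} (hs : s ∈ Set.Ioc (1 : ℝ) (M + 1)) {p : ℝ}
    (hp : p ∈ Set.Ioc (1 : ℝ) (M + 1)) (hlt : p < base M s) : H M p < H M (base M s) := by
  have hMR : (1 : ℝ) ≤ M := by exact_mod_cast hM
  obtain ⟨hq, hqa⟩ := base_spec hM hs
  have h1 := alpha_lt_alpha hp hq hlt
  rw [hqa] at h1
  obtain ⟨k, hk, hklt⟩ := lex_lt_iff.1 h1
  obtain ⟨t, ⟨ht, hta⟩, hts⟩ :=
    ((eventually_kneading_eq hM hs (k + 1)).and self_mem_nhdsWithin).exists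
  obtain ⟨hr, hra⟩ := base_spec hM ht
  have h2 : p < base M t := by
    refine lt_of_alpha_lt hp hr ?_
    rw [hra]
    refine lex_lt_of k (fun i hi => ?_) ?_
    · rw [hk i hi, hta i (by omega)]
    · rw [hta k (by omega)]; exact hklt
  refine (H_mono hp hr h2.le).trans_lt ?_
  rw [H_base hM ht, H_base hM hs]
  exact Real.logb_lt_logb (by linarith) (by linarith [ht.1]) hts

/-! ### Reflected blocks and the Thue-Morse sequence -/

theorem remainder_reflected {s : ℝ} {x z : Sequ M} {m i : ℕ}
    (h : ∀ l < i, sgn (z (m + l)) = -sgn (x l)) :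
    remainder s z (m + i) = s ^ i * (remainder s z m + 1) - remainder s x i := by
  induction i with
  | zero => simp [remainder]
  | succ i ih =>
    rw [← add_assoc, remainder, remainder, ih fun l hl => h l (by omega), h i (by omega), pow_succ]
    ring

/-- Reading the reflection of `x₁…xⱼ` with its last digit raised by one. -/
theorem remainder_reflected_succ {s : ℝ} {x z : Sequ M} {m j : ℕ} (hj : 1 ≤ j)
    (h : ∀ l, l + 1 < j → sgn (z (m + l)) = -sgn (x l))
    (hlast : sgn (z (m + (j - 1))) = -sgn (x (j - 1)) + 2) :
    remainder s z (m + j) + 1 = s ^ j * (remainder s z m + 1) - (remainder s x j + 1) := by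
  obtain ⟨i, rfl⟩ : ∃ i, j = i + 1 := ⟨j - 1, by omega⟩
  rw [Nat.add_sub_cancel] at hlast
  rw [← add_assoc, remainder, remainder, remainder_reflected (x := x) fun l hl => h l (by omega),
    hlast, pow_succ]
  ring

/-- The sequence `x₁…xⱼ (w⁺)^∞`, where `w` is the reflection of `x₁…xⱼ`. -/
def reflectedTail (j : ℕ) (x : Sequ M) : Sequ M :=
  concat j x (cyc j (lastSucc j (reflect x)))

theorem reflectedTail_of_lt {j i : ℕ} (x : Sequ M) (h : i < j) : reflectedTail j x i = x i := by
  simp [reflectedTail, concat, h]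

theorem reflectedTail_of_ge {j i : ℕ} (x : Sequ M) (k : ℕ) (h : i < j) :
    reflectedTail j x (j + k * j + i) =
      if i + 1 = j then (x i).rev + 1 else (x i).rev := by
  have h1 : ¬ (j + k * j + i < j) := by omega
  have h2 : (j + k * j + i - j) % j = i := by
    rw [show j + k * j + i - j = i + j * k by rw [mul_comm]; omega, Nat.add_mul_mod_self_left,
      Nat.mod_eq_of_lt h]
  simp only [reflectedTail, concat, h1, if_false, cyc, h2, lastSucc, reflect]
  split_ifs with h3
  · obtain rfl : i = j - 1 := by omega
    simp
  · rw [Function.update_of_ne (by omega)]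
    rfl

theorem exists_block {j m : ℕ} (hj : 1 ≤ j) (hm : j ≤ m) :
    ∃ k i, i < j ∧ m = j + k * j + i :=
  ⟨(m - j) / j, (m - j) % j, Nat.mod_lt _ hj, by
    have := Nat.div_add_mod' (m - j) j
    omega⟩

theorem reflectedTail_congr {j : ℕ} (hj : 1 ≤ j) {x y : Sequ M} (h : ∀ i < j, x i = y i) :
    reflectedTail j x = reflectedTail j y := by
  funext i
  rcases lt_or_ge i j with hi | hi
  · rw [reflectedTail_of_lt x hi, reflectedTail_of_lt y hi, h i hi]
  · obtain ⟨k, l, hl, rfl⟩ := exists_block hj hi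
    rw [reflectedTail_of_ge x _ hl, reflectedTail_of_ge y _ hl, h _ hl]

theorem sgn_add_one {d : Fin (M + 1)} (h : d < Fin.last M) : sgn (d + 1) = sgn d + 2 := by
  have := Fin.val_add_one_of_lt h
  simp only [sgn, this]
  push_cast
  ring

theorem rev_lt_last {d : Fin (M + 1)} (h : 0 < d) : d.rev < Fin.last M := by
  rw [Fin.lt_def, Fin.val_rev, Fin.val_last]
  have : 0 < (d : ℕ) := h
  have := d.2
  omega

theorem sgn_reflectedTail {j i : ℕ} {x : Sequ M} (k : ℕ) (h : i + 1 < j) :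
    sgn (reflectedTail j x (j + k * j + i)) = -sgn (x i) := by
  rw [reflectedTail_of_ge x k (by omega), if_neg (by omega), sgn_rev]

theorem sgn_reflectedTail_last {j : ℕ} (hj : 1 ≤ j) {x : Sequ M} (hx : 0 < x (j - 1)) (k : ℕ) :
    sgn (reflectedTail j x (j + k * j + (j - 1))) = -sgn (x (j - 1)) + 2 := by
  rw [reflectedTail_of_ge x k (by omega), if_pos (by omega), sgn_add_one (rev_lt_last hx), sgn_rev]

theorem remainder_reflectedTail {s : ℝ} {j i : ℕ} (hi : i < j) (x : Sequ M) (k : ℕ) :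
    remainder s (reflectedTail j x) (j + k * j + i) =
      s ^ i * (remainder s (reflectedTail j x) (j + k * j) + 1) - remainder s x i :=
  remainder_reflected fun _ hl => sgn_reflectedTail k (by omega)

theorem remainder_reflectedTail_zero {s : ℝ} (j : ℕ) (x : Sequ M) :
    remainder s (reflectedTail j x) (j + 0 * j) = remainder s x j := by
  rw [zero_mul, add_zero]
  exact remainder_congr fun i hi => reflectedTail_of_lt x hi

theorem remainder_reflectedTail_succ {s : ℝ} {j : ℕ} (hj : 1 ≤ j) {x : Sequ M}
    (hx : 0 < x (j - 1)) (k : ℕ) :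
    remainder s (reflectedTail j x) (j + (k + 1) * j) + 1 =
      s ^ j * (remainder s (reflectedTail j x) (j + k * j) + 1) - (remainder s x j + 1) := by
  rw [show j + (k + 1) * j = j + k * j + j by ring]
  exact remainder_reflected_succ hj (fun l hl => sgn_reflectedTail k hl)
    (sgn_reflectedTail_last hj hx k)

/-- If `sʲ > 2`, then the kneading sequence of slope `s` satisfies the condition of
irreducibility at `j`: otherwise the distance to the periodic orbit of the block, multiplied by
`sʲ` on each return, would push a remainder above `1`. -/
theorem reflectedTail_lt_kneading {s : ℝ} (hs : s ∈ Set.Ioc (1 : ℝ) (M + 1)) {j : ℕ} (hj : 1 ≤ j)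
    (hsj : 2 < s ^ j) (h0 : 0 < kneading M s (j - 1)) :
    toLex (reflectedTail j (kneading M s)) < toLex (kneading M s) := by
  set a := kneading M s with ha
  set z := reflectedTail j a with hz
  set D := remainder s a j + 1 with hD
  have hD0 : 0 < D := by linarith [(remainder_kneading hs j).1]
  have hgrow : ∀ k : ℕ, D + k * ((s ^ j - 2) * D) ≤ remainder s z (j + k * j) + 1 := by
    intro k
    induction k with
    | zero => rw [remainder_reflectedTail_zero]; simp [hD]
    | succ k ih =>
      rw [remainder_reflectedTail_succ hj h0]
      have h1 : 0 ≤ (k : ℝ) * ((s ^ j - 2) * D) :=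
        mul_nonneg (by positivity) (mul_nonneg (by linarith) hD0.le)
      push_cast
      nlinarith
  by_contra hc
  rcases (not_lt.1 hc).lt_or_eq with hlt | heq
  · obtain ⟨m, hm, hmlt⟩ := lex_lt_iff.1 hlt
    have hjm : j ≤ m := by
      by_contra hc
      rw [hz, reflectedTail_of_lt a (by omega)] at hmlt
      exact lt_irrefl _ hmlt
    obtain ⟨k, i, hi, rfl⟩ := exists_block hj hjm
    have hV := (kneading_mem_seqV hs (j + k * j)).1
    have hagree : ∀ l < i, reflect a l = shift (j + k * j) a l := by
      intro l hl
      rw [shift_apply, hm _ (by omega), hz, reflectedTail_of_ge a k (by omega), if_neg (by omega)]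
      rfl
    have hge : (a i).rev ≤ a (j + k * j + i) := Pi.apply_le_of_toLex hV hagree
    rw [hz, reflectedTail_of_ge a k hi] at hmlt
    split_ifs at hmlt with hij
    · obtain rfl : i = j - 1 := by omega
      have heq : a (j + k * j + (j - 1)) = (a (j - 1)).rev := by
        refine le_antisymm ?_ hge
        rw [Fin.lt_def, Fin.val_add_one_of_lt (rev_lt_last h0)] at hmlt
        exact Fin.le_def.2 (by omega)
      have h1 : remainder s a (j + k * j + j) =
          s ^ j * (remainder s a (j + k * j) + 1) - remainder s a j := by
        refine remainder_reflected fun l hl => ?_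
        rw [← sgn_rev]
        congr 1
        rcases Nat.lt_or_ge l (j - 1) with h2 | h2
        · exact (hagree l h2).symm
        · obtain rfl : l = j - 1 := by omega
          exact heq
      have h2 := (remainder_kneading hs (j + k * j + j)).2
      have h3 : remainder s a (j + k * j) = remainder s z (j + k * j) :=
        remainder_congr fun l hl => hm l (by omega)
      have h4 := hgrow k
      have h5 : 0 ≤ (k : ℝ) * ((s ^ j - 2) * D) :=
        mul_nonneg (by positivity) (mul_nonneg (by linarith) hD0.le)
      rw [← ha, h1, h3] at h2
      nlinarith
    · exact absurd hge (not_le.2 hmlt)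
  · have heq : a = z := toLex_inj.1 heq
    obtain ⟨k, hk⟩ := exists_nat_gt (2 / ((s ^ j - 2) * D))
    have hpos : 0 < (s ^ j - 2) * D := mul_pos (by linarith) hD0
    rw [div_lt_iff₀ hpos] at hk
    have h1 := hgrow k
    rw [← heq] at h1
    linarith [(remainder_kneading hs (j + k * j)).2]

theorem thueMorse_le_one (i : ℕ) : thueMorse i ≤ 1 := by
  induction i using Nat.strong_induction_on with
  | _ i ih =>
    rcases Nat.even_or_odd' i with ⟨j, rfl | rfl⟩
    · rcases Nat.eq_zero_or_pos j with rfl | hj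
      · simp [thueMorse_zero]
      · rw [thueMorse_two_mul]; exact ih j (by omega)
    · rw [thueMorse_two_mul_add_one]; omega

theorem thueMorse_two_pow_add (m i : ℕ) (hi : i < 2 ^ m) :
    thueMorse (2 ^ m + i) = 1 - thueMorse i := by
  induction m generalizing i with
  | zero =>
    obtain rfl : i = 0 := by simpa using hi
    simpa [thueMorse_zero] using thueMorse_two_mul_add_one 0
  | succ m ih =>
    rw [pow_succ] at hi ⊢
    rcases Nat.even_or_odd' i with ⟨j, rfl | rfl⟩
    · rw [show 2 ^ m * 2 + 2 * j = 2 * (2 ^ m + j) by ring, thueMorse_two_mul, thueMorse_two_mul,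
        ih j (by omega)]
    · rw [show 2 ^ m * 2 + (2 * j + 1) = 2 * (2 ^ m + j) + 1 by ring, thueMorse_two_mul_add_one,
        thueMorse_two_mul_add_one, ih j (by omega)]

theorem thueMorse_two_pow (m : ℕ) : thueMorse (2 ^ m) = 1 := by
  have := thueMorse_two_pow_add m 0 (by positivity)
  rwa [add_zero, thueMorse_zero] at this

theorem sgn_genThueMorse_of_even (hM : 1 ≤ M) (h : Even M) (i : ℕ) :
    sgn (genThueMorse M i) = 2 * ((thueMorse (i + 1) : ℝ) - thueMorse i) := by
  obtain ⟨k, rfl⟩ := h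
  have h1 := thueMorse_le_one i
  have h2 := thueMorse_le_one (i + 1)
  have h3 : ((genThueMorse (k + k) i : ℕ)) = k + thueMorse (i + 1) - thueMorse i := by
    simp only [genThueMorse, Even.add_self, if_true, Fin.ofNat]
    rw [show (k + k) / 2 = k by omega, Nat.mod_eq_of_lt (by omega)]
  rw [sgn, h3, Nat.cast_sub (by omega)]
  push_cast
  ring

theorem sgn_genThueMorse_of_odd (h : ¬ Even M) (i : ℕ) :
    sgn (genThueMorse M i) = 2 * (thueMorse (i + 1) : ℝ) - 1 := by
  obtain ⟨k, rfl⟩ := Nat.not_even_iff_odd.1 h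
  have h2 := thueMorse_le_one (i + 1)
  have h3 : ((genThueMorse (2 * k + 1) i : ℕ)) = k + thueMorse (i + 1) := by
    simp only [genThueMorse, h, if_false, Fin.ofNat]
    rw [show (2 * k + 1) / 2 = k by omega, Nat.mod_eq_of_lt (by omega)]
  rw [sgn, h3]
  push_cast
  ring

theorem one_le_blockLen (M n : ℕ) : 1 ≤ blockLen M n := by
  unfold blockLen; split_ifs <;> exact Nat.one_le_two_pow

theorem blockLen_succ (M : ℕ) {n : ℕ} (hn : 1 ≤ n) : blockLen M (n + 1) = 2 * blockLen M n := by
  obtain ⟨m, rfl⟩ : ∃ m, n = m + 1 := ⟨n - 1, by omega⟩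
  unfold blockLen
  split_ifs
  · simp only [Nat.add_sub_cancel]; rw [pow_succ]; ring
  · rw [pow_succ 2 (m + 1)]; ring

theorem le_blockLen (M n : ℕ) : n ≤ blockLen M n := by
  unfold blockLen
  split_ifs
  · have := Nat.lt_two_pow_self (n := n - 1); omega
  · exact Nat.lt_two_pow_self.le

theorem sgn_genThueMorse_add (hM : 1 ≤ M) (n : ℕ) {i : ℕ} (hi : i + 1 < blockLen M n) :
    sgn (genThueMorse M (blockLen M n + i)) = -sgn (genThueMorse M i) := by
  unfold blockLen at *
  have h2 := thueMorse_le_one (i + 1)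
  have h3 := thueMorse_le_one i
  split_ifs at * with h
  · rw [sgn_genThueMorse_of_even hM h, sgn_genThueMorse_of_even hM h, add_assoc,
      thueMorse_two_pow_add _ _ hi, thueMorse_two_pow_add _ _ (by omega),
      Nat.cast_sub h2, Nat.cast_sub h3]
    push_cast; ring
  · rw [sgn_genThueMorse_of_odd h, sgn_genThueMorse_of_odd h, add_assoc,
      thueMorse_two_pow_add _ _ hi, Nat.cast_sub h2]
    push_cast; ring

theorem sgn_genThueMorse_last (hM : 1 ≤ M) (n : ℕ) :
    sgn (genThueMorse M (blockLen M n + (blockLen M n - 1))) =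
      -sgn (genThueMorse M (blockLen M n - 1)) + 2 := by
  have hL := one_le_blockLen M n
  unfold blockLen at *
  split_ifs at * with h
  · have h3 := thueMorse_le_one (2 ^ (n - 1) - 1)
    rw [sgn_genThueMorse_of_even hM h, sgn_genThueMorse_of_even hM h,
      thueMorse_two_pow_add (n - 1) (2 ^ (n - 1) - 1) (by omega),
      show 2 ^ (n - 1) + (2 ^ (n - 1) - 1) + 1 = 2 ^ (n - 1 + 1) by rw [pow_succ]; omega,
      Nat.sub_add_cancel hL, thueMorse_two_pow, thueMorse_two_pow, Nat.cast_sub h3]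
    push_cast; ring
  · rw [sgn_genThueMorse_of_odd h, sgn_genThueMorse_of_odd h,
      show 2 ^ n + (2 ^ n - 1) + 1 = 2 ^ (n + 1) by rw [pow_succ]; omega,
      Nat.sub_add_cancel hL, thueMorse_two_pow, thueMorse_two_pow]
    push_cast; ring

theorem genThueMorse_pos (hM : 1 ≤ M) (n : ℕ) : 0 < genThueMorse M (blockLen M n - 1) := by
  have hL := one_le_blockLen M n
  have hMR : (1 : ℝ) ≤ M := by exact_mod_cast hM
  have h1 : -(M : ℝ) < sgn (genThueMorse M (blockLen M n - 1)) := by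
    unfold blockLen at *
    split_ifs at * with h
    · have h3 : (thueMorse (2 ^ (n - 1) - 1) : ℝ) ≤ 1 := by
        exact_mod_cast thueMorse_le_one (2 ^ (n - 1) - 1)
      rw [sgn_genThueMorse_of_even hM h, Nat.sub_add_cancel hL, thueMorse_two_pow]
      push_cast; linarith
    · rw [sgn_genThueMorse_of_odd h, Nat.sub_add_cancel hL, thueMorse_two_pow]
      push_cast; linarith
  rw [sgn] at h1
  have h2 : (0 : ℝ) < ((genThueMorse M (blockLen M n - 1) : ℕ) : ℝ) := by linarith
  exact_mod_cast h2

theorem remainder_gtm_add (hM : 1 ≤ M) (s : ℝ) (n : ℕ) {i : ℕ} (hi : i < blockLen M n) :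
    remainder s (genThueMorse M) (blockLen M n + i) =
      s ^ i * (remainder s (genThueMorse M) (blockLen M n) + 1) -
        remainder s (genThueMorse M) i :=
  remainder_reflected fun _ hl => sgn_genThueMorse_add hM n (by omega)

theorem remainder_gtm_two_mul (hM : 1 ≤ M) (s : ℝ) (n : ℕ) :
    remainder s (genThueMorse M) (2 * blockLen M n) + 1 =
      (s ^ blockLen M n - 1) * (remainder s (genThueMorse M) (blockLen M n) + 1) := by
  rw [two_mul, remainder_reflected_succ (one_le_blockLen M n)
    (fun l hl => sgn_genThueMorse_add hM n hl) (sgn_genThueMorse_last hM n)]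
  ring

theorem remainder_gtm_one_of_odd (h : ¬ Even M) (s : ℝ) :
    remainder s (genThueMorse M) 1 = s - 1 := by
  have h1 : thueMorse 1 = 1 := by simpa using thueMorse_two_pow 0
  rw [remainder, remainder, sgn_genThueMorse_of_odd h, zero_add, h1]
  push_cast; ring

theorem remainder_gtm_blockLen_one (hM : 1 ≤ M) (s : ℝ) :
    remainder s (genThueMorse M) (blockLen M 1) + 1 = if Even M then s - 1 else s * (s - 1) := by
  have h1 : thueMorse 1 = 1 := by simpa using thueMorse_two_pow 0
  have h2 : thueMorse 2 = 1 := by simpa using thueMorse_two_pow 1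
  unfold blockLen
  split_ifs with h
  · simp only [Nat.sub_self, pow_zero, remainder]
    rw [sgn_genThueMorse_of_even hM h, zero_add, h1, thueMorse_zero]
    push_cast; ring
  · rw [pow_one, remainder, remainder_gtm_one_of_odd h, sgn_genThueMorse_of_odd h, h2]
    push_cast; ring

theorem remainder_gtm_blockLen_pos (hM : 1 ≤ M) {s : ℝ} (hs : 1 < s) {n : ℕ} (hn : 1 ≤ n) :
    0 < remainder s (genThueMorse M) (blockLen M n) + 1 := by
  induction n, hn using Nat.le_induction with
  | base =>
    rw [remainder_gtm_blockLen_one hM]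
    split_ifs
    · linarith
    · nlinarith
  | succ n hn ih =>
    rw [blockLen_succ M hn, remainder_gtm_two_mul hM]
    have := one_lt_pow₀ hs (Nat.one_le_iff_ne_zero.1 (one_le_blockLen M n))
    exact mul_pos (by linarith) ih

/-- A remainder of the generalized Thue-Morse sequence exceeds `-1` if the previous ones are at
most `1`. -/
theorem neg_one_lt_remainder_gtm (hM : 1 ≤ M) {s : ℝ} (hs : 1 < s) {j : ℕ}
    (h : ∀ i < j, remainder s (genThueMorse M) i ≤ 1) :
    -1 < remainder s (genThueMorse M) j := by
  rcases Nat.lt_or_ge j (blockLen M 1) with hj | hj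
  · rcases Nat.eq_zero_or_pos j with rfl | hj0
    · simp only [remainder]; norm_num
    · unfold blockLen at hj
      split_ifs at hj with hev
      · simp at hj; omega
      · obtain rfl : j = 1 := by omega
        rw [remainder_gtm_one_of_odd hev]; linarith
  · classical
    have hex : ∃ n, j < blockLen M (n + 1) := ⟨j, (le_blockLen M (j + 1))⟩
    set n := Nat.find hex with hn
    have hn1 : 1 ≤ n := by
      by_contra hc
      have h1 := Nat.find_spec hex
      rw [← hn, show n = 0 by omega, zero_add] at h1
      omega
    have h1 : blockLen M n ≤ j := by
      have := Nat.find_min hex (m := n - 1) (by omega)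
      rw [Nat.sub_add_cancel hn1] at this
      omega
    have h2 : j < 2 * blockLen M n := by
      rw [← blockLen_succ M hn1]; exact Nat.find_spec hex
    have hj' : blockLen M n + (j - blockLen M n) = j := by omega
    set i := j - blockLen M n
    have hrem := remainder_gtm_add hM s n (i := i) (by omega)
    rw [hj'] at hrem
    rw [hrem]
    have h3 := h i (by have := one_le_blockLen M n; omega)
    have h4 := mul_pos (pow_pos (by linarith : 0 < s) i) (remainder_gtm_blockLen_pos hM hs hn1)
    linarith

theorem remainder_gtm_bounds (hM : 1 ≤ M) {s : ℝ} (hs : 1 < s) {n : ℕ} (hn : 1 ≤ n)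
    (h2 : s ^ blockLen M n < 2) :
    (∀ i < blockLen M n, s ^ i * (remainder s (genThueMorse M) (blockLen M n) + 1) ≤
      remainder s (genThueMorse M) i + 1) ∧
    ∀ i ≤ 2 * blockLen M n, remainder s (genThueMorse M) i ≤ 1 := by
  -- The first half of the assertion carries the second one to the next block length.
  have step : ∀ n, 1 ≤ n → s ^ blockLen M n < 2 →
      (∀ i < blockLen M n, s ^ i * (remainder s (genThueMorse M) (blockLen M n) + 1) ≤
        remainder s (genThueMorse M) i + 1) →
      (∀ i ≤ blockLen M n, remainder s (genThueMorse M) i ≤ 1) →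
      ∀ i ≤ 2 * blockLen M n, remainder s (genThueMorse M) i ≤ 1 := by
    intro n hn h2 h3 h4 i hi
    rcases Nat.lt_or_ge i (blockLen M n) with h | h
    · exact h4 i h.le
    · obtain ⟨l, rfl⟩ : ∃ l, i = blockLen M n + l := ⟨i - blockLen M n, by omega⟩
      rcases Nat.lt_or_ge l (blockLen M n) with h5 | h5
      · rw [remainder_gtm_add hM s n h5]
        linarith [h3 l h5]
      · obtain rfl : l = blockLen M n := by omega
        have h6 := remainder_gtm_two_mul hM s n
        have h7 := remainder_gtm_blockLen_pos hM hs hn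
        have h8 := h4 _ le_rfl
        rw [two_mul] at h6
        nlinarith
  induction n, hn using Nat.le_induction with
  | base =>
    have hD := remainder_gtm_blockLen_one hM s
    have h4 : (∀ i < blockLen M 1, s ^ i * (remainder s (genThueMorse M) (blockLen M 1) + 1) ≤
        remainder s (genThueMorse M) i + 1) ∧
        ∀ i ≤ blockLen M 1, remainder s (genThueMorse M) i ≤ 1 := by
      rw [hD]
      have hD' : remainder s (genThueMorse M) (blockLen M 1) =
        (if Even M then s - 1 else s * (s - 1)) - 1 := by linarith
      by_cases hev : Even M
      · have hL : blockLen M 1 = 1 := by simp [blockLen, hev]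
        rw [hL] at h2 hD' ⊢
        rw [if_pos hev] at hD' ⊢
        rw [pow_one] at h2
        constructor
        · intro i hi
          obtain rfl : i = 0 := by omega
          simp only [remainder, pow_zero]; linarith
        · intro i hi
          obtain rfl | rfl : i = 0 ∨ i = 1 := by omega
          · simp [remainder]
          · linarith
      · have hL : blockLen M 1 = 2 := by simp [blockLen, hev]
        have h1 := remainder_gtm_one_of_odd hev s
        rw [hL] at h2 hD' ⊢
        rw [if_neg hev] at hD' ⊢
        constructor
        · intro i hi
          obtain rfl | rfl : i = 0 ∨ i = 1 := by omega
          · simp only [remainder, pow_zero]; nlinarith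
          · rw [h1, pow_one]; nlinarith
        · intro i hi
          obtain rfl | rfl | rfl : i = 0 ∨ i = 1 ∨ i = 2 := by omega
          · simp [remainder]
          · nlinarith
          · nlinarith
    exact ⟨h4.1, step 1 le_rfl h2 h4.1 h4.2⟩
  | succ n hn ih =>
    have hL := one_le_blockLen M n
    have hs2 : s ^ blockLen M (n + 1) = s ^ blockLen M n * s ^ blockLen M n := by
      rw [blockLen_succ M hn, two_mul, pow_add]
    have hp1 := one_lt_pow₀ hs (Nat.one_le_iff_ne_zero.1 hL)
    set p := s ^ blockLen M n with hp
    rw [hs2] at h2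
    obtain ⟨ih1, ih2⟩ := ih (by nlinarith)
    have hD := remainder_gtm_blockLen_pos hM hs hn
    set D := remainder s (genThueMorse M) (blockLen M n) + 1 with hDdef
    have hD2 : remainder s (genThueMorse M) (blockLen M (n + 1)) + 1 = (p - 1) * D := by
      rw [blockLen_succ M hn, remainder_gtm_two_mul hM]
    have h4 : ∀ i < blockLen M (n + 1),
        s ^ i * (remainder s (genThueMorse M) (blockLen M (n + 1)) + 1) ≤
          remainder s (genThueMorse M) i + 1 := by
      intro i hi
      rw [blockLen_succ M hn] at hi
      rw [hD2]
      rcases Nat.lt_or_ge i (blockLen M n) with h | h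
      · refine le_trans ?_ (ih1 i h)
        have : 0 < s ^ i * D := by positivity
        nlinarith
      · obtain ⟨l, rfl⟩ : ∃ l, i = blockLen M n + l := ⟨i - blockLen M n, by omega⟩
        have h5 : 0 < s ^ l * D := by positivity
        have h6 := ih2 l (by omega)
        rw [remainder_gtm_add hM s n (by omega), pow_add, ← hp, ← hDdef]
        have h7 : p * s ^ l * ((p - 1) * D) = (p * p - p) * (s ^ l * D) := by ring
        rw [h7]
        nlinarith
    refine ⟨h4, step (n + 1) (by omega) (by rw [hs2]; exact h2) h4 ?_⟩
    rw [blockLen_succ M hn]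
    exact ih2

theorem kneading_eq_gtm (hM : 1 ≤ M) {s : ℝ} (hs : s ∈ Set.Ioc (1 : ℝ) (M + 1)) {n : ℕ}
    (hn : 1 ≤ n) (h2 : s ^ blockLen M n < 2) :
    ∀ i < 2 * blockLen M n, kneading M s i = genThueMorse M i := by
  have h := (remainder_gtm_bounds hM hs.1 hn h2).2
  exact kneading_eq_of_remainder hs fun i hi =>
    ⟨neg_one_lt_remainder_gtm hM hs.1 fun l hl => h l (by omega), h i hi⟩

theorem kneading_lt_xi (hM : 1 ≤ M) {s : ℝ} (hs : s ∈ Set.Ioc (1 : ℝ) (M + 1)) {n : ℕ}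
    (hn : 1 ≤ n) (h2 : s ^ blockLen M n < 2) : toLex (kneading M s) < toLex (xi M n) := by
  have hL := one_le_blockLen M n
  have hb := (remainder_gtm_bounds hM hs.1 hn h2).2
  have hg0 := genThueMorse_pos hM n
  have hadd : ∀ i < blockLen M n, remainder s (genThueMorse M) (blockLen M n + i) =
      s ^ i * (remainder s (genThueMorse M) (blockLen M n) + 1) -
        remainder s (genThueMorse M) i := fun i hi => remainder_gtm_add hM s n hi
  have hag := kneading_eq_gtm hM hs hn h2
  have hD0 := remainder_gtm_blockLen_pos hM hs.1 hn
  have hs1 := hs.1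
  rw [show xi M n = reflectedTail (blockLen M n) (genThueMorse M) from rfl]
  set L := blockLen M n
  set g := genThueMorse M
  set z := reflectedTail L g with hz
  set D := remainder s g L + 1 with hD
  have hdecr : ∀ k : ℕ, remainder s z (L + k * L) + 1 ≤ D - k * ((2 - s ^ L) * D) := by
    intro k
    induction k with
    | zero => rw [remainder_reflectedTail_zero]; simp [hD]
    | succ k ih =>
      rw [remainder_reflectedTail_succ hL hg0]
      have h1 : 0 ≤ (k : ℝ) * ((2 - s ^ L) * D) :=
        mul_nonneg (by positivity) (mul_nonneg (by linarith) hD0.le)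
      have h3 := one_lt_pow₀ hs1 (Nat.one_le_iff_ne_zero.1 hL)
      push_cast
      nlinarith
  have hle : ∀ k : ℕ, remainder s z (L + k * L) + 1 ≤ D := by
    intro k
    have h1 : 0 ≤ (k : ℝ) * ((2 - s ^ L) * D) :=
      mul_nonneg (by positivity) (mul_nonneg (by linarith) hD0.le)
    linarith [hdecr k]
  by_contra hc
  rcases (not_lt.1 hc).lt_or_eq with hlt | heq
  · obtain ⟨m, hm, hmlt⟩ := lex_lt_iff.1 hlt
    have hjm : L ≤ m := by
      by_contra hc
      rw [hz, reflectedTail_of_lt g (by omega), hag m (by omega)] at hmlt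
      exact lt_irrefl _ hmlt
    have h3 : remainder s (kneading M s) (m + 1) ≤ remainder s z (m + 1) - 2 := by
      have := sgn_add_two_le hmlt
      rw [remainder, remainder, remainder_congr hm]
      linarith
    have h4 : remainder s z (m + 1) ≤ 1 := by
      obtain ⟨k, i, hi, rfl⟩ := exists_block hL hjm
      rcases Nat.lt_or_ge (i + 1) L with h5 | h5
      · rw [add_assoc, remainder_reflectedTail h5]
        have h6 := hadd (i + 1) h5
        have h7 := hb (L + (i + 1)) (by omega)
        rw [h6] at h7
        have h8 := mul_le_mul_of_nonneg_left (hle k) (pow_nonneg (by linarith : 0 ≤ s) (i + 1))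
        linarith
      · rw [show L + k * L + i + 1 = L + (k + 1) * L by rw [add_mul, one_mul]; omega]
        have h6 := hb L (by omega)
        linarith [hle (k + 1)]
    linarith [(remainder_kneading hs (m + 1)).1]
  · have heq : z = kneading M s := toLex_inj.1 heq
    have hpos : 0 < (2 - s ^ L) * D := mul_pos (by linarith) hD0
    obtain ⟨k, hk⟩ := exists_nat_gt (D / ((2 - s ^ L) * D))
    rw [div_lt_iff₀ hpos] at hk
    have h1 := hdecr k
    rw [heq] at h1
    linarith [(remainder_kneading hs (L + k * L)).1]

/-- For slopes close to `1` the kneading sequence follows the generalized Thue-Morse sequence. -/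
theorem exists_kneading_eq_gtm (hM : 1 ≤ M) {t : ℝ} (ht : 1 < t) (n : ℕ) :
    ∃ s ∈ Set.Ioc (1 : ℝ) (M + 1), s < t ∧ ∀ i < n, kneading M s i = genThueMorse M i := by
  have hMR : (1 : ℝ) ≤ M := by exact_mod_cast hM
  have h1 : Tendsto (fun s : ℝ => s ^ blockLen M (n + 1)) (𝓝[>] 1) (𝓝 (1 ^ blockLen M (n + 1))) :=
    ((continuous_pow _).tendsto 1).mono_left nhdsWithin_le_nhds
  rw [one_pow] at h1
  obtain ⟨s, hs, hs1, hs2⟩ := ((h1.eventually_lt_const one_lt_two).and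
    (Ioo_mem_nhdsGT (lt_min ht (by linarith : (1 : ℝ) < M + 1)))).exists
  have hs' : s ∈ Set.Ioc (1 : ℝ) (M + 1) := ⟨hs1, (hs2.trans_le (min_le_right _ _)).le⟩
  refine ⟨s, hs', hs2.trans_le (min_le_left _ _), fun i hi => ?_⟩
  refine kneading_eq_gtm hM hs' (by omega) hs i ?_
  have := le_blockLen M (n + 1)
  omega

theorem exists_kneading_lt_of_gtm_lt (hM : 1 ≤ M) {a : Sequ M}
    (h : toLex (genThueMorse M) < toLex a) {t : ℝ} (ht : 1 < t) :
    ∃ s ∈ Set.Ioc (1 : ℝ) (M + 1), s < t ∧ toLex (kneading M s) < toLex a := by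
  obtain ⟨k, hk, hlt⟩ := lex_lt_iff.1 h
  obtain ⟨s, hs, hst, hag⟩ := exists_kneading_eq_gtm hM ht (k + 1)
  refine ⟨s, hs, hst, lex_lt_of k (fun i hi => ?_) ?_⟩
  · rw [hag i (by omega), hk i hi]
  · rw [hag k (by omega)]; exact hlt

theorem gtm_lt_kneading (hM : 1 ≤ M) {s : ℝ} (hs : s ∈ Set.Ioc (1 : ℝ) (M + 1)) :
    toLex (genThueMorse M) < toLex (kneading M s) := by
  by_contra hc
  obtain ⟨t, ht1, hts⟩ := exists_between hs.1
  have ht : t ∈ Set.Ioc (1 : ℝ) (M + 1) := ⟨ht1, hts.le.trans hs.2⟩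
  obtain ⟨k, hk, hlt⟩ := lex_lt_iff.1 ((kneading_strictMono hM ht hs hts).trans_le (not_lt.1 hc))
  obtain ⟨u, hu, hut, hag⟩ := exists_kneading_eq_gtm hM ht1 (k + 1)
  refine absurd (kneading_strictMono hM hu ht hut) (lt_asymm (lex_lt_of k (fun i hi => ?_) ?_))
  · rw [hk i hi, hag i (by omega)]
  · rw [hag k (by omega)]; exact hlt

theorem gtm_mem_seqV (hM : 1 ≤ M) : genThueMorse M ∈ seqV M := by
  intro m
  constructor
  · by_contra hc
    obtain ⟨k, hk, hlt⟩ := lex_lt_iff.1 (not_le.1 hc)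
    obtain ⟨s, hs, -, hag⟩ := exists_kneading_eq_gtm hM one_lt_two (m + k + 1)
    refine absurd (kneading_mem_seqV hs m).1 (not_le.2 (lex_lt_of k (fun i hi => ?_) ?_))
    · have := hk i hi
      simp only [shift_apply, reflect] at this ⊢
      rw [hag _ (by omega), hag _ (by omega), this]
    · simp only [shift_apply, reflect] at hlt ⊢
      rw [hag _ (by omega), hag _ (by omega)]
      exact hlt
  · by_contra hc
    obtain ⟨k, hk, hlt⟩ := lex_lt_iff.1 (not_le.1 hc)
    obtain ⟨s, hs, -, hag⟩ := exists_kneading_eq_gtm hM one_lt_two (m + k + 1)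
    refine absurd (kneading_mem_seqV hs m).2 (not_le.2 (lex_lt_of k (fun i hi => ?_) ?_))
    · have := hk i hi
      simp only [shift_apply] at this ⊢
      rw [hag _ (by omega), hag _ (by omega), this]
    · simp only [shift_apply] at hlt ⊢
      rw [hag _ (by omega), hag _ (by omega)]
      exact hlt

theorem komornikLoreti_spec (hM : 1 ≤ M) :
    komornikLoreti M ∈ Set.Ioc (1 : ℝ) (M + 1) ∧
      alpha M (komornikLoreti M) = genThueMorse M := by
  obtain ⟨q, hq, hqa⟩ := exists_base_of_mem_seqV hM (gtm_mem_seqV hM)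
  have : {q | q ∈ Set.Ioc (1 : ℝ) (M + 1) ∧ IsQuasiGreedy q (genThueMorse M)} = {q} := by
    ext p
    constructor
    · rintro ⟨hp, hpa⟩
      have hpa := hpa.eq_alpha hp
      rcases lt_trichotomy p q with h | h | h
      · exact absurd (alpha_lt_alpha hp hq h) (by rw [← hpa, hqa]; exact lt_irrefl _)
      · exact h
      · exact absurd (alpha_lt_alpha hq hp h) (by rw [← hpa, hqa]; exact lt_irrefl _)
    · rintro rfl
      exact ⟨hq, hqa ▸ isQuasiGreedy_alpha hq⟩
  rw [komornikLoreti, this, csInf_singleton]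
  exact ⟨hq, hqa⟩

theorem komornikLoreti_lt_base (hM : 1 ≤ M) {s : ℝ} (hs : s ∈ Set.Ioc (1 : ℝ) (M + 1)) :
    komornikLoreti M < base M s := by
  refine lt_of_alpha_lt (komornikLoreti_spec hM).1 (base_spec hM hs).1 ?_
  rw [(komornikLoreti_spec hM).2, (base_spec hM hs).2]
  exact gtm_lt_kneading hM hs

/-- For `M` odd and slope less than `2`, irreducibility imposes nothing at `1`: the word
`a₁⁻` is the digit `(M - 1) / 2`. -/
theorem cyc_one_not_mem_seqV (h : ¬ Even M) {s : ℝ} (hs : s ∈ Set.Ioc (1 : ℝ) (M + 1))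
    (h2 : s < 2) : cyc 1 (lastPred 1 (kneading M s)) ∉ seqV M := by
  intro hV
  obtain ⟨k, rfl⟩ := Nat.not_even_iff_odd.1 h
  have h1 := remainder_kneading hs 1
  simp only [remainder, sgn] at h1
  set a := kneading (2 * k + 1) s
  have hs1 := hs.1
  have h3 : (a 0 : ℕ) = k + 1 := by
    obtain ⟨h4, h5⟩ := h1
    push_cast at h4 h5
    have h6 : ((a 0 : ℕ) : ℝ) < ((k + 2 : ℕ) : ℝ) := by push_cast; linarith
    have h7 : ((k : ℕ) : ℝ) < ((a 0 : ℕ) : ℝ) := by linarith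
    have h6 : (a 0 : ℕ) < k + 2 := by exact_mod_cast h6
    have h7 : k < (a 0 : ℕ) := by exact_mod_cast h7
    omega
  have h4 := (hV 0).1
  rw [shift_zero] at h4
  have h5 := Pi.apply_le_of_toLex (i := 0) h4 fun j hj => absurd hj (by omega)
  have h6 : ((a 0 - 1 : Fin (2 * k + 1 + 1)) : ℕ) = k := by
    rw [Fin.val_sub_one_of_ne_zero, h3]
    · rfl
    · intro h0
      rw [h0] at h3
      simp at h3
  simp only [cyc, lastPred, reflect, Nat.mod_one, Nat.sub_self, Function.update_self,
    Fin.le_def, Fin.val_rev, h6] at h5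
  omega

/-- Apart from the slopes that are roots of `2`, all kneading sequences are irreducible or
`*`-irreducible. -/
theorem kneading_irreducible (hM : 1 ≤ M) {s : ℝ} (hs : s ∈ Set.Ioc (1 : ℝ) (M + 1))
    (hne : ∀ j, 1 ≤ j → s ^ j ≠ 2) :
    IsIrreducible (kneading M s) ∨ IsStarIrreducible (kneading M s) := by
  have hs1 := hs.1
  rcases lt_or_gt_of_ne (hne _ (one_le_blockLen M 1)) with hlt | hgt
  · right
    classical
    have hex : ∃ n, 2 < s ^ blockLen M (n + 1) := by
      obtain ⟨n, hn⟩ := pow_unbounded_of_one_lt 2 hs1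
      exact ⟨n, hn.trans_le (pow_le_pow_right₀ hs1.le (by have := le_blockLen M (n + 1); omega))⟩
    set n := Nat.find hex with hn
    have hspec : 2 < s ^ blockLen M (n + 1) := Nat.find_spec hex
    have hn1 : 1 ≤ n := by
      by_contra hc
      rw [show n = 0 by omega, zero_add] at hspec
      linarith
    have hmin : s ^ blockLen M n < 2 := by
      have := Nat.find_min hex (m := n - 1) (by omega)
      rw [Nat.sub_add_cancel hn1, not_lt] at this
      exact this.lt_of_ne (hne _ (one_le_blockLen M n))
    have hag := kneading_eq_gtm hM hs hn1 hmin
    rw [← blockLen_succ M hn1] at hag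
    refine ⟨kneading_mem_seqV hs, n, hn1, ?_, kneading_lt_xi hM hs hn1 hmin, fun j hj h0 _ => ?_⟩
    · have h1 := reflectedTail_lt_kneading hs (one_le_blockLen M (n + 1)) hspec (by
        rw [hag _ (by have := one_le_blockLen M (n + 1); omega)]
        exact genThueMorse_pos hM (n + 1))
      rw [reflectedTail_congr (one_le_blockLen M (n + 1)) hag] at h1
      exact h1.le
    · have hj' : blockLen M (n + 1) < j := by
        simpa only [blockLen, Nat.add_sub_cancel] using hj
      exact reflectedTail_lt_kneading hs (by omega)
        (hspec.trans_le (pow_le_pow_right₀ hs1.le hj'.le)) h0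
  · left
    refine ⟨kneading_mem_seqV hs, fun j hj h0 hV => ?_⟩
    rcases lt_or_gt_of_ne (hne j hj) with h | h
    · have hjL : j < blockLen M 1 := by
        by_contra hc
        have := pow_le_pow_right₀ hs1.le (not_lt.1 hc)
        linarith
      unfold blockLen at hjL
      split_ifs at hjL with hev
      · simp at hjL; omega
      · obtain rfl : j = 1 := by omega
        rw [pow_one] at h
        exact absurd hV (cyc_one_not_mem_seqV hev hs h)
    · exact reflectedTail_lt_kneading hs hj h h0

/-! ### The bifurcation set is the closure of the irreducible bases -/

theorem sgn_injective : Function.Injective (sgn : Fin (M + 1) → ℝ) := by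
  intro d d' h
  have : ((d : ℕ) : ℝ) = (d' : ℕ) := by simp only [sgn] at h; linarith
  exact Fin.ext (by exact_mod_cast this)

theorem agree_of_le_of_le {x a y : Sequ M} (hxa : toLex x ≤ toLex a) (hay : toLex a ≤ toLex y)
    {m : ℕ} (h : ∀ i < m, x i = y i) : ∀ i < m, a i = y i := by
  intro i
  induction i using Nat.strong_induction_on with
  | _ i ih =>
    intro hi
    refine le_antisymm (Pi.apply_le_of_toLex hay fun j hj => ih j hj (by omega)) ?_
    rw [← h i hi]
    exact Pi.apply_le_of_toLex hxa fun j hj => by rw [ih j hj (by omega), h j (by omega)]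

theorem xi_eq_gtm (hM : 1 ≤ M) (n : ℕ) :
    ∀ i < 2 * blockLen M n, xi M n i = genThueMorse M i := by
  intro i hi
  have hL := one_le_blockLen M n
  rw [show xi M n = reflectedTail (blockLen M n) (genThueMorse M) from rfl]
  rcases Nat.lt_or_ge i (blockLen M n) with h | h
  · exact reflectedTail_of_lt _ h
  · obtain ⟨l, rfl⟩ : ∃ l, i = blockLen M n + l := ⟨i - blockLen M n, by omega⟩
    apply sgn_injective
    have h0 : blockLen M n + l = blockLen M n + 0 * blockLen M n + l := by ring
    rcases Nat.lt_or_ge (l + 1) (blockLen M n) with h1 | h1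
    · rw [sgn_genThueMorse_add hM n h1, h0, sgn_reflectedTail 0 h1]
    · obtain rfl : l = blockLen M n - 1 := by omega
      rw [sgn_genThueMorse_last hM n, h0, sgn_reflectedTail_last hL (genThueMorse_pos hM n)]

theorem gtm_agree_of_xi (hM : 1 ≤ M) {n : ℕ} (hn : 1 ≤ n) {a : Sequ M}
    (h1 : toLex (xi M (n + 1)) ≤ toLex a) (h2 : toLex a < toLex (xi M n)) :
    ∀ i < blockLen M (n + 1), a i = genThueMorse M i := by
  intro i hi
  rw [agree_of_le_of_le h1 h2.le (m := blockLen M (n + 1)) (fun l hl => ?_) i hi]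
  · exact xi_eq_gtm hM n i (by rwa [← blockLen_succ M hn])
  · rw [xi_eq_gtm hM (n + 1) l (by omega), xi_eq_gtm hM n l (by rwa [← blockLen_succ M hn])]

theorem H_pos_of_komornikLoreti_lt (hM : 1 ≤ M) {q : ℝ} (hq : q ∈ Set.Ioc (1 : ℝ) (M + 1))
    (h : komornikLoreti M < q) : 0 < H M q := by
  have hMR : (1 : ℝ) ≤ M := by exact_mod_cast hM
  have hlt := alpha_lt_alpha (komornikLoreti_spec hM).1 hq h
  rw [(komornikLoreti_spec hM).2] at hlt
  obtain ⟨s, hs, -, hsa⟩ := exists_kneading_lt_of_gtm_lt hM hlt one_lt_two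
  rw [← (base_spec hM hs).2] at hsa
  have h1 := H_mono (base_spec hM hs).1 hq (lt_of_alpha_lt (base_spec hM hs).1 hq hsa).le
  rw [H_base hM hs] at h1
  exact (Real.logb_pos (by linarith) hs.1).trans_le h1

theorem H_eq_zero_of_le (hM : 1 ≤ M) {q : ℝ} (hq : q ∈ Set.Ioc (1 : ℝ) (M + 1))
    (h : q ≤ komornikLoreti M) : H M q = 0 := by
  refine le_antisymm (le_of_forall_gt fun c hc => ?_) (H_nonneg hq.1)
  obtain ⟨d, hd0, hd⟩ := exists_between (lt_min hc one_pos)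
  obtain ⟨s, hs, hsd⟩ := exists_base_H_eq hM hd0 (hd.le.trans (min_le_right _ _))
  have h1 := H_mono hq (base_spec hM hs).1 (h.trans (komornikLoreti_lt_base hM hs).le)
  rw [hsd] at h1
  exact h1.trans_lt (hd.trans_le (min_le_left _ _))

/-- If the quasi-greedy expansion `a` lies in `seqV M` but is not the kneading sequence `b` of the
slope `s` given by its entropy, then `a` and `b` are expansions of `1` with bounded orbits that
part at the last digit of a period `j` of `b`, and the condition of irreducibility fails at `j`. -/
theorem exists_not_irredAt (hM : 1 ≤ M) {q : ℝ} (hq : q ∈ Set.Ioc (1 : ℝ) (M + 1))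
    (ha : alpha M q ∈ seqV M) (hH : 0 < H M q)
    (hne : alpha M q ≠ kneading M (((M : ℝ) + 1) ^ H M q)) :
    ∃ j, 1 ≤ j ∧ ¬ IrredAt (alpha M q) j ∧
      remainder (((M : ℝ) + 1) ^ H M q) (alpha M q) j = -1 ∧
      ∀ i, remainder (((M : ℝ) + 1) ^ H M q) (alpha M q) i ≤ 1 := by
  have hMR : (1 : ℝ) ≤ M := by exact_mod_cast hM
  have hent := entropy_symShift_alpha hM hq ha
  have hbd := bounded_of_entropy hM ha (by rwa [hent]) (self_mem_symShift ha)
  have hval := val_eq_one_of_entropy hM ha (by rwa [hent])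
  rw [hent] at hbd hval
  have hs : ((M : ℝ) + 1) ^ H M q ∈ Set.Ioc (1 : ℝ) (M + 1) :=
    ⟨Real.one_lt_rpow (by linarith) hH, (Real.rpow_le_rpow_of_exponent_le (by linarith)
      (H_le_one hM hq.1)).trans_eq (Real.rpow_one _)⟩
  set s := ((M : ℝ) + 1) ^ H M q
  set a := alpha M q
  set b := kneading M s with hb
  have hlt : toLex b < toLex a :=
    (kneading_le hs hbd hval).lt_of_ne fun h => hne (toLex_inj.1 h).symm
  obtain ⟨k, hk, hklt⟩ := lex_lt_iff.1 hlt
  have hbb := bounded_kneading hs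
  obtain ⟨h1, h2, h3⟩ := val_eq_of_firstDiff hs.1 hbb hbd (by rw [val_kneading hs, hval]) hk hklt
  have hper : shift (k + 1) b = b := toLex_inj.1
    (le_antisymm (kneading_mem_seqV hs (k + 1)).2 (kneading_le hs (hbb.shift _) h1))
  have hcyc : ∀ i, b (i % (k + 1)) = b i := by
    intro i
    induction i using Nat.strong_induction_on with
    | _ i ih =>
      rcases Nat.lt_or_ge i (k + 1) with h | h
      · rw [Nat.mod_eq_of_lt h]
      · rw [Nat.mod_eq_sub_mod h, ih _ (by omega), ← congrFun hper (i - (k + 1)), shift_apply,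
          Nat.add_sub_cancel' h]
  have hbk : b k < Fin.last M := hklt.trans_le (Fin.le_last _)
  have hak : a k = b k + 1 := sgn_injective (by rw [h3, sgn_add_one hbk])
  have hpred : cyc (k + 1) (lastPred (k + 1) a) = b := by
    funext i
    rw [← hcyc i]
    have hmod : i % (k + 1) < k + 1 := Nat.mod_lt _ (Nat.succ_pos k)
    simp only [cyc, lastPred, Nat.add_sub_cancel]
    rcases eq_or_ne (i % (k + 1)) k with h | h
    · rw [h, Function.update_self, hak, add_sub_cancel_right]
    · rw [Function.update_of_ne h, hk _ (by omega)]
  have hsucc : cyc (k + 1) (lastSucc (k + 1) (reflect a)) = reflect b := by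
    funext i
    rw [reflect, ← hcyc i]
    have hmod : i % (k + 1) < k + 1 := Nat.mod_lt _ (Nat.succ_pos k)
    simp only [cyc, lastSucc, Nat.add_sub_cancel]
    rcases eq_or_ne (i % (k + 1)) k with h | h
    · rw [h, Function.update_self, reflect]
      apply sgn_injective
      have h0 : 0 < a k := lt_of_le_of_lt (Fin.zero_le _) hklt
      rw [sgn_add_one (rev_lt_last h0), sgn_rev, sgn_rev, h3]
      ring
    · rw [Function.update_of_ne h, hk _ (by omega)]
      rfl
  refine ⟨k + 1, by omega, fun hirr => ?_, ?_, fun i => ?_⟩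
  · have h4 := hirr (lt_of_le_of_lt (Fin.zero_le _) hklt)
      (by rw [hpred]; exact kneading_mem_seqV hs)
    rw [hsucc] at h4
    have h5 := shift_lt_shift_of_agree h4 (n := k + 1) fun i hi => by simp [concat, hi]
    have h6 : shift (k + 1) (concat (k + 1) a (reflect b)) = reflect b := by
      funext i
      simp only [shift, concat]
      rw [if_neg (by omega), Nat.add_sub_cancel_left]
    rw [h6] at h5
    -- The reflection of `b` is the largest bounded expansion of `-1`.
    obtain ⟨l, hl, hllt⟩ := lex_lt_iff.1 h5
    have h7 := (val_eq_of_firstDiff hs.1 (hbb.reflect hs.1) (hbd.shift (k + 1))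
      (by rw [val_reflect hs.1, val_kneading hs, h2]) hl hllt).1
    rw [shift_reflect, val_reflect hs.1] at h7
    linarith [(val_shift_kneading hs (l + 1)).1]
  · rw [← val_shift_eq_remainder hs.1 hval, h2]
  · rw [← val_shift_eq_remainder hs.1 hval]
    exact le_of_abs_le (hbd i)

/-- Irreducible and `*`-irreducible quasi-greedy expansions above the Komornik-Loreti constant
are kneading sequences. -/
theorem exists_eq_base_of_irreducible (hM : 1 ≤ M) {q : ℝ} (hq : q ∈ Set.Ioc (1 : ℝ) (M + 1))
    (hqc : komornikLoreti M < q)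
    (h : IsIrreducible (alpha M q) ∨ IsStarIrreducible (alpha M q)) :
    ∃ s ∈ Set.Ioc (1 : ℝ) (M + 1), q = base M s := by
  have hMR : (1 : ℝ) ≤ M := by exact_mod_cast hM
  have hH := H_pos_of_komornikLoreti_lt hM hq hqc
  have hs : ((M : ℝ) + 1) ^ H M q ∈ Set.Ioc (1 : ℝ) (M + 1) :=
    ⟨Real.one_lt_rpow (by linarith) hH, (Real.rpow_le_rpow_of_exponent_le (by linarith)
      (H_le_one hM hq.1)).trans_eq (Real.rpow_one _)⟩
  have ha : alpha M q ∈ seqV M := h.elim (fun h => h.1) fun h => h.1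
  by_cases hne : alpha M q = kneading M (((M : ℝ) + 1) ^ H M q)
  · refine ⟨_, hs, ?_⟩
    obtain ⟨hb, hba⟩ := base_spec hM hs
    rw [← hba] at hne
    rcases lt_trichotomy q (base M (((M : ℝ) + 1) ^ H M q)) with h1 | h1 | h1
    · exact absurd (alpha_lt_alpha hq hb h1) (by rw [hne]; exact lt_irrefl _)
    · exact h1
    · exact absurd (alpha_lt_alpha hb hq h1) (by rw [hne]; exact lt_irrefl _)
  · exfalso
    obtain ⟨j, hj, hirr, hrem, hle⟩ := exists_not_irredAt hM hq ha hH hne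
    rcases h with h | ⟨-, n, hn, h1, h2, h3⟩
    · exact hirr (h.2 j hj)
    · have h3' : ∀ j, blockLen M (n + 1) < j → IrredAt (alpha M q) j := by
        simpa only [blockLen, Nat.add_sub_cancel] using h3
      have hjn : j ≤ blockLen M (n + 1) := by
        by_contra hc
        exact hirr (h3' j (not_le.1 hc))
      have hag := gtm_agree_of_xi hM hn h1 h2
      have hc : ∀ i ≤ j, remainder (((M : ℝ) + 1) ^ H M q) (genThueMorse M) i =
          remainder (((M : ℝ) + 1) ^ H M q) (alpha M q) i := fun i hi =>
        remainder_congr fun l hl => (hag l (by omega)).symm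
      have h4 := neg_one_lt_remainder_gtm hM hs.1 (j := j) fun i hi => by
        rw [hc i hi.le]; exact hle i
      rw [hc j le_rfl, hrem] at h4
      exact lt_irrefl _ h4

theorem base_mem_bifurcationSet (hM : 1 ≤ M) {s : ℝ} (hs : s ∈ Set.Ioc (1 : ℝ) (M + 1)) :
    base M s ∈ bifurcationSet M := by
  obtain ⟨hb, -⟩ := base_spec hM hs
  refine ⟨hb, fun ε hε => ?_⟩
  obtain ⟨p, hp1, hp2⟩ := exists_between (max_lt hb.1 (by linarith : base M s - ε < base M s))
  have hp : p ∈ Set.Ioc (1 : ℝ) (M + 1) :=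
    ⟨(le_max_left _ _).trans_lt hp1, hp2.le.trans hb.2⟩
  exact ⟨p, hp, ⟨(le_max_right _ _).trans_lt hp1, by linarith⟩, (H_lt_H_base hM hs hp hp2).ne⟩

theorem countable_roots_two : {s : ℝ | 0 < s ∧ ∃ j : ℕ, 1 ≤ j ∧ s ^ j = 2}.Countable := by
  refine (Set.countable_range fun j : ℕ => (2 : ℝ) ^ ((j : ℝ)⁻¹)).mono ?_
  rintro s ⟨hs, j, hj, hsj⟩
  exact ⟨j, by rw [← hsj]; exact Real.pow_rpow_inv_natCast hs.le (by omega)⟩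

/-- Between two bases with different entropies there is the base of a kneading sequence whose
slope is not a root of `2`. -/
theorem exists_base_between (hM : 1 ≤ M) {p q : ℝ} (hp : p ∈ Set.Ioc (1 : ℝ) (M + 1))
    (hq : q ∈ Set.Ioc (1 : ℝ) (M + 1)) (h : H M p < H M q) :
    ∃ s ∈ Set.Ioc (1 : ℝ) (M + 1), (∀ j, 1 ≤ j → s ^ j ≠ 2) ∧ base M s ∈ Set.Ioo p q := by
  have hMR : (1 : ℝ) ≤ M := by exact_mod_cast hM
  have hb1 : (1 : ℝ) < M + 1 := by linarith
  obtain ⟨s, hsc, hs1, hs2⟩ := (countable_roots_two.dense_compl ℝ).exists_between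
    (Real.rpow_lt_rpow_of_exponent_lt hb1 h)
  have hs0 : 1 < s := (Real.one_le_rpow hb1.le (H_nonneg hp.1)).trans_lt hs1
  have hs : s ∈ Set.Ioc (1 : ℝ) (M + 1) := ⟨hs0, hs2.le.trans
    ((Real.rpow_le_rpow_of_exponent_le hb1.le (H_le_one hM hq.1)).trans_eq (Real.rpow_one _))⟩
  obtain ⟨hb, -⟩ := base_spec hM hs
  refine ⟨s, hs, fun j hj hsj => hsc ⟨by linarith, j, hj, hsj⟩, ?_, ?_⟩
  · refine lt_of_H_lt hp hb ?_
    rw [H_base hM hs]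
    exact (Real.lt_logb_iff_rpow_lt hb1 (by linarith)).2 hs1
  · refine lt_of_H_lt hb hq ?_
    rw [H_base hM hs]
    exact (Real.logb_lt_iff_lt_rpow hb1 (by linarith)).2 hs2

/-- Every punctured neighbourhood of a point of the bifurcation set contains the base of a
kneading sequence whose slope is not a root of `2`. -/
theorem exists_base_near (hM : 1 ≤ M) {q : ℝ} (hq : q ∈ bifurcationSet M) {ε : ℝ} (hε : 0 < ε) :
    ∃ s ∈ Set.Ioc (1 : ℝ) (M + 1), (∀ j, 1 ≤ j → s ^ j ≠ 2) ∧ |base M s - q| < ε ∧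
      base M s ≠ q := by
  obtain ⟨p, hp, ⟨hp1, hp2⟩, hne⟩ := hq.2 ε hε
  rcases lt_or_gt_of_ne hne with h | h
  · obtain ⟨s, hs, hsj, h1, h2⟩ := exists_base_between hM hp hq.1 h
    exact ⟨s, hs, hsj, abs_lt.2 ⟨by linarith, by linarith⟩, h2.ne⟩
  · obtain ⟨s, hs, hsj, h1, h2⟩ := exists_base_between hM hq.1 hp h
    exact ⟨s, hs, hsj, abs_lt.2 ⟨by linarith, by linarith⟩, h1.ne'⟩

theorem bifurcationSet_subset (hM : 1 ≤ M) :
    bifurcationSet M ⊆ Set.Icc (komornikLoreti M) (M + 1) := by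
  intro q hq
  refine ⟨?_, hq.1.2⟩
  by_contra hc
  push Not at hc
  obtain ⟨p, hp, ⟨-, hp2⟩, hne⟩ := hq.2 (komornikLoreti M - q) (by linarith)
  rw [H_eq_zero_of_le hM hp (by linarith), H_eq_zero_of_le hM hq.1 hc.le] at hne
  exact hne rfl

theorem isClosed_bifurcationSet (hM : 1 ≤ M) : IsClosed (bifurcationSet M) := by
  refine isClosed_of_closure_subset fun q hq => ?_
  have hqI := closure_minimal (bifurcationSet_subset hM) isClosed_Icc hq
  have hqc := (komornikLoreti_spec hM).1.1
  refine ⟨⟨hqc.trans_le hqI.1, hqI.2⟩, fun ε hε => ?_⟩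
  obtain ⟨r, hr, hrq⟩ := Metric.mem_closure_iff.1 hq (ε / 2) (by linarith)
  obtain ⟨p, hp, ⟨hp1, hp2⟩, hne⟩ := hr.2 (ε / 2) (by linarith)
  rw [Real.dist_eq, abs_lt] at hrq
  by_cases h : H M r = H M q
  · exact ⟨p, hp, ⟨by linarith, by linarith⟩, h ▸ hne⟩
  · exact ⟨r, hr.1, ⟨by linarith, by linarith⟩, h⟩

theorem bifurcationSet_eq_closure (hM : 1 ≤ M) :
    bifurcationSet M = closure {q : ℝ | q ∈ Set.Ioc (komornikLoreti M) ((M : ℝ) + 1) ∧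
      ∃ a : Sequ M, IsQuasiGreedy q a ∧ (IsIrreducible a ∨ IsStarIrreducible a)} := by
  have hqc := (komornikLoreti_spec hM).1.1
  apply Set.Subset.antisymm
  · intro q hq
    refine Metric.mem_closure_iff.2 fun ε hε => ?_
    obtain ⟨s, hs, hsj, hlt, -⟩ := exists_base_near hM hq hε
    obtain ⟨hb, hba⟩ := base_spec hM hs
    refine ⟨base M s, ⟨⟨komornikLoreti_lt_base hM hs, hb.2⟩, kneading M s, ?_,
      kneading_irreducible hM hs hsj⟩, ?_⟩
    · rw [← hba]; exact isQuasiGreedy_alpha hb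
    · rwa [dist_comm, Real.dist_eq]
  · refine closure_minimal ?_ (isClosed_bifurcationSet hM)
    rintro q ⟨⟨hq1, hq2⟩, a, ha, hirr⟩
    have hq : q ∈ Set.Ioc (1 : ℝ) (M + 1) := ⟨hqc.trans hq1, hq2⟩
    rw [ha.eq_alpha hq] at hirr
    obtain ⟨s, hs, rfl⟩ := exists_eq_base_of_irreducible hM hq hq1 hirr
    exact base_mem_bifurcationSet hM hs

theorem accPt_bifurcationSet (hM : 1 ≤ M) {q : ℝ} (hq : q ∈ bifurcationSet M) :
    AccPt q (𝓟 (bifurcationSet M)) := by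
  refine accPt_iff_nhds.2 fun U hU => ?_
  obtain ⟨ε, hε, hball⟩ := Metric.mem_nhds_iff.1 hU
  obtain ⟨s, hs, -, hlt, hne⟩ := exists_base_near hM hq hε
  exact ⟨base M s, ⟨hball (by rwa [Metric.mem_ball, Real.dist_eq]), base_mem_bifurcationSet hM hs⟩,
    hne⟩

/-! ### Empty interior of the bifurcation set -/

theorem lt_of_zero_prefix {y z : Sequ M} {K : ℕ} (hy : ∀ i ≤ K, y i = 0) (hz : z K ≠ 0) :
    toLex y < toLex z := by
  by_contra hc
  rcases (not_lt.1 hc).lt_or_eq with h | h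
  · obtain ⟨k, hk, hlt⟩ := lex_lt_iff.1 h
    rcases le_or_gt k K with h1 | h1
    · rw [hy k h1] at hlt
      exact absurd hlt (Fin.not_lt_zero _)
    · exact hz ((hk K h1).trans (hy K le_rfl))
  · exact hz (by rw [toLex_inj.1 h, hy K le_rfl])

/-- Since the reflection of `a` has a non-zero digit at `K`, no sequence of `strictSymShift a`
contains `K + 1` zeros in a row. So the digits of `a` after such a run of zeros do not matter. -/
theorem strictSymShift_subset_of_zero_run {a b : Sequ M} {m K : ℕ}
    (hab : ∀ i ≤ m + K, a i = b i) (h0 : ∀ i ≤ K, a (m + i) = 0) (hK : a K < Fin.last M) :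
    strictSymShift a ⊆ strictSymShift b := by
  have key : ∀ x ∈ strictSymShift a, ∀ n, toLex (shift n x) < toLex b := by
    intro x hx n
    obtain ⟨k, hk, hlt⟩ := lex_lt_iff.1 (hx n).2
    rcases le_or_gt k (m + K) with h | h
    · exact lex_lt_of k (fun i hi => by rw [hk i hi, hab i (by omega)]) (by rwa [← hab k h])
    · exfalso
      refine absurd (hx (n + m)).1 (lt_of_zero_prefix (K := K) (fun i hi => ?_) ?_).not_gt
      · rw [← shift_shift, shift_apply, hk _ (by omega), h0 i hi]
      · intro h
        rw [reflect, Fin.rev_eq_iff, Fin.rev_zero] at h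
        exact hK.ne h
  refine fun x hx n => ⟨?_, key x hx n⟩
  rw [reflect_lt_comm, ← shift_reflect]
  refine key (reflect x) (fun l => ?_) n
  rw [shift_reflect, reflect_lt_reflect, reflect_lt_comm]
  exact ⟨(hx l).2, (hx l).1⟩

/-- `(a₁…aₘ0^N)^∞`. -/
def padded (a : Sequ M) (m N : ℕ) : Sequ M := cyc (m + N) (concat m a 0)

theorem padded_of_lt {a : Sequ M} {m N i : ℕ} (hi : i < m) : padded a m N i = a i := by
  simp only [padded, cyc, concat]
  rw [Nat.mod_eq_of_lt (by omega), if_pos hi]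

theorem padded_of_ge {a : Sequ M} {m N i : ℕ} (hi : m ≤ i) (hi' : i < m + N) :
    padded a m N i = 0 := by
  simp only [padded, cyc, concat]
  rw [Nat.mod_eq_of_lt (by omega), if_neg (by omega)]
  rfl

theorem shift_padded_mod (a : Sequ M) (m N r : ℕ) :
    shift r (padded a m N) = shift (r % (m + N)) (padded a m N) := by
  funext i
  simp only [shift, padded, cyc, Nat.mod_add_mod]

theorem shift_padded_le {a : Sequ M} (ha : ∀ n, toLex (shift n a) ≤ toLex a) {m N : ℕ}
    (hm : 0 < m) (hmN : m ≤ N) (h0 : a 0 ≠ 0) (hlast : a (m - 1) ≠ 0) (r : ℕ) :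
    toLex (shift r (padded a m N)) ≤ toLex (padded a m N) := by
  rw [shift_padded_mod]
  have hr : r % (m + N) < m + N := Nat.mod_lt _ (by omega)
  generalize r % (m + N) = r at hr
  by_contra hc
  obtain ⟨k, hk, hlt⟩ := lex_lt_iff.1 (not_le.1 hc)
  simp only [shift_apply] at hk hlt
  rcases lt_or_ge r m with hrm | hrm
  · rcases Nat.eq_zero_or_pos r with rfl | hr0
    · rw [Nat.zero_add] at hlt
      exact lt_irrefl _ hlt
    rcases lt_or_ge (r + k) m with h1 | h1
    · refine absurd (ha r) (not_le.2 (lex_lt_of k (fun i hi => ?_) ?_))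
      · rw [shift_apply, ← padded_of_lt (a := a) (N := N) (by omega : i < m), hk i hi,
          padded_of_lt (by omega)]
      · rwa [padded_of_lt (by omega), padded_of_lt h1] at hlt
    · rcases lt_or_ge (r + k) (m + N) with h2 | h2
      · rw [padded_of_ge h1 h2] at hlt
        exact absurd hlt (Fin.not_lt_zero _)
      · -- The run of zeros would be matched with a stretch containing the digit `aₘ`.
        have := hk (m - 1) (by omega)
        rw [padded_of_lt (by omega), padded_of_ge (by omega) (by omega)] at this
        exact hlast this
  · rcases Nat.eq_zero_or_pos k with rfl | hk0
    · rw [add_zero, padded_of_ge hrm hr] at hlt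
      exact absurd hlt (Fin.not_lt_zero _)
    · have := hk 0 hk0
      rw [padded_of_lt hm, add_zero, padded_of_ge hrm hr] at this
      exact h0 this

theorem isInfinite_padded {a : Sequ M} {m N : ℕ} (hm : 0 < m) (h0 : a 0 ≠ 0) :
    IsInfinite (padded a m N) := by
  refine fun n => ⟨n * (m + N), Nat.le_mul_of_pos_right _ (by omega), ?_⟩
  have h := congrFun (shift_padded_mod a m N (n * (m + N))) 0
  rw [Nat.mul_mod_left, shift_zero, shift_apply, add_zero, padded_of_lt hm] at h
  rwa [h]

/-- Between any two bases there is an interval on which the entropy is constant: there the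
quasi-greedy expansions have a common long run of zeros. -/
theorem exists_Ioo_H_eq (hM : 1 ≤ M) {p q : ℝ} (hp : p ∈ Set.Ioc (1 : ℝ) (M + 1))
    (hq : q ∈ Set.Ioc (1 : ℝ) (M + 1)) (hpq : p < q) :
    ∃ u v, p < u ∧ u < v ∧ v < q ∧ ∀ r ∈ Set.Ioo u v, ∀ r' ∈ Set.Ioo u v, H M r = H M r' := by
  obtain ⟨q', hpq', hq'q⟩ := exists_between hpq
  have hq' : q' ∈ Set.Ioc (1 : ℝ) (M + 1) := ⟨hp.1.trans hpq', hq'q.le.trans hq.2⟩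
  set a := alpha M q'
  obtain ⟨d, hd, hdlt⟩ := lex_lt_iff.1 (alpha_lt_alpha hp hq' hpq')
  obtain ⟨K, hK, hKlt⟩ := lex_lt_iff.1 (alpha_lt_alpha hq' hq hq'q)
  have ha : ∀ n, toLex (shift n a) ≤ toLex a := shift_alpha_le hq'
  have hinf : IsInfinite a := (isQuasiGreedy_alpha hq').1.1
  have h0 : a 0 ≠ 0 := by
    obtain ⟨i, -, hi⟩ := hinf 0
    have := Pi.apply_le_of_toLex (ha i) (i := 0) (by simp)
    rw [shift_apply, add_zero] at this
    intro h
    rw [h] at this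
    exact hi (Fin.le_zero_iff.1 this)
  obtain ⟨l, hl, hlast⟩ := hinf (max d K)
  have hdl := (le_max_left d K).trans hl
  have hKl := (le_max_right d K).trans hl
  have hc : ∀ N, l + 1 ≤ N → ∃ r ∈ Set.Ioc (1 : ℝ) (M + 1), alpha M r = padded a (l + 1) N ∧
      p < r ∧ r < q := by
    intro N hN
    obtain ⟨r, hr, hra⟩ := exists_base hM (isInfinite_padded (N := N) l.succ_pos h0)
      (shift_padded_le ha l.succ_pos hN h0 hlast)
    refine ⟨r, hr, hra, lt_of_alpha_lt hp hr ?_, lt_of_alpha_lt hr hq ?_⟩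
    · rw [hra]
      exact lex_lt_of d (fun i hi => by rw [padded_of_lt (by omega), hd i hi])
        (by rwa [padded_of_lt (by omega)])
    · rw [hra]
      exact lex_lt_of K (fun i hi => (padded_of_lt (by omega)).trans (hK i hi))
        (by rwa [padded_of_lt (by omega)])
  obtain ⟨v, hv, hva, -, hvq⟩ := hc (l + 1) le_rfl
  obtain ⟨u, hu, hua, hpu, -⟩ := hc (l + 2) (by omega)
  have hagree : ∀ i < 2 * (l + 1), padded a (l + 1) (l + 2) i = padded a (l + 1) (l + 1) i := by
    intro i hi
    rcases lt_or_ge i (l + 1) with h | h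
    · rw [padded_of_lt h, padded_of_lt h]
    · rw [padded_of_ge h (by omega), padded_of_ge h (by omega)]
  have huv : u < v := by
    refine lt_of_alpha_lt hu hv ?_
    rw [hua, hva]
    refine lex_lt_of (2 * (l + 1)) hagree ?_
    have h := congrFun (shift_padded_mod a (l + 1) (l + 1) (l + 1 + (l + 1))) 0
    rw [Nat.mod_self, shift_zero, shift_apply, add_zero, padded_of_lt l.succ_pos] at h
    rw [padded_of_ge (by omega) (by omega), two_mul, h]
    exact Fin.pos_iff_ne_zero.2 h0
  have hpre : ∀ r ∈ Set.Ioo u v, r ∈ Set.Ioc (1 : ℝ) (M + 1) ∧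
      ∀ i < 2 * (l + 1), alpha M r i = padded a (l + 1) (l + 1) i := by
    intro r hr
    have hr' : r ∈ Set.Ioc (1 : ℝ) (M + 1) := ⟨hu.1.trans hr.1, hr.2.le.trans hv.2⟩
    have h1 := (alpha_lt_alpha hu hr' hr.1).le
    have h2 := (alpha_lt_alpha hr' hv hr.2).le
    rw [hua] at h1
    rw [hva] at h2
    exact ⟨hr', agree_of_le_of_le h1 h2 hagree⟩
  have hle : ∀ r ∈ Set.Ioo u v, ∀ r' ∈ Set.Ioo u v, H M r ≤ H M r' := by
    intro r hr r' hr'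
    obtain ⟨h1, h2⟩ := hpre r hr
    obtain ⟨h3, h4⟩ := hpre r' hr'
    refine H_le_H h1 h3 (strictSymShift_subset_of_zero_run (m := l + 1) (K := K)
      (fun i hi => ?_) (fun i hi => ?_) ?_)
    · rw [h2 i (by omega), h4 i (by omega)]
    · rw [h2 _ (by omega), padded_of_ge (by omega) (by omega)]
    · rw [h2 _ (by omega), padded_of_lt (by omega)]
      exact hKlt.trans_le (Fin.le_last _)
  exact ⟨u, v, hpu, huv, hvq, fun r hr r' hr' => le_antisymm (hle r hr r' hr') (hle r' hr' r hr)⟩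

theorem interior_bifurcationSet (hM : 1 ≤ M) : interior (bifurcationSet M) = ∅ := by
  refine Set.eq_empty_of_forall_notMem fun q hq => ?_
  obtain ⟨ε, hε, hball⟩ := Metric.mem_nhds_iff.1 (mem_interior_iff_mem_nhds.1 hq)
  have hqI := (interior_subset hq).1
  obtain ⟨p, hp1, hp2⟩ := exists_between (max_lt hqI.1 (by linarith : q - ε < q))
  obtain ⟨u, v, hpu, huv, hvq, hH⟩ := exists_Ioo_H_eq hM
    ⟨(le_max_left _ _).trans_lt hp1, hp2.le.trans hqI.2⟩ hqI hp2
  have hpε := (le_max_right _ _).trans_lt hp1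
  have hmid : (u + v) / 2 ∈ bifurcationSet M := by
    refine hball ?_
    rw [Metric.mem_ball, Real.dist_eq, abs_lt]
    constructor <;> linarith
  obtain ⟨r, -, ⟨hr1, hr2⟩, hne⟩ := hmid.2 ((v - u) / 2) (by linarith)
  exact hne (hH r ⟨by linarith, by linarith⟩ _ ⟨by linarith, by linarith⟩)

/-! ### The Hausdorff dimension of the bifurcation set -/

/-- The difference of the orbits of `1` for two slopes grows like a geometric sequence as long as
the digits agree, and it is at most `2`. -/
theorem slope_sub_mul_pow_le (hM : 1 ≤ M) {s t : ℝ} (hs : s ∈ Set.Ioc (1 : ℝ) (M + 1))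
    (ht : t ∈ Set.Ioc (1 : ℝ) (M + 1)) (hst : s < t) (hsM : (M : ℝ) + 7 / 10 ≤ s) {n : ℕ}
    (h : ∀ i < n, kneading M s i = kneading M t i) :
    (t - s) * s ^ n ≤ 8 * ((M : ℝ) + 1) ^ 2 := by
  have hMR : (1 : ℝ) ≤ M := by exact_mod_cast hM
  have hpow : (t - s) * s ^ n ≤ (t - s) * t ^ n :=
    mul_le_mul_of_nonneg_left (pow_le_pow_left₀ (by linarith [hs.1]) hst.le n) (by linarith)
  refine hpow.trans ?_
  rcases lt_or_ge n 2 with hn | hn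
  · have h1 : t ^ n ≤ t ^ 1 := pow_le_pow_right₀ ht.1.le (by omega)
    nlinarith [hs.1, ht.1, ht.2]
  obtain ⟨n, rfl⟩ := Nat.exists_eq_add_of_le' hn
  have hrec : ∀ i < n + 2, remainder t (kneading M t) (i + 1) - remainder s (kneading M s) (i + 1) =
      t * (remainder t (kneading M t) i - remainder s (kneading M s) i) +
        (t - s) * remainder s (kneading M s) i := by
    intro i hi
    simp only [remainder, h i hi]
    ring
  have ht1 : (7 / 10 : ℝ) ≤ t - 1 := by linarith
  have hf : (t - 1)⁻¹ * (t - 1) = 1 := inv_mul_cancel₀ (by linarith)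
  have hf0 : 0 < (t - 1)⁻¹ := inv_pos.2 (by linarith)
  have key : ∀ i, i ≤ n → (t - s) * (t ^ i / 4 + (t - 1)⁻¹) ≤
      remainder t (kneading M t) (i + 2) - remainder s (kneading M s) (i + 2) := by
    intro i
    induction i with
    | zero =>
      intro _
      have h0 := hrec 0 (by omega)
      have h1 := hrec 1 (by omega)
      have h2 : 0 ≤ remainder s (kneading M s) 1 := by
        simp only [remainder]
        linarith [sgn_le (kneading M s 0)]
      have h3 : remainder s (kneading M s) 0 = 1 := rfl
      have h4 : remainder t (kneading M t) 0 = 1 := rfl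
      rw [h3, h4, sub_self, mul_zero, zero_add, mul_one] at h0
      rw [h0] at h1
      rw [h1]
      -- The bound `M + 7 / 10` on the slopes is there to make this hold also for `M = 1`.
      have h5 : 1 / 4 + (t - 1)⁻¹ ≤ t := by nlinarith
      rw [pow_zero]
      nlinarith
    | succ i ih =>
      intro hi
      have h1 := hrec (i + 2) (by omega)
      have h2 := (remainder_kneading hs (i + 2)).1
      have h3 := mul_le_mul_of_nonneg_left (ih (by omega)) (by linarith : (0 : ℝ) ≤ t)
      have h4 := mul_le_mul_of_nonneg_left h2.le (by linarith : (0 : ℝ) ≤ t - s)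
      rw [show i + 1 + 2 = i + 2 + 1 by ring, h1]
      have h5 : (t - s) * (t ^ (i + 1) / 4 + (t - 1)⁻¹) =
          t * ((t - s) * (t ^ i / 4 + (t - 1)⁻¹)) + (t - s) * -1 := by
        rw [pow_succ]
        linear_combination (-(t - s)) * hf
      linarith
  have h1 := key n le_rfl
  have h2 := (remainder_kneading ht (n + 2)).2
  have h3 := (remainder_kneading hs (n + 2)).1
  have h4 : 0 ≤ (t - s) * (t - 1)⁻¹ := mul_nonneg (by linarith) hf0.le
  have h5 : (t - s) * t ^ n ≤ 8 := by linarith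
  have h6 : t ^ 2 ≤ ((M : ℝ) + 1) ^ 2 := pow_le_pow_left₀ (by linarith [ht.1]) ht.2 2
  calc (t - s) * t ^ (n + 2) = (t - s) * t ^ n * t ^ 2 := by ring
    _ ≤ 8 * ((M : ℝ) + 1) ^ 2 := mul_le_mul h5 h6 (by positivity) (by norm_num)

theorem inv_pow_le_expand {q : ℝ} (hq : 1 < q) {x : Sequ M} {i : ℕ} (hi : x i ≠ 0) :
    1 / q ^ (i + 1) ≤ expand q x := by
  have h1 : (1 : ℝ) ≤ ((x i : ℕ) : ℝ) := by
    exact_mod_cast Nat.pos_of_ne_zero fun h => hi (Fin.ext h)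
  refine le_trans ?_ ((summable_expand hq x).le_tsum i fun j _ => by positivity)
  gcongr

/-- If `α(p)` and `α(q)` part at the index `n`, and `α(q)` has no long run of zeros after it, then
`q - p` is not much smaller than `(M + 1) ^ (-n)`. -/
theorem one_le_mul_base_sub {r p q : ℝ} (hr : 1 < r) (hp : p ∈ Set.Ioc (1 : ℝ) (M + 1))
    (hq : q ∈ Set.Ioc (1 : ℝ) (M + 1)) (hrp : r ≤ p) (hpq : p < q) {n R i : ℕ}
    (h : ∀ i < n, alpha M p i = alpha M q i) (hn : alpha M p n < alpha M q n) (hi : i ≤ R)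
    (hne : alpha M q (n + 1 + i) ≠ 0) :
    1 ≤ ((M : ℝ) + 1) ^ (R + 2) * (M / (r - 1) / (r - 1)) * (q - p) * ((M : ℝ) + 1) ^ n := by
  have h1 := expand_sub hp.1 h
  have h2 : ((alpha M p n : ℕ) : ℝ) + 1 ≤ ((alpha M q n : ℕ) : ℝ) := by
    exact_mod_cast Fin.lt_def.1 hn
  have h3 := (expand_shift_alpha hp (n + 1)).2
  have h4 := inv_pow_le_expand hp.1 (x := shift (n + 1) (alpha M q)) (i := i) hne
  have h5 := abs_expand_sub_le hr hrp (hrp.trans hpq.le) (alpha M q)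
  rw [expand_alpha hq] at h5
  rw [expand_alpha hp] at h1
  have h6 := (le_abs_self _).trans h5
  rw [abs_sub_comm, abs_of_pos (by linarith : 0 < q - p)] at h6
  have hp0 : (0 : ℝ) < p := by linarith [hp.1]
  have h7 : p ^ (n + 1) * (M / (r - 1) / (r - 1) * (q - p)) ≥ 1 / p ^ (i + 1) := by
    have := mul_le_mul_of_nonneg_left h6 (by positivity : 0 ≤ p ^ (n + 1))
    linarith
  have h8 : 0 ≤ (M : ℝ) / (r - 1) / (r - 1) * (q - p) := by
    have : 0 < r - 1 := by linarith
    have : 0 < q - p := by linarith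
    positivity
  have h9 : 1 ≤ p ^ (n + i + 2) * (M / (r - 1) / (r - 1) * (q - p)) := by
    have := mul_le_mul_of_nonneg_left h7 (by positivity : 0 ≤ p ^ (i + 1))
    rw [mul_one_div_cancel (by positivity)] at this
    calc (1 : ℝ) ≤ _ := this
      _ = _ := by ring
  have h10 : p ^ (n + i + 2) ≤ ((M : ℝ) + 1) ^ (n + (R + 2)) :=
    (pow_le_pow_left₀ hp0.le hp.2 _).trans (pow_le_pow_right₀ (by linarith [hp.1, hp.2]) (by omega))
  calc (1 : ℝ) ≤ _ := h9
    _ ≤ _ := mul_le_mul_of_nonneg_right h10 h8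
    _ = _ := by rw [pow_add]; ring

/-- The inverse of `s ↦ base M s`, given by the entropy, is Hölder continuous with any exponent
`γ < 1` on the bases of the slopes that are close to `M + 1`. -/
theorem exists_holder (hM : 1 ≤ M) {γ s₀ s₁ : ℝ} (hγ : 0 < γ) (hs₀ : (M : ℝ) + 7 / 10 ≤ s₀)
    (hγs : ((M : ℝ) + 1) ^ γ ≤ s₀) (hs₁ : s₀ < s₁) (hs₁M : s₁ < M + 1) :
    ∃ C : ℝ, 0 ≤ C ∧ ∀ s ∈ Set.Ioo s₀ s₁, ∀ t ∈ Set.Ioo s₀ s₁, s < t →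
      t - s ≤ C * (base M t - base M s) ^ γ := by
  have hMR : (1 : ℝ) ≤ M := by exact_mod_cast hM
  have hI : ∀ s, s₀ ≤ s → s ≤ M + 1 → s ∈ Set.Ioc (1 : ℝ) (M + 1) := fun s h1 h2 =>
    ⟨by linarith, h2⟩
  have hI₁ := hI s₁ hs₁.le hs₁M.le
  obtain ⟨R, -, hR⟩ := lex_lt_iff.1
    (kneading_strictMono hM hI₁ (hI (M + 1) (by linarith) le_rfl) hs₁M)
  have hr := (base_spec hM (hI s₀ le_rfl (by linarith))).1.1
  set r := base M s₀
  set D : ℝ := ((M : ℝ) + 1) ^ (R + 2) * (M / (r - 1) / (r - 1)) with hD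
  have hD0 : 0 ≤ D := by
    have : 0 < r - 1 := by linarith
    positivity
  refine ⟨8 * ((M : ℝ) + 1) ^ 2 * D ^ γ, by positivity, fun s hs t ht hst => ?_⟩
  have hsI := hI s hs.1.le (by linarith [hs.2])
  have htI := hI t ht.1.le (by linarith [ht.2])
  obtain ⟨hp, hpa⟩ := base_spec hM hsI
  obtain ⟨hq, hqa⟩ := base_spec hM htI
  obtain ⟨n, hn, hnlt⟩ := lex_lt_iff.1 (kneading_strictMono hM hsI htI hst)
  -- The tails of the kneading sequence of `t` exceed the reflection of that of `s₁`.
  obtain ⟨i, hi, hne⟩ : ∃ i ≤ R, kneading M t (n + 1 + i) ≠ 0 := by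
    by_contra hc
    push Not at hc
    refine absurd (lt_of_zero_prefix (y := shift (n + 1) (kneading M t))
      (z := reflect (kneading M s₁)) (K := R) hc fun h => ?_) (not_lt.2 ?_)
    · rw [reflect, Fin.rev_eq_iff, Fin.rev_zero] at h
      exact (hR.trans_le (Fin.le_last _)).ne h
    · exact (reflect_le_reflect.2 (kneading_strictMono hM htI hI₁ ht.2).le).trans
        (kneading_mem_seqV htI (n + 1)).1
  have h1 := one_le_mul_base_sub hr hp hq
    (base_strictMono hM (hI s₀ le_rfl (by linarith)) hsI hs.1).le (base_strictMono hM hsI htI hst)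
    (by rwa [hpa, hqa]) (by rwa [hpa, hqa]) hi (by rwa [hqa])
  rw [← hD] at h1
  have h2 := slope_sub_mul_pow_le hM hsI htI hst (by linarith [hs.1]) hn
  have hd0 : 0 ≤ base M t - base M s := by linarith [base_strictMono hM hsI htI hst]
  have hB0 : (0 : ℝ) ≤ (M : ℝ) + 1 := by positivity
  have h3 : (1 : ℝ) ≤ D ^ γ * (base M t - base M s) ^ γ * (((M : ℝ) + 1) ^ n) ^ γ := by
    rw [← Real.mul_rpow hD0 hd0, ← Real.mul_rpow (by positivity) (by positivity)]
    exact Real.one_le_rpow h1 hγ.le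
  have h4 : (((M : ℝ) + 1) ^ n) ^ γ ≤ s ^ n := by
    rw [← Real.rpow_natCast, ← Real.rpow_mul hB0, mul_comm, Real.rpow_mul hB0, Real.rpow_natCast]
    exact pow_le_pow_left₀ (by positivity) (hγs.trans hs.1.le) n
  have hX : 0 ≤ D ^ γ * (base M t - base M s) ^ γ := by positivity
  calc t - s ≤ (t - s) * (D ^ γ * (base M t - base M s) ^ γ * (((M : ℝ) + 1) ^ n) ^ γ) :=
        le_mul_of_one_le_right (by linarith) h3
    _ ≤ (t - s) * (D ^ γ * (base M t - base M s) ^ γ * s ^ n) :=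
        mul_le_mul_of_nonneg_left (mul_le_mul_of_nonneg_left h4 hX) (by linarith)
    _ = (t - s) * s ^ n * (D ^ γ * (base M t - base M s) ^ γ) := by ring
    _ ≤ 8 * ((M : ℝ) + 1) ^ 2 * (D ^ γ * (base M t - base M s) ^ γ) :=
        mul_le_mul_of_nonneg_right h2 hX
    _ = _ := by ring

open scoped NNReal ENNReal in
theorem dimH_bifurcationSet (hM : 1 ≤ M) : dimH (bifurcationSet M) = 1 := by
  have hMR : (1 : ℝ) ≤ M := by exact_mod_cast hM
  have hb1 : (1 : ℝ) < M + 1 := by linarith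
  refine le_antisymm ((dimH_mono (Set.subset_univ _)).trans_eq Real.dimH_univ)
    (ENNReal.le_of_forall_nnreal_lt fun γ hγ1 => ?_)
  rcases eq_or_ne γ 0 with rfl | hγ
  · simp
  have hγ0 : (0 : ℝ) < γ := NNReal.coe_pos.2 (pos_iff_ne_zero.2 hγ)
  have hγ1 : (γ : ℝ) < 1 := by exact_mod_cast hγ1
  obtain ⟨s₀, hs₀, hs₀M⟩ := exists_between (max_lt (by linarith : (M : ℝ) + 7 / 10 < M + 1)
    ((Real.rpow_lt_rpow_of_exponent_lt hb1 hγ1).trans_eq (Real.rpow_one _)))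
  obtain ⟨s₁, hs₁, hs₁M⟩ := exists_between hs₀M
  have h7 := (le_max_left _ _).trans hs₀.le
  obtain ⟨C, hC, hhol⟩ := exists_holder hM hγ0 h7 ((le_max_right _ _).trans hs₀.le) hs₁ hs₁M
  have hI : ∀ s ∈ Set.Ioo s₀ s₁, s ∈ Set.Ioc (1 : ℝ) (M + 1) := fun s hs =>
    ⟨by linarith [hs.1], by linarith [hs.2]⟩
  have hG : ∀ s ∈ Set.Ioo s₀ s₁, ((M : ℝ) + 1) ^ H M (base M s) = s := fun s hs => by
    rw [H_base hM (hI s hs), Real.rpow_logb (by linarith) hb1.ne' (by linarith [(hI s hs).1])]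
  have hle : ∀ s ∈ Set.Ioo s₀ s₁, ∀ t ∈ Set.Ioo s₀ s₁,
      |s - t| ≤ C * |base M s - base M t| ^ (γ : ℝ) := by
    intro s hs t ht
    rcases lt_trichotomy s t with h | rfl | h
    · rw [abs_sub_comm, abs_sub_comm (base M s), abs_of_pos (sub_pos.2 h),
        abs_of_pos (sub_pos.2 (base_strictMono hM (hI s hs) (hI t ht) h))]
      exact hhol s hs t ht h
    · rw [sub_self, abs_zero]
      positivity
    · rw [abs_of_pos (sub_pos.2 h),
        abs_of_pos (sub_pos.2 (base_strictMono hM (hI t ht) (hI s hs) h))]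
      exact hhol t ht s hs h
  have hH : HolderOnWith C.toNNReal γ (fun q => ((M : ℝ) + 1) ^ H M q)
      (base M '' Set.Ioo s₀ s₁) := by
    rintro _ ⟨s, hs, rfl⟩ _ ⟨t, ht, rfl⟩
    simp only [hG s hs, hG t ht]
    rw [edist_dist, edist_dist, Real.dist_eq, Real.dist_eq,
      ENNReal.ofReal_rpow_of_nonneg (abs_nonneg _) hγ0.le]
    change _ ≤ ENNReal.ofReal C * _
    rw [← ENNReal.ofReal_mul hC]
    exact ENNReal.ofReal_le_ofReal (hle s hs t ht)
  have himg : (fun q => ((M : ℝ) + 1) ^ H M q) '' (base M '' Set.Ioo s₀ s₁) = Set.Ioo s₀ s₁ := by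
    rw [Set.image_image]
    exact (Set.image_congr hG).trans (Set.image_id' _)
  have h1 := hH.dimH_image_le (NNReal.coe_pos.1 hγ0)
  rw [himg, Real.dimH_of_nonempty_interior (by rw [interior_Ioo]; exact Set.nonempty_Ioo.2 hs₁),
    Module.finrank_self, Nat.cast_one, ENNReal.le_div_iff_mul_le (Or.inl (by exact_mod_cast hγ))
    (Or.inl ENNReal.coe_ne_top), one_mul] at h1
  refine h1.trans (dimH_mono ?_)
  rintro _ ⟨s, hs, rfl⟩
  exact base_mem_bifurcationSet hM (hI s hs)

end UniqueExpansions

theorem theorem3 (M : ℕ) (hM : 1 ≤ M) :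
    UniqueExpansions.bifurcationSet M =
        closure {q : ℝ | q ∈ Set.Ioc (UniqueExpansions.komornikLoreti M) ((M : ℝ) + 1) ∧
          ∃ a : UniqueExpansions.Sequ M, UniqueExpansions.IsQuasiGreedy q a ∧
            (UniqueExpansions.IsIrreducible a ∨ UniqueExpansions.IsStarIrreducible a)} ∧
      UniqueExpansions.IsCantorSet (UniqueExpansions.bifurcationSet M) ∧
      dimH (UniqueExpansions.bifurcationSet M) = 1 := by
  have hmem := UniqueExpansions.base_mem_bifurcationSet (s := M + 1) hM
    ⟨by simpa using Nat.succ_le_iff.1 hM, le_rfl⟩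
  exact ⟨UniqueExpansions.bifurcationSet_eq_closure hM, ⟨⟨_, hmem⟩,
    isCompact_Icc.of_isClosed_subset (UniqueExpansions.isClosed_bifurcationSet hM)
      (UniqueExpansions.bifurcationSet_subset hM),
    UniqueExpansions.interior_bifurcationSet hM, fun _ hq =>
      UniqueExpansions.accPt_bifurcationSet hM hq⟩,
    UniqueExpansions.dimH_bifurcationSet hM⟩
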